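/- Let $p>2$ be a prime and let $$1\to N\to E\to H\to 1$$ be a central extension of profinite groups, where $N\cong\mathbb Z_p^r$ and $H\cong\mathbb Z_p^s$ are finitely generated free abelian pro-$p$ groups of ranks $r=\operatorname{rk} N$ and $s=\operatorname{rk} H$. A central extension $1\to\bar N\to\bar E\to\bar H\to 1$ of finite elementary abelian $p$-groups is called a *finite Heisenberg group* if its class in $H^2(\bar H,\bar N)$ is represented by an alternating bilinear form $\bar H\times\bar H\to\bar N$. A *mod $p$ reduction* of $E$ is a map of central extensions $$\begin{array}{ccccccccc}1&\to& N&\to& E&\to& H&\to& 1\\ &&\downarrow&&\downarrow&&\downarrow&&\\ 1&\to&\bar N&\to&\bar E&\to&\bar H&\to& 1\end{array}$$ (with $E\to\bar E$ continuous) which identifies $\bar N$ with $N/pN$ and $\bar H$ with $H/pH$, and such that $\bar E$ is a finite Heisenberg group. **Proposition.** Let $\bar E$ be a mod $p$ reduction of $E$. If $$p>\tfrac12\left(\operatorname{rk} H+3\operatorname{rk} N+1\right),$$ then the map of cohomology rings $H^*(\bar E,\mathbb F_p)\to H^*(E,\mathbb F_p)$ induced by $E\to\bar E$ is surjective, i.e.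 $H^n(\bar E,\mathbb F_p)\to H^n(E,\mathbb F_p)$ is surjective for every $n\ge 0$. Here $H^*(E,\mathbb F_p)$ denotes continuous cohomology with coefficients in the discrete trivial module $\mathbb F_p$. -/

import Mathlib

open CategoryTheory

universe u v w v' w'

/-- The multiplicatively written topological abelian group `A` is a finitely generated free abelian
pro-`p` group of rank `r`, i.e. `A ≅ ℤ_p ^ r` as topological groups. -/
def IsFreeAbelianProP (p : ℕ) [Fact p.Prime] (r : ℕ) (A : Type*) [CommGroup A]
    [TopologicalSpace A] : Prop :=
  Nonempty (A ≃ₜ* Multiplicative (Fin r → ℤ_[p]))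

/-- A (topological) central extension `1 → N → E → H → 1` in which `N ≅ ℤ_p ^ r` and
`H ≅ ℤ_p ^ s`. It is used with `E` a profinite group; exactness is part of `GroupExtension`. -/
structure IsFreeProPCentralExtension (p : ℕ) [Fact p.Prime] (r s : ℕ)
    {N : Type v} {E : Type u} {H : Type w} [CommGroup N] [TopologicalSpace N]
    [Group E] [TopologicalSpace E] [CommGroup H] [TopologicalSpace H]
    (S : GroupExtension N E H) : Prop where
  free_left : IsFreeAbelianProP p r N
  free_right : IsFreeAbelianProP p s H
  continuous_inl : Continuous S.inl
  continuous_rightHom : Continuous S.rightHom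
  central : S.inl.range ≤ Subgroup.center E

/-- A finite Heisenberg group: a central extension `1 → N → E → H → 1` of finite elementary abelian
`p`-groups whose class in `H²(H, N)` is represented by an alternating bilinear form.

The class of the extension is that of the factor set of any set-theoretic section, and it is
represented by a 2-cocycle `c` exactly when some section `σ` has factor set `c`. In that case
`(n, h) ↦ n σ(h)` identifies `E` with `N × H` under the law
`(n₁, h₁) (n₂, h₂) = (n₁ + n₂ + c(h₁, h₂), h₁ + h₂)` (written additively in `N` and `H`). -/
structure IsFiniteHeisenberg (p : ℕ) {N : Type v} {E : Type u} {H : Type w} [CommGroup N]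
    [Group E] [CommGroup H] (S : GroupExtension N E H) : Prop where
  finite_left : Finite N
  finite_right : Finite H
  pow_left : ∀ n : N, n ^ p = 1
  pow_right : ∀ h : H, h ^ p = 1
  central : S.inl.range ≤ Subgroup.center E
  exists_alternating : ∃ c : H →* H →* N, (∀ h, c h h = 1) ∧
    ∃ σ : S.Section, ∀ h₁ h₂ : H,
      σ.toFun h₁ * σ.toFun h₂ = S.inl (c h₁ h₂) * σ.toFun (h₁ * h₂)

/-- `(fN, fE, fH)` is a mod `p` reduction of the extension `S`: a map of extensions from `S` to a
finite Heisenberg group `S'` such that `fN` and `fH` induce isomorphisms `N / pN ≅ N'` and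
`H / pH ≅ H'` (`powMonoidHom p` is multiplication by `p`, written multiplicatively). -/
structure IsModPReduction (p : ℕ) {N : Type v} {E : Type u} {H : Type w}
    {N' : Type v'} {E' : Type u} {H' : Type w'}
    [CommGroup N] [Group E] [TopologicalSpace E] [CommGroup H]
    [CommGroup N'] [Group E'] [TopologicalSpace E'] [CommGroup H']
    (S : GroupExtension N E H) (S' : GroupExtension N' E' H')
    (fN : N →* N') (fE : E →ₜ* E') (fH : H →* H') : Prop where
  comm_inl : ∀ n : N, fE (S.inl n) = S'.inl (fN n)
  comm_rightHom : ∀ e : E, S'.rightHom (fE e) = fH (S.rightHom e)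
  surjective_left : Function.Surjective fN
  ker_left : fN.ker = (powMonoidHom p : N →* N).range
  surjective_right : Function.Surjective fH
  ker_right : fH.ker = (powMonoidHom p : H →* H).range
  heisenberg : IsFiniteHeisenberg p S'

instance instContinuousSMulULiftZMod (p : ℕ) : ContinuousSMul (ZMod p) (ULift.{u} (ZMod p)) :=
  ⟨continuous_uliftUp.comp (continuous_fst.smul (continuous_uliftDown.comp continuous_snd))⟩

/-- The field `𝔽_p`, with the discrete topology and the trivial action of `G`. The `ULift` only
adjusts the universe level to that of `G`. -/
noncomputable abbrev trivialFp (p : ℕ) (G : Type u) [Group G] : TopRep.{u} (ZMod p) G :=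
  TopRep.of (ContRepresentation.trivial (ZMod p) G (ULift.{u} (ZMod p)))

/-- The continuous cohomology group `Hⁿ(G, 𝔽_p)`. -/
noncomputable abbrev cohFp (p : ℕ) (G : Type u) [Group G] [TopologicalSpace G]
    [IsTopologicalGroup G] (n : ℕ) : TopModuleCat (ZMod p) :=
  continuousCohomology n (trivialFp p G)

/-- The map `Hⁿ(G', 𝔽_p) → Hⁿ(G, 𝔽_p)` given by pullback along `f : G → G'`. -/
noncomputable def cohFpMap (p : ℕ) {G G' : Type u} [Group G] [TopologicalSpace G]
    [IsTopologicalGroup G] [Group G'] [TopologicalSpace G'] [IsTopologicalGroup G']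
    (f : G →ₜ* G') (n : ℕ) : cohFp p G' n ⟶ cohFp p G n :=
  ContinuousCohomology.map (X := trivialFp p G') (Y := trivialFp p G) f
    (TopRep.ofHom ⟨ContinuousLinearMap.id _ _, fun _ => rfl⟩) n

/-!
The idea is to compare the spectral sequences of the two central extensions by means of weights.
If `λ` generates `𝔽_p ^ ×`, then `n ↦ n ^ (λ ^ 2)` on `N̄` and `h ↦ h ^ λ` on `H̄` come from an
endomorphism of the Heisenberg group `Ē`, because its factor set is bilinear (`exists_isScaling`).
It acts on the spectral sequence of `Ē` with order prime to `p`, so everything decomposes into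
eigenspaces for the powers `λ ^ w`, and `w` matters modulo `p - 1`. In bidegree `(i, j)` the second
page is `H^i(H̄) ⊗ H^j(N̄)`, a tensor product of exterior and symmetric algebras. Each generator of
the cohomology of `H̄` has weight `1` and each one of `N̄` has weight `2`, whether it has degree `1`
(exterior) or `2` (symmetric). Hence all weights have the form `i + 2 j - δ` with
`0 ≤ 2 δ ≤ i + 2 j`, and the part with `δ = 0` is the exterior algebra, which is exactly the second
page for `E`. That page vanishes unless `i ≤ s` and `j ≤ r`.

A permanent cycle for `E` in bidegree `(i, j)` therefore lifts to a class of weight `i + 2 j` for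
`Ē`. Its differential `d_2` lies in the part of top weight, where the comparison is injective, so
that it vanishes as it does for `E`. The differential `d_q` for `q ≥ 3` lands in bidegree
`(i + q, j + 1 - q)`, whose weights are smaller than `i + 2 j`, and the difference is at most half
of `s + 3 r - 1`. The hypothesis on `p` says that this is less than `p - 1`, so that the weight
`i + 2 j` does not occur there and the class survives. The lifts being available in every
filtration step, surjectivity follows by descending induction (`OpCx.FirstPage.surjective`).

No general theory of spectral sequences is used. The cohomology of an abelian group that acts on a
complex is computed by the total complex of a cube of commuting operators, one direction for each
generator (`OpCx.K`): `X` in the case of `ℤ_p` and `X, X ^ (p - 1), X, …` in the case of `ℤ / p`.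
Here `X = ∑ a⁻¹ T ^ a` (`wtOp`) generates the augmentation ideal, like `T - 1`, but it is an
eigenvector for the change of generator `T ↦ T ^ b`; so the endomorphism above acts on the cube
itself. The comparison `OpCx.isQI_ι` holds because locally constant cochains are acyclic, which is
seen by solving `T ψ - ψ = φ` and `∑ T ^ a ψ = φ` along a locally constant coordinate function on
the group (`Tot.exists_act_sub_eq`, `Tot.exists_norm_eq`). Applied to the central subgroups, this
gives the first page (`OpCx.firstPage_of_resolution`, `CentralGens.firstPage_inv`); the generators
of the quotients are then adjoined one at a time (`OpCx.FirstPage.step`). The result about cochains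
is `CentralGens.exists_pullback`, and `cohFpMap_surjective` translates it to continuous cohomology.
-/

/-! ### Complexes with operators -/

/-- A cochain complex of `k`-vector spaces together with a decreasing filtration and `s` families
of operators. The complex is modelled by one ambient module `M` with a differential `d`; the
submodule `G n` consists of the cochains of degree `n`, and `F i` is the `i`-th step of the
filtration. For `l : Fin s`, the maps `θ l 0, θ l 1, …` satisfy `θ l (m + 1) ∘ θ l m = 0`; they are
the coefficients of a complex `M → M → ⋯` whose terms are indexed by the elements of `S`. -/
structure OpCx (k : Type*) [Field k] (M : Type*) [AddCommGroup M] [Module k M] (S : LowerSet ℕ)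
    (s : ℕ) where
  d : M →ₗ[k] M
  G : ℤ → Submodule k M
  F : ℤ → Submodule k M
  θ : Fin s → ℕ → M →ₗ[k] M
  zero_mem : 0 ∈ S
  d_d : ∀ x, d (d x) = 0
  d_mem : ∀ {n x}, x ∈ G n → d x ∈ G (n + 1)
  d_memF : ∀ {i x}, x ∈ F i → d x ∈ F i
  G_neg : ∀ {n x}, n < 0 → x ∈ G n → x = 0
  F_anti : ∀ {i j}, i ≤ j → F j ≤ F i
  F_top : ∀ {i x}, i ≤ 0 → x ∈ F i
  F_big : ∀ {i n x}, n < i → x ∈ F i → x ∈ G n → x = 0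
  θ_d : ∀ l m x, θ l m (d x) = d (θ l m x)
  θ_mem : ∀ l m {n x}, x ∈ G n → θ l m x ∈ G n
  θ_memF : ∀ l m {i x}, x ∈ F i → θ l m x ∈ F i
  θ_comm : ∀ l m l' m' x, l ≠ l' → θ l m (θ l' m' x) = θ l' m' (θ l m x)
  θ_θ : ∀ l m x, θ l (m + 1) (θ l m x) = 0
  θ_out : ∀ l m x, m + 1 ∉ S → θ l m x = 0

namespace OpCx

variable {k : Type*} [Field k] {S S' : LowerSet ℕ} {s : ℕ}
variable {M : Type u} [AddCommGroup M] [Module k M] {M' : Type v} [AddCommGroup M'] [Module k M']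

/-- The differential on families `(c_m)`: `(D c)_m = (-1)^m d c_m + θ_{m-1} c_{m-1}`. -/
def stepD (d : M →ₗ[k] M) (θ : ℕ → M →ₗ[k] M) :
    (ℕ → M) →ₗ[k] (ℕ → M) :=
  LinearMap.pi fun m => match m with
    | 0 => d ∘ₗ LinearMap.proj 0
    | m + 1 => ((-1 : k) ^ (m + 1)) • (d ∘ₗ LinearMap.proj (m + 1)) + θ m ∘ₗ LinearMap.proj m

section stepD
variable (d : M →ₗ[k] M) (θ : ℕ → M →ₗ[k] M)

@[simp] lemma stepD_zero (c : ℕ → M) : stepD d θ c 0 = d (c 0) := rfl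

@[simp] lemma stepD_succ (c : ℕ → M) (m : ℕ) :
    stepD d θ c (m + 1) = ((-1 : k) ^ (m + 1)) • d (c (m + 1)) + θ m (c m) := rfl

end stepD

/-- The total complex of `C → C → ⋯` formed with the first family of operators; the remaining
families act componentwise. -/
@[simps d G F θ]
def step (C : OpCx k M S (s + 1)) : OpCx k (ℕ → M) S s where
  d := stepD C.d (C.θ 0)
  G n :=
    { carrier := {c | ∀ m : ℕ, c m ∈ C.G (n - m) ∧ (m ∉ S → c m = 0)}
      add_mem' := fun {a b} ha hb m => ⟨add_mem (ha m).1 (hb m).1, fun h => by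
        simp [(ha m).2 h, (hb m).2 h]⟩
      zero_mem' := fun m => ⟨Submodule.zero_mem _, fun _ => rfl⟩
      smul_mem' := fun r a ha m => ⟨Submodule.smul_mem _ _ (ha m).1, fun h => by
        simp [(ha m).2 h]⟩ }
  F i :=
    { carrier := {c | ∀ m : ℕ, c m ∈ C.F (i - m)}
      add_mem' := fun {a b} ha hb m => add_mem (ha m) (hb m)
      zero_mem' := fun m => Submodule.zero_mem _
      smul_mem' := fun r a ha m => Submodule.smul_mem _ _ (ha m) }
  θ l m := LinearMap.pi fun m' => C.θ l.succ m ∘ₗ LinearMap.proj m'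
  zero_mem := C.zero_mem
  d_d c := by
    funext m
    rcases m with _ | _ | m
    · simp [C.d_d]
    · simp [C.d_d, C.θ_d]
    · simp only [stepD_succ, map_add, map_smul, C.d_d, C.θ_d, C.θ_θ, smul_zero, zero_add, add_zero,
        Pi.zero_apply]
      rw [← add_smul, pow_succ _ (m + 1)]
      simp
  d_mem {n c} hc m := by
    rcases m with _ | m
    · refine ⟨?_, fun h => absurd C.zero_mem h⟩
      have := C.d_mem (hc 0).1
      simpa using this
    · constructor
      · refine add_mem (Submodule.smul_mem _ _ ?_) ?_
        · have := C.d_mem (hc (m + 1)).1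
          rwa [show n - ((m + 1 : ℕ) : ℤ) + 1 = n + 1 - ((m + 1 : ℕ) : ℤ) by ring] at this
        · have := C.θ_mem 0 m (hc m).1
          rwa [show n - (m : ℤ) = n + 1 - ((m + 1 : ℕ) : ℤ) by push_cast; ring] at this
      · intro h
        simp [(hc (m + 1)).2 h, C.θ_out 0 m _ h]
  d_memF {i c} hc m := by
    rcases m with _ | m
    · exact C.d_memF (hc 0)
    · refine add_mem (Submodule.smul_mem _ _ (C.d_memF (hc (m + 1)))) ?_
      exact C.F_anti (by push_cast; omega) (C.θ_memF 0 m (hc m))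
  G_neg {n c} hn hc := by
    funext m
    exact C.G_neg (by omega) (hc m).1
  F_anti {i j} h c hc m := C.F_anti (by omega) (hc m)
  F_top {i c} hi m := C.F_top (by omega)
  F_big {i n c} h hF hG := by
    funext m
    exact C.F_big (by omega) (hF m) (hG m).1
  θ_d l m c := by
    funext m'
    rcases m' with _ | m'
    · simp [C.θ_d]
    · simp [C.θ_d, C.θ_comm l.succ m 0 m' _ (Fin.succ_ne_zero l)]
  θ_mem l m {n c} hc m' := ⟨C.θ_mem _ _ (hc m').1, fun h => by simp [(hc m').2 h]⟩
  θ_memF l m {n c} hc m' := C.θ_memF _ _ (hc m')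
  θ_comm l m l' m' c h := by
    funext m''
    exact C.θ_comm _ _ _ _ _ (fun h' => h (Fin.succ_injective _ h'))
  θ_θ l m c := by
    funext m'
    exact C.θ_θ _ _ _
  θ_out l m c h := by
    funext m'
    exact C.θ_out _ _ _ h

variable (C : OpCx k M S (s + 1))

/-- The module underlying an `s`-fold iterated total complex: families indexed by `ℕ ^ s`. -/
def KM : ℕ → Type u → Type u
  | 0, M => M
  | s + 1, M => KM s (ℕ → M)

instance instAddCommGroupKM : ∀ (s : ℕ) (M : Type u) [AddCommGroup M], AddCommGroup (KM s M)
  | 0, _, h => h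
  | s + 1, M, _ => instAddCommGroupKM s (ℕ → M)

instance instModuleKM : ∀ (s : ℕ) (M : Type u) [AddCommGroup M] [Module k M], Module k (KM s M)
  | 0, _, _, h => h
  | s + 1, M, _, _ => instModuleKM s (ℕ → M)

/-- The iterated total complex: all families of operators are used up. -/
def K : ∀ {s : ℕ} {M : Type u} [AddCommGroup M] [Module k M], OpCx k M S s → OpCx k (KM s M) S 0
  | 0, _, _, _, C => C
  | s + 1, M, _, _, C => K (s := s) (M := ℕ → M) C.step

/-- The inclusion of a complex as the summand of multi-index zero of its total complex. -/
def ι : ∀ {s : ℕ} {M : Type u} [AddCommGroup M] [Module k M] (_ : OpCx k M S s), M →ₗ[k] KM s M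
  | 0, _, _, _, _ => LinearMap.id
  | s + 1, M, _, _, C => ι (s := s) (M := ℕ → M) C.step ∘ₗ LinearMap.single k (fun _ : ℕ => M) 0

/-- The subcomplex of elements killed by the first operator of every family. -/
@[simps d G]
def inv (C : OpCx k M S s) : OpCx k M S 0 where
  d := C.d
  G n :=
    { carrier := {x | x ∈ C.G n ∧ ∀ l, C.θ l 0 x = 0}
      add_mem' := fun ha hb => ⟨add_mem ha.1 hb.1, fun l => by simp [ha.2 l, hb.2 l]⟩
      zero_mem' := ⟨Submodule.zero_mem _, fun _ => map_zero _⟩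
      smul_mem' := fun r a ha => ⟨Submodule.smul_mem _ _ ha.1, fun l => by simp [ha.2 l]⟩ }
  F := C.F
  θ l := l.elim0
  zero_mem := C.zero_mem
  d_d := C.d_d
  d_mem h := ⟨C.d_mem h.1, fun l => by rw [C.θ_d, h.2 l, map_zero]⟩
  d_memF := C.d_memF
  G_neg h h' := C.G_neg h h'.1
  F_anti := C.F_anti
  F_top := C.F_top
  F_big h h' h'' := C.F_big h h' h''.1
  θ_d l := l.elim0
  θ_mem l := l.elim0
  θ_memF l := l.elim0
  θ_comm l := l.elim0
  θ_θ l := l.elim0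
  θ_out l := l.elim0

/-! ### Quasi-isomorphisms -/

/-- A map of complexes whose relative cohomology vanishes: a relative cocycle `(a, z)`, with
`d a = 0` and `g a = d z`, is a relative coboundary. -/
def IsQI {s s' : ℕ} (C : OpCx k M S s) (B : OpCx k M' S' s') (g : M →ₗ[k] M') : Prop :=
  ∀ (n : ℤ) (a : M) (z : M'), a ∈ C.G (n + 1) → z ∈ B.G n → C.d a = 0 → g a = B.d z →
    ∃ a' ∈ C.G n, ∃ z' ∈ B.G (n - 1), C.d a' = a ∧ z = g a' + B.d z'

section IsQI
variable {s s' : ℕ} {C : OpCx k M S s} {B : OpCx k M' S' s'}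
  {g : M →ₗ[k] M'}

lemma IsQI.surj (hg : IsQI C B g) {n : ℤ} {z : M'} (hz : z ∈ B.G n) (hdz : B.d z = 0) :
    ∃ a ∈ C.G n, C.d a = 0 ∧ ∃ z' ∈ B.G (n - 1), z = g a + B.d z' := by
  obtain ⟨a, ha, z', hz', h1, h2⟩ := hg n 0 z (Submodule.zero_mem _) hz (map_zero _)
    (by rw [map_zero, hdz])
  exact ⟨a, ha, h1, z', hz', h2⟩

lemma IsQI.inj (hg : IsQI C B g) {n : ℤ} {a : M} {z : M'} (ha : a ∈ C.G n)
    (hda : C.d a = 0) (hz : z ∈ B.G (n - 1)) (h : g a = B.d z) :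
    ∃ a' ∈ C.G (n - 1), C.d a' = a := by
  obtain ⟨a', ha', z', hz', h1, h2⟩ := hg (n - 1) a z (by simpa using ha) hz hda h
  exact ⟨a', ha', h1⟩

end IsQI

/-- The operators are acyclic: on the elements killed by the operators of all later families, each
family is exact in positive degrees. -/
def Acyc (C : OpCx k M S s) : Prop :=
  ∀ (l : Fin s) (m : ℕ) (n : ℤ) (x : M), x ∈ C.G n → (∀ l', l < l' → C.θ l' 0 x = 0) →
    C.θ l (m + 1) x = 0 → m + 1 ∈ S →
    ∃ y ∈ C.G n, (∀ l', l < l' → C.θ l' 0 y = 0) ∧ C.θ l m y = x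

lemma Acyc.step {C : OpCx k M S (s + 1)} (hC : Acyc C) : Acyc C.step := by
  classical
  intro l m n x hx hx' hx'' hm
  have key : ∀ m' : ℕ, ∃ y ∈ C.G (n - m'), ((∀ l', l.succ < l' → C.θ l' 0 y = 0) ∧
      C.θ l.succ m y = x m') ∧ (m' ∉ S → y = 0) := by
    intro m'
    by_cases hS : m' ∈ S
    · obtain ⟨y, h1, h2, h3⟩ := hC l.succ m (n - m') (x m') (hx m').1 (fun l' hl' => by
        obtain ⟨j, rfl⟩ := Fin.exists_succ_eq.2 (Fin.ne_zero_of_lt hl')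
        exact congrFun (hx' j (by simpa using hl')) m') (congrFun hx'' m') hm
      exact ⟨y, h1, ⟨h2, h3⟩, fun h => absurd hS h⟩
    · exact ⟨0, Submodule.zero_mem _, ⟨by simp, by simp [(hx m').2 hS]⟩, fun _ => rfl⟩
  choose y h1 h2 h3 using key
  refine ⟨y, fun m' => ⟨h1 m', h3 m'⟩, fun l' hl' => ?_, ?_⟩
  · funext m'
    exact (h2 m').1 l'.succ (by simpa using hl')
  · funext m'
    exact (h2 m').2

/-- If the components of positive index of `D c` vanish, then `c` is, up to a coboundary,
concentrated in index `0`: the components are removed from the top down. -/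
lemma exists_single_sub {C : OpCx k M S (s + 1)} (hC : Acyc C) {n : ℤ} {c : ℕ → M}
    (hc : c ∈ C.step.inv.G n) (hD : ∀ m, C.step.d c (m + 1) = 0) :
    ∃ e ∈ C.step.inv.G (n - 1), ∃ x, c - C.step.d e = Pi.single 0 x := by
  have key : ∀ (N : ℕ) (c : ℕ → M), c ∈ C.step.inv.G n → (∀ m, C.step.d c (m + 1) = 0) →
      (∀ m, N < m → c m = 0) → ∃ e ∈ C.step.inv.G (n - 1), ∃ x, c - C.step.d e = Pi.single 0 x := by
    intro N
    induction N with
    | zero =>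
      intro c _ _ h0
      refine ⟨0, Submodule.zero_mem _, c 0, ?_⟩
      funext m
      rcases m with _ | m
      · simp
      · simp [h0 (m + 1) (Nat.succ_pos m)]
    | succ N ih =>
      intro c hc hD h0
      by_cases hS : N + 1 ∈ S
      · have h1 : C.θ 0 (N + 1) (c (N + 1)) = 0 := by
          have := hD (N + 1)
          simpa [h0 (N + 2) (by omega)] using this
        obtain ⟨b, hb, hb', hb''⟩ := hC 0 N (n - (N + 1 : ℕ)) (c (N + 1)) (hc.1 (N + 1)).1
          (fun l' hl' => by
            obtain ⟨j, rfl⟩ := Fin.exists_succ_eq.2 (Fin.ne_zero_of_lt hl')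
            exact congrFun (hc.2 j) (N + 1)) h1 hS
        have he : (Pi.single N b : ℕ → M) ∈ C.step.inv.G (n - 1) := by
          refine ⟨fun m => ?_, fun l => ?_⟩
          · by_cases hm : m = N
            · subst hm
              refine ⟨?_, fun h => absurd (S.lower (Nat.le_succ m) hS) h⟩
              rw [show n - 1 - (m : ℤ) = n - (m + 1 : ℕ) by push_cast; ring]
              simpa using hb
            · simp [hm]
          · funext m
            by_cases hm : m = N
            · subst hm
              simpa using hb' l.succ (Fin.succ_pos l)
            · simp [hm]
        obtain ⟨e, he1, x, hx⟩ := ih (c - C.step.d (Pi.single N b))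
          (Submodule.sub_mem _ hc (by simpa using C.step.inv.d_mem he)) (fun m => by
            rw [map_sub, C.step.d_d, sub_zero]; exact hD m) (fun m hm => by
            obtain ⟨m, rfl⟩ : ∃ m', m = m' + 1 := ⟨m - 1, by omega⟩
            by_cases hmN : m = N
            · subst hmN
              simp [hb'']
            · have hm1 : m + 1 ≠ N := by omega
              simp [hmN, hm1, h0 (m + 1) (by omega)])
        refine ⟨Pi.single N b + e, add_mem he he1, x, ?_⟩
        rw [← hx, map_add]
        abel
      · refine ih c hc hD fun m hm => ?_
        by_cases hmN : m = N + 1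
        · subst hmN
          exact (hc.1 _).2 hS
        · exact h0 m (by omega)
  refine key n.toNat c hc hD fun m hm => ?_
  exact C.G_neg (by omega) (hc.1 m).1

lemma isQI_single {C : OpCx k M S (s + 1)} (hC : Acyc C) :
    IsQI C.inv C.step.inv (LinearMap.single k (fun _ : ℕ => M) 0) := by
  intro n a z ha hz hda haz
  have haz' : ∀ m, (Pi.single 0 a : ℕ → M) m = C.step.d z m := fun m => congrFun haz m
  obtain ⟨e, he, x, hx⟩ := exists_single_sub hC hz (fun m => by rw [← haz']; simp)
  have hxe : (Pi.single 0 x : ℕ → M) ∈ C.step.inv.G n := by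
    rw [← hx]
    exact Submodule.sub_mem _ hz (by simpa using C.step.inv.d_mem he)
  have hdx : C.step.d (Pi.single 0 x) = Pi.single 0 a := by
    rw [← hx, map_sub, C.step.d_d, sub_zero]
    exact haz.symm
  refine ⟨x, ⟨by simpa using (hxe.1 0).1, fun l => ?_⟩, e, he, ?_, ?_⟩
  · rcases Fin.eq_zero_or_eq_succ l with rfl | ⟨j, rfl⟩
    · simpa using congrFun hdx 1
    · simpa using congrFun (hxe.2 j) 0
  · simpa using congrFun hdx 0
  · exact sub_eq_iff_eq_add.1 hx

lemma single_mem_step {C : OpCx k M S (s + 1)} {n : ℤ} {x : M} (h : x ∈ C.G n) :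
    (Pi.single 0 x : ℕ → M) ∈ C.step.G n := by
  intro m
  rcases m with _ | m
  · exact ⟨by simpa using h, fun h' => absurd C.zero_mem h'⟩
  · simp

lemma single_mem_step_inv {C : OpCx k M S (s + 1)} {n : ℤ} {x : M} (h : x ∈ C.inv.G n) :
    (Pi.single 0 x : ℕ → M) ∈ C.step.inv.G n := by
  refine ⟨single_mem_step h.1, fun l => ?_⟩
  funext m
  rcases m with _ | m
  · simpa using h.2 l.succ
  · simp

lemma single_d_step {C : OpCx k M S (s + 1)} {x : M} (h : C.θ 0 0 x = 0) :
    (Pi.single 0 (C.d x) : ℕ → M) = C.step.d (Pi.single 0 x : ℕ → M) := by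
  funext m
  rcases m with _ | _ | m
  · simp
  · simp [h]
  · simp

lemma ι_mem (C : OpCx k M S s) {n : ℤ} {x : M} (h : x ∈ C.G n) : ι C x ∈ (K C).G n := by
  induction s generalizing M with
  | zero => exact h
  | succ s ih => exact ih C.step (single_mem_step h)

lemma ι_d (C : OpCx k M S s) {x : M} (h : ∀ l, C.θ l 0 x = 0) :
    ι C (C.d x) = (K C).d (ι C x) := by
  induction s generalizing M with
  | zero => rfl
  | succ s ih =>
    have h2 := ih C.step (x := (Pi.single 0 x : ℕ → M)) fun l => by
      funext m
      rcases m with _ | m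
      · simpa using h l.succ
      · simp
    rw [← single_d_step (h 0)] at h2
    exact h2

/-- For acyclic operators, the total complex computes the cohomology of the subcomplex of elements
killed by all operators. -/
theorem isQI_ι {C : OpCx k M S s} (hC : Acyc C) : IsQI C.inv (K C) (ι C) := by
  induction s generalizing M with
  | zero =>
    intro n a z ha hz hda haz
    exact ⟨z, ⟨hz, fun l => l.elim0⟩, 0, Submodule.zero_mem _, Eq.symm haz, by
      rw [map_zero, add_zero]; rfl⟩
  | succ s ih =>
    intro n a z ha hz hda haz
    obtain ⟨b', hb', z', hz', e1, e2⟩ := ih hC.step n (Pi.single 0 a : ℕ → M) z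
      (single_mem_step_inv ha) hz (by
        have := single_d_step (ha.2 0)
        rw [show C.d a = 0 from hda] at this
        rw [Pi.single_zero] at this
        exact this.symm) haz
    obtain ⟨a', ha', b'', hb'', e3, e4⟩ := isQI_single hC n a b' ha hb' hda e1.symm
    refine ⟨a', ha', z' + ι C.step b'', add_mem hz' (ι_mem _ hb''.1), e3, ?_⟩
    have e5 : ι C.step (C.step.d b'') = (K C.step).d (ι C.step b'') := ι_d C.step hb''.2
    have e6 : b' = (Pi.single 0 a' : ℕ → M) + C.step.d b'' := e4
    have e7 : C.step.ι b' + C.step.K.d z' =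
        C.step.ι (Pi.single 0 a' : ℕ → M) + C.step.K.d (z' + ι C.step b'') := by
      rw [e6, map_add, e5, map_add, add_assoc, add_comm ((K C.step).d (ι C.step b''))]
    rw [e2]
    exact e7

/-! ### Morphisms -/

/-- A map of filtered complexes which intertwines the operators up to scalars:
`c (m + 1) • g (θ l m x) = c m • θ l m (g x)`. The scalars `c m` turn `g` into a map of total
complexes. -/
structure Mor (c : ℕ → k) (C : OpCx k M S s) (B : OpCx k M' S' s) where
  g : M →ₗ[k] M'
  g_d : ∀ x, g (C.d x) = B.d (g x)
  g_mem : ∀ {n x}, x ∈ C.G n → g x ∈ B.G n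
  g_memF : ∀ {i x}, x ∈ C.F i → g x ∈ B.F i
  g_θ : ∀ l m x, c (m + 1) • g (C.θ l m x) = c m • B.θ l m (g x)
  supp : ∀ m, m ∈ S → m ∉ S' → c m = 0

namespace Mor
variable {c : ℕ → k}

/-- The map of total complexes given by `(x_m) ↦ (c_m g(x_m))`. -/
@[simps g]
def step {C : OpCx k M S (s + 1)} {B : OpCx k M' S' (s + 1)} (φ : Mor c C B) :
    Mor c C.step B.step where
  g := LinearMap.pi fun m => c m • (φ.g ∘ₗ LinearMap.proj m)
  g_d x := by
    funext m
    rcases m with _ | m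
    · simp [φ.g_d]
    · simp only [step_d, LinearMap.pi_apply, LinearMap.smul_apply, LinearMap.comp_apply,
        LinearMap.proj_apply, stepD_succ, map_add, map_smul, φ.g_d, smul_add, φ.g_θ]
      rw [smul_comm]
  g_mem {n x} hx m := by
    refine ⟨Submodule.smul_mem _ _ (φ.g_mem (hx m).1), fun h => ?_⟩
    by_cases hm : m ∈ S
    · simp [φ.supp m hm h]
    · simp [(hx m).2 hm]
  g_memF {i x} hx m := Submodule.smul_mem _ _ (φ.g_memF (hx m))
  g_θ l m x := by
    funext m'
    have := φ.g_θ l.succ m (x m')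
    simp only [step_θ, LinearMap.pi_apply, LinearMap.smul_apply, LinearMap.comp_apply,
        LinearMap.proj_apply, Pi.smul_apply, map_smul]
    rw [smul_comm, this, smul_comm]
  supp := φ.supp

/-- The map induced on iterated total complexes. -/
def K : ∀ {s : ℕ} {M : Type u} [AddCommGroup M] [Module k M] {M' : Type v} [AddCommGroup M']
    [Module k M'] {C : OpCx k M S s} {B : OpCx k M' S' s}, Mor c C B → Mor c C.K B.K
  | 0, _, _, _, _, _, _, _, _, φ => φ
  | s + 1, M, _, _, M', _, _, _, _, φ => K (s := s) (M := ℕ → M) (M' := ℕ → M') φ.step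

lemma K_ι (hc : c 0 = 1) {C : OpCx k M S s} {B : OpCx k M' S' s} (φ : Mor c C B) (x : M) :
    φ.K.g (ι C x) = ι B (φ.g x) := by
  induction s generalizing M M' with
  | zero => rfl
  | succ s ih =>
    have := ih φ.step (Pi.single 0 x : ℕ → M)
    have h2 : φ.step.g (Pi.single 0 x : ℕ → M) = (Pi.single 0 (φ.g x) : ℕ → M') := by
      funext m
      rcases m with _ | m
      · simp [hc]
      · simp
    rw [h2] at this
    exact this

lemma K_square {S₁ S₂ S₃ S₄ : LowerSet ℕ} {c₁ c₂ c₃ c₄ : ℕ → k}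
    (hc : ∀ m, c₂ m * c₁ m = c₄ m * c₃ m) {M₁ M₂ M₃ M₄ : Type u}
    [AddCommGroup M₁] [Module k M₁] [AddCommGroup M₂] [Module k M₂] [AddCommGroup M₃] [Module k M₃]
    [AddCommGroup M₄] [Module k M₄] {C₁ : OpCx k M₁ S₁ s} {C₂ : OpCx k M₂ S₂ s}
    {C₃ : OpCx k M₃ S₃ s} {C₄ : OpCx k M₄ S₄ s} (φ₁ : Mor c₁ C₁ C₂) (φ₂ : Mor c₂ C₂ C₄)
    (φ₃ : Mor c₃ C₁ C₃) (φ₄ : Mor c₄ C₃ C₄) (h : ∀ x, φ₂.g (φ₁.g x) = φ₄.g (φ₃.g x)) :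
    ∀ x, φ₂.K.g (φ₁.K.g x) = φ₄.K.g (φ₃.K.g x) := by
  induction s generalizing M₁ M₂ M₃ M₄ with
  | zero => exact h
  | succ s ih =>
    refine ih φ₁.step φ₂.step φ₃.step φ₄.step fun x => ?_
    funext m
    simp only [step_g, LinearMap.pi_apply, LinearMap.smul_apply, LinearMap.comp_apply,
      LinearMap.proj_apply, map_smul, smul_smul, h, hc]

/-- If `g ^ N = 1` and the scalars of `g` are `N`-th roots of unity, then the induced map on total
complexes has the same property. -/
lemma K_iterate {N : ℕ} (hc : ∀ m, c m ^ N = 1) {C : OpCx k M S s} (φ : Mor c C C)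
    (h : ∀ x, (φ.g ^ N) x = x) : ∀ x, (φ.K.g ^ N) x = x := by
  induction s generalizing M with
  | zero => exact h
  | succ s ih =>
    refine ih φ.step fun x => ?_
    have : ∀ j : ℕ, (φ.step.g ^ j) x = fun m => c m ^ j • (φ.g ^ j) (x m) := by
      intro j
      induction j with
      | zero => simp
      | succ j ih =>
        rw [pow_succ', Module.End.mul_apply, ih]
        funext m
        simp only [step_g, LinearMap.pi_apply, LinearMap.smul_apply, LinearMap.comp_apply,
          LinearMap.proj_apply, map_smul, smul_smul, pow_succ' φ.g, Module.End.mul_apply]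
        rw [pow_succ']
    rw [this]
    funext m
    rw [hc, h, one_smul]

end Mor

/-- A strict quasi-isomorphism compatible with the operators induces a quasi-isomorphism of total
complexes: relative cocycles are removed component by component, from index `0` upwards. -/
lemma IsQI.step {C : OpCx k M S (s + 1)} {B : OpCx k M' S (s + 1)} (φ : Mor (fun _ => (1 : k)) C B)
    (hφ : IsQI C B φ.g) : IsQI C.step B.step φ.step.g := by
  intro n
  have key : ∀ (j N : ℕ), n + 1 < (N + j : ℕ) → ∀ (a : ℕ → M) (z : ℕ → M'),
      a ∈ C.step.G (n + 1) → z ∈ B.step.G n → C.step.d a = 0 → φ.step.g a = B.step.d z →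
      (∀ m < N, a m = 0) → (∀ m < N, z m = 0) →
      ∃ a' ∈ C.step.G n, ∃ z' ∈ B.step.G (n - 1), C.step.d a' = a ∧
        z = φ.step.g a' + B.step.d z' := by
    intro j
    induction j with
    | zero =>
      intro N hN a z ha hz _ _ ha0 hz0
      have ha : a = 0 := by
        funext m
        rcases lt_or_ge m N with h | h
        · exact ha0 m h
        · exact C.G_neg (by omega) (ha m).1
      have hz : z = 0 := by
        funext m
        rcases lt_or_ge m N with h | h
        · exact hz0 m h
        · exact B.G_neg (by omega) (hz m).1
      exact ⟨0, Submodule.zero_mem _, 0, Submodule.zero_mem _, by simp [ha], by simp [hz]⟩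
    | succ j ih =>
      intro N hN a z ha hz hda haz ha0 hz0
      by_cases hS : N ∈ S
      swap
      · have hle : ∀ m, N ≤ m → m ∉ S := fun m hm h => hS (S.lower hm h)
        have ha : a = 0 := by
          funext m
          rcases lt_or_ge m N with h | h
          · exact ha0 m h
          · exact (ha m).2 (hle m h)
        have hz : z = 0 := by
          funext m
          rcases lt_or_ge m N with h | h
          · exact hz0 m h
          · exact (hz m).2 (hle m h)
        exact ⟨0, Submodule.zero_mem _, 0, Submodule.zero_mem _, by simp [ha], by simp [hz]⟩
      have hsgn : ((-1 : k) ^ N) * (-1) ^ N = 1 := by rw [← mul_pow]; simp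
      have hCd : ∀ x : ℕ → M, (∀ m < N, x m = 0) → C.step.d x N = (-1 : k) ^ N • C.d (x N) := by
        intro x hx
        rcases N with _ | N
        · simp
        · simp [hx N (by omega)]
      have hBd : ∀ x : ℕ → M', (∀ m < N, x m = 0) → B.step.d x N = (-1 : k) ^ N • B.d (x N) := by
        intro x hx
        rcases N with _ | N
        · simp
        · simp [hx N (by omega)]
      have hCd' : ∀ x : ℕ → M, (∀ m < N, x m = 0) → ∀ m < N, C.step.d x m = 0 := by
        intro x hx m hm
        rcases m with _ | m
        · simp [hx 0 hm]
        · simp [hx _ hm, hx m (by omega)]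
      have hBd' : ∀ x : ℕ → M', (∀ m < N, x m = 0) → ∀ m < N, B.step.d x m = 0 := by
        intro x hx m hm
        rcases m with _ | m
        · simp [hx 0 hm]
        · simp [hx _ hm, hx m (by omega)]
      have h1 : C.d (a N) = 0 := by
        have h := congrFun hda N
        rw [hCd a ha0, Pi.zero_apply] at h
        have := congrArg (fun y => (-1 : k) ^ N • y) h
        simpa [smul_smul, hsgn] using this
      have h2 : φ.g (a N) = B.d ((-1 : k) ^ N • z N) := by
        have h := congrFun haz N
        rw [hBd z hz0] at h
        rw [map_smul, ← h]
        simp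
      obtain ⟨a', ha', z', hz', e1, e2⟩ := hφ (n - N) (a N) ((-1 : k) ^ N • z N)
        (by rw [show n - (N : ℤ) + 1 = n + 1 - N by ring]; exact (ha N).1)
        (Submodule.smul_mem _ _ (hz N).1) h1 h2
      set x : ℕ → M := Pi.single N ((-1 : k) ^ N • a') with hx
      set y : ℕ → M' := Pi.single N z' with hy
      have hx0 : ∀ m < N, x m = 0 := fun m hm => by simp [hx, hm.ne]
      have hy0 : ∀ m < N, y m = 0 := fun m hm => by simp [hy, hm.ne]
      have hxG : x ∈ C.step.G n := fun m => by
        by_cases hm : m = N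
        · subst hm
          exact ⟨by simpa [hx] using Submodule.smul_mem _ _ ha', fun h => absurd hS h⟩
        · simp [hx, hm]
      have hyG : y ∈ B.step.G (n - 1) := fun m => by
        by_cases hm : m = N
        · subst hm
          refine ⟨?_, fun h => absurd hS h⟩
          rw [show n - 1 - (m : ℤ) = n - m - 1 by ring]
          simpa [hy] using hz'
        · simp [hy, hm]
      have hyG' : B.step.d y ∈ B.step.G n := by simpa using B.step.d_mem hyG
      obtain ⟨a'', ha'', z'', hz'', f1, f2⟩ := ih (N + 1) (by push_cast at hN ⊢; omega)
        (a - C.step.d x) (z - φ.step.g x - B.step.d y)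
        (Submodule.sub_mem _ ha (C.step.d_mem hxG))
        (Submodule.sub_mem _ (Submodule.sub_mem _ hz (φ.step.g_mem hxG)) hyG')
        (by rw [map_sub, hda, C.step.d_d, sub_zero])
        (by rw [map_sub, map_sub, map_sub, haz, B.step.d_d, φ.step.g_d, sub_zero])
        (fun m hm => by
          rcases Nat.lt_succ_iff_lt_or_eq.1 hm with h | rfl
          · rw [Pi.sub_apply, ha0 m h, hCd' x hx0 m h, sub_zero]
          · rw [Pi.sub_apply, hCd x hx0, hx, Pi.single_eq_same, map_smul, smul_smul, hsgn,
              one_smul, e1, sub_self])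
        (fun m hm => by
          rcases Nat.lt_succ_iff_lt_or_eq.1 hm with h | rfl
          · rw [Pi.sub_apply, Pi.sub_apply, hz0 m h, hBd' y hy0 m h]
            simp [hx0 m h]
          · have : z m = (-1 : k) ^ m • (φ.g a' + B.d z') := by
              rw [← e2, smul_smul, hsgn, one_smul]
            rw [Pi.sub_apply, Pi.sub_apply, hBd y hy0, this]
            simp [hx, hy])
      refine ⟨a'' + x, add_mem ha'' hxG, z'' + y, add_mem hz'' hyG, ?_, ?_⟩
      · rw [map_add, f1]; abel
      · rw [map_add, map_add, add_add_add_comm, ← f2]; abel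
  intro a z ha hz hda haz
  exact key (n + 2).toNat 0 (by push_cast; omega) a z ha hz hda haz (by simp) (by simp)

lemma IsQI.K {C : OpCx k M S s} {B : OpCx k M' S s} (φ : Mor (fun _ => (1 : k)) C B)
    (h : IsQI C B φ.g) : IsQI C.K B.K φ.K.g := by
  induction s generalizing M M' with
  | zero => exact h
  | succ s ih => exact ih φ.step (h.step φ)

end OpCx

namespace OpCx

variable {k : Type*} [Field k] {S S' : LowerSet ℕ} {s : ℕ}
variable {M : Type u} [AddCommGroup M] [Module k M] {M' : Type v} [AddCommGroup M'] [Module k M']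

/-! ### The first page of the spectral sequence of a filtered complex -/

/-- `x` represents a class on the first page: a cocycle of `F i / F (i + 1)` in degree `n`. -/
def Cy (C : OpCx k M S s) (i n : ℤ) (x : M) : Prop := x ∈ C.F i ∧ x ∈ C.G n ∧ C.d x ∈ C.F (i + 1)

/-- `x` represents zero on the first page: it is a coboundary in `F i / F (i + 1)`. -/
def Bd (C : OpCx k M S s) (i n : ℤ) (x : M) : Prop :=
  ∃ y, y ∈ C.F i ∧ y ∈ C.G (n - 1) ∧ x - C.d y ∈ C.F (i + 1)

section
variable {C : OpCx k M S s} {i n : ℤ} {x y : M}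

lemma Bd.of_mem (h : x ∈ C.F (i + 1)) : Bd C i n x :=
  ⟨0, Submodule.zero_mem _, Submodule.zero_mem _, by simpa using h⟩

lemma Bd.add (hx : Bd C i n x) (hy : Bd C i n y) : Bd C i n (x + y) := by
  obtain ⟨a, h1, h2, h3⟩ := hx
  obtain ⟨b, h4, h5, h6⟩ := hy
  refine ⟨a + b, add_mem h1 h4, add_mem h2 h5, ?_⟩
  rw [map_add, add_sub_add_comm]
  exact add_mem h3 h6

lemma Bd.smul (r : k) (hx : Bd C i n x) : Bd C i n (r • x) := by
  obtain ⟨a, h1, h2, h3⟩ := hx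
  refine ⟨r • a, Submodule.smul_mem _ _ h1, Submodule.smul_mem _ _ h2, ?_⟩
  rw [map_smul, ← smul_sub]
  exact Submodule.smul_mem _ _ h3

lemma Bd.neg (hx : Bd C i n x) : Bd C i n (-x) := by
  simpa using hx.smul (-1)

lemma Bd.sub (hx : Bd C i n x) (hy : Bd C i n y) : Bd C i n (x - y) := by
  rw [sub_eq_add_neg]
  exact hx.add hy.neg

lemma Bd.d_of_mem (hx : x ∈ C.F i) (hx' : x ∈ C.G (n - 1)) : Bd C i n (C.d x) :=
  ⟨x, hx, hx', by simp⟩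

end

section step
variable {C : OpCx k M S (s + 1)} {i n : ℤ} {c : ℕ → M}

lemma neg_one_pow_smul_mem {V : Submodule k M} (m : ℕ) {x : M} :
    ((-1 : k) ^ m) • x ∈ V ↔ x ∈ V := by
  rcases neg_one_pow_eq_or k m with h | h <;> simp [h]

lemma cy_step : Cy C.step i n c ↔
    (∀ m : ℕ, Cy C (i - m) (n - m) (c m)) ∧ ∀ m, m ∉ S → c m = 0 := by
  constructor
  · rintro ⟨hF, hG, hd⟩
    refine ⟨fun m => ⟨hF m, (hG m).1, ?_⟩, fun m => (hG m).2⟩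
    rcases m with _ | m
    · simpa using hd 0
    · have h1 := hd (m + 1)
      have h2 : C.θ 0 m (c m) ∈ C.F (i + 1 - (m + 1 : ℕ)) := by
        rw [show i + 1 - ((m + 1 : ℕ) : ℤ) = i - m by push_cast; ring]
        exact C.θ_memF _ _ (hF m)
      have h3 := Submodule.sub_mem _ h1 h2
      rw [step_d, stepD_succ, add_sub_cancel_right, neg_one_pow_smul_mem] at h3
      rwa [show i - ((m + 1 : ℕ) : ℤ) + 1 = i + 1 - (m + 1 : ℕ) by ring]
  · rintro ⟨h, hS⟩
    refine ⟨fun m => (h m).1, fun m => ⟨(h m).2.1, hS m⟩, fun m => ?_⟩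
    rcases m with _ | m
    · simpa using (h 0).2.2
    · rw [step_d, stepD_succ]
      refine add_mem (neg_one_pow_smul_mem _ |>.2 ?_) ?_
      · have := (h (m + 1)).2.2
        rwa [show i - ((m + 1 : ℕ) : ℤ) + 1 = i + 1 - (m + 1 : ℕ) by ring] at this
      · rw [show i + 1 - ((m + 1 : ℕ) : ℤ) = i - m by push_cast; ring]
        exact C.θ_memF _ _ (h m).1

/-- On the first page the operator part of the differential of the total complex is invisible, so
that a family is a coboundary there as soon as its components are. -/
lemma bd_step (hS : ∀ m, m ∉ S → c m = 0) :
    Bd C.step i n c ↔ ∀ m : ℕ, Bd C (i - m) (n - m) (c m) := by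
  constructor
  · rintro ⟨y, hF, hG, hd⟩ m
    have hG' : y m ∈ C.G (n - m - 1) := by
      have := (hG m).1
      rwa [show n - 1 - (m : ℤ) = n - m - 1 by ring] at this
    have hd' := hd m
    rw [show i + 1 - (m : ℤ) = i - m + 1 by ring] at hd'
    refine ⟨(-1 : k) ^ m • y m, Submodule.smul_mem _ _ (hF m), Submodule.smul_mem _ _ hG', ?_⟩
    rw [map_smul]
    rcases m with _ | m
    · simpa using hd'
    · have h2 : C.θ 0 m (y m) ∈ C.F (i - (m + 1 : ℕ) + 1) := by
        rw [show i - ((m + 1 : ℕ) : ℤ) + 1 = i - m by push_cast; ring]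
        exact C.θ_memF _ _ (hF m)
      have h3 := Submodule.add_mem _ hd' h2
      rwa [Pi.sub_apply, step_d, stepD_succ, ← sub_sub, sub_add_cancel] at h3
  · intro h
    classical
    choose y hF hG hd using h
    refine ⟨fun m => if m ∈ S then (-1 : k) ^ m • y m else 0, fun m => ?_, fun m => ⟨?_, ?_⟩,
      fun m => ?_⟩
    · dsimp only
      split_ifs
      · exact Submodule.smul_mem _ _ (hF m)
      · exact Submodule.zero_mem _
    · dsimp only
      split_ifs
      · rw [show n - 1 - (m : ℤ) = n - m - 1 by ring]
        exact Submodule.smul_mem _ _ (hG m)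
      · exact Submodule.zero_mem _
    · intro hm
      simp [hm]
    · rw [show i + 1 - (m : ℤ) = i - m + 1 by ring]
      have key : c m - (-1 : k) ^ m • C.d (if m ∈ S then (-1 : k) ^ m • y m else 0) ∈
          C.F (i - m + 1) := by
        split_ifs with hm
        · rw [map_smul, smul_smul, ← mul_pow]
          simpa using hd m
        · simp [hS m hm]
      rcases m with _ | m
      · simpa using key
      · rw [Pi.sub_apply, step_d, stepD_succ, ← sub_sub]
        refine Submodule.sub_mem _ key ?_
        rw [show i - ((m + 1 : ℕ) : ℤ) + 1 = i - m by push_cast; ring]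
        refine C.θ_memF _ _ ?_
        split_ifs
        · exact Submodule.smul_mem _ _ (hF m)
        · exact Submodule.zero_mem _

end step

/-- The differential and the operators act as zero on the first page. -/
structure Degen (C : OpCx k M S s) : Prop where
  d_bd : ∀ {i n x}, Cy C i n x → Bd C (i + 1) (n + 1) (C.d x)
  θ_bd : ∀ l m {i n x}, Cy C i n x → Bd C i n (C.θ l m x)

lemma Degen.step {C : OpCx k M S (s + 1)} (hC : Degen C) : Degen C.step where
  d_bd {i n x} hx := by
    obtain ⟨h1, h2⟩ := cy_step.1 hx
    refine (bd_step fun m => (C.step.d_mem hx.2.1 m).2).2 fun m => ?_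
    have h3 : Bd C (i + 1 - m) (n + 1 - m) (C.d (x m)) := by
      rw [show i + 1 - (m : ℤ) = i - m + 1 by ring, show n + 1 - (m : ℤ) = n - m + 1 by ring]
      exact hC.d_bd (h1 m)
    rcases m with _ | m
    · simpa using h3
    · rw [step_d, stepD_succ]
      refine (h3.smul _).add ?_
      have := hC.θ_bd 0 m (h1 m)
      rwa [show i - (m : ℤ) = i + 1 - (m + 1 : ℕ) by push_cast; ring,
        show n - (m : ℤ) = n + 1 - (m + 1 : ℕ) by push_cast; ring] at this
  θ_bd l m {i n x} hx := by
    obtain ⟨h1, h2⟩ := cy_step.1 hx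
    exact (bd_step fun m' => (C.step.θ_mem l m hx.2.1 m').2).2 fun m' => hC.θ_bd _ _ (h1 m')

/-! ### Weights -/

/-- The scalars by which a weight operator acts on the components of a total complex: the operators
`θ l m` have weight `κ` for even `m` and weight `0` for odd `m`. -/
def wtScalar (lam : k) (κ : ℕ) (m : ℕ) : k := lam ^ (κ * ((m + 1) / 2))

/-- The scalars of a map from a periodic complex to a truncated one. -/
def truncScalar (k : Type*) [Field k] (m : ℕ) : k := if m ≤ 1 then 1 else 0

/-- The first pages of two filtered complexes `B` and `C`, compared through `f : B → C` and graded
on the side of `B` by the eigenvalues `lam ^ w` of the operator `Λ`. In bidegree `(i, j)`, where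
`j = n - i`, the top weight is `κ i + 2 j`; all weights of `B` are of the form `κ i + 2 j - δ` with
`0 ≤ 2 δ ≤ κ i + 2 j`; the part of top weight maps onto the first page of `C`, and the kernel of
this map has only weights with `δ ≥ 1`. The first page of `C` is concentrated in `i ≤ a`, `j ≤ b`,
and both spectral sequences have zero differential on the first page. -/
structure FirstPage (lam : k) (κ a b : ℕ) {B : OpCx k M S s} {C : OpCx k M' S' s}
    (f : Mor (truncScalar k) B C) (Λ : Mor (wtScalar lam κ) B B) : Prop where
  degen_left : Degen B
  degen_right : Degen C
  vanish : ∀ {i n x} (w : ℤ), Cy B i n x → Λ.g x = lam ^ w • x →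
    (∀ δ : ℕ, 2 * (δ : ℤ) ≤ κ * i + 2 * (n - i) → lam ^ w ≠ lam ^ (κ * i + 2 * (n - i) - δ)) →
    Bd B i n x
  top_inj : ∀ {i n x} (w : ℤ), Cy B i n x → Λ.g x = lam ^ w • x →
    (∀ δ : ℕ, 1 ≤ δ → 2 * (δ : ℤ) ≤ κ * i + 2 * (n - i) →
      lam ^ w ≠ lam ^ (κ * i + 2 * (n - i) - δ)) →
    Bd C i n (f.g x) → Bd B i n x
  top_surj : ∀ {i n z}, Cy C i n z →
    ∃ x, Cy B i n x ∧ Λ.g x = lam ^ (κ * i + 2 * (n - i)) • x ∧ Bd C i n (f.g x - z)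
  bound : ∀ {i n z}, Cy C i n z → (a < i ∨ b < n - i) → Bd C i n z

lemma FirstPage.step {lam : k} (hlam : lam ≠ 0) {κ a b : ℕ} (hκ : 0 < κ)
    {B : OpCx k M ⊤ (s + 1)}
    {C : OpCx k M' (LowerSet.Iic 1) (s + 1)} {f : Mor (truncScalar k) B C}
    {Λ : Mor (wtScalar lam κ) B B} (h : FirstPage lam κ a b f Λ) :
    FirstPage lam κ (a + 1) b f.step Λ.step where
  degen_left := h.degen_left.step
  degen_right := h.degen_right.step
  vanish {i n x} w hx hΛ hw := by
    obtain ⟨h1, h2⟩ := cy_step.1 hx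
    refine (bd_step h2).2 fun m => ?_
    refine h.vanish (w - κ * ((m + 1) / 2 : ℕ)) (h1 m) ?_ fun δ hδ heq => ?_
    · have := congrFun hΛ m
      simp only [Mor.step_g, LinearMap.pi_apply, LinearMap.smul_apply, LinearMap.comp_apply,
        LinearMap.proj_apply, wtScalar, Pi.smul_apply] at this
      rw [zpow_sub₀ hlam, div_eq_inv_mul, mul_smul, ← this, smul_smul, ← Nat.cast_mul,
        zpow_natCast, inv_mul_cancel₀ (pow_ne_zero _ hlam), one_smul]
    · have hm : m / 2 + (m + 1) / 2 = m := by omega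
      have hm' : (κ : ℤ) * (m / 2 : ℕ) + κ * ((m + 1) / 2 : ℕ) = κ * m := by
        rw [← mul_add, ← Nat.cast_add, hm]
      have hm2 : (κ : ℤ) * (2 * (m / 2 : ℕ)) ≤ κ * m :=
        mul_le_mul_of_nonneg_left (by omega) (by positivity)
      refine hw (δ + κ * (m / 2)) ?_ ?_
      · push_cast at hδ hm2 ⊢
        linarith
      · have : lam ^ w =
            lam ^ (w - κ * ((m + 1) / 2 : ℕ)) * lam ^ ((κ : ℤ) * ((m + 1) / 2 : ℕ)) := by
          rw [← zpow_add₀ hlam, sub_add_cancel]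
        rw [this, heq, ← zpow_add₀ hlam]
        congr 1
        push_cast at hm' ⊢
        linarith
  top_inj {i n x} w hx hΛ hw hf := by
    obtain ⟨h1, h2⟩ := cy_step.1 hx
    refine (bd_step h2).2 fun m => ?_
    have hf' := (bd_step (fun m hm => (f.step.g_mem hx.2.1 m).2 hm)).1 hf m
    have hΛ' : Λ.g (x m) = lam ^ (w - κ * ((m + 1) / 2 : ℕ)) • x m := by
      have := congrFun hΛ m
      simp only [Mor.step_g, LinearMap.pi_apply, LinearMap.smul_apply, LinearMap.comp_apply,
        LinearMap.proj_apply, wtScalar, Pi.smul_apply] at this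
      rw [zpow_sub₀ hlam, div_eq_inv_mul, mul_smul, ← this, smul_smul, ← Nat.cast_mul,
        zpow_natCast, inv_mul_cancel₀ (pow_ne_zero _ hlam), one_smul]
    have hm : m / 2 + (m + 1) / 2 = m := by omega
    have hm' : (κ : ℤ) * (m / 2 : ℕ) + κ * ((m + 1) / 2 : ℕ) = κ * m := by
      rw [← mul_add, ← Nat.cast_add, hm]
    have hm2 : (κ : ℤ) * (2 * (m / 2 : ℕ)) ≤ κ * m :=
      mul_le_mul_of_nonneg_left (by omega) (by positivity)
    have key : ∀ δ : ℕ, 1 ≤ δ + κ * (m / 2) →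
        2 * (δ : ℤ) ≤ κ * (i - m) + 2 * (n - m - (i - m)) →
        lam ^ (w - κ * ((m + 1) / 2 : ℕ)) ≠ lam ^ (κ * (i - m) + 2 * (n - m - (i - m)) - δ) := by
      intro δ hδ1 hδ heq
      refine hw (δ + κ * (m / 2)) hδ1 ?_ ?_
      · push_cast at hδ hm2 ⊢
        linarith
      · have : lam ^ w =
            lam ^ (w - κ * ((m + 1) / 2 : ℕ)) * lam ^ ((κ : ℤ) * ((m + 1) / 2 : ℕ)) := by
          rw [← zpow_add₀ hlam, sub_add_cancel]
        rw [this, heq, ← zpow_add₀ hlam]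
        congr 1
        push_cast at hm' ⊢
        linarith
    by_cases hm1 : m ≤ 1
    · refine h.top_inj _ (h1 m) hΛ' (fun δ hδ1 => key δ (by omega)) ?_
      simpa [truncScalar, hm1] using hf'
    · refine h.vanish _ (h1 m) hΛ' (fun δ => key δ ?_)
      have : 1 ≤ κ * (m / 2) := Nat.mul_pos hκ (by omega)
      omega
  top_surj {i n z} hz := by
    obtain ⟨h1, h2⟩ := cy_step.1 hz
    choose x hx1 hx2 hx3 using fun m => h.top_surj (h1 m)
    have hS : ∀ m, ¬ m ≤ 1 → z m = 0 := fun m hm => h2 m hm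
    refine ⟨fun m => if m ≤ 1 then x m else 0, cy_step.2 ⟨fun m => ?_, fun m hm => ?_⟩, ?_, ?_⟩
    · split_ifs
      · exact hx1 m
      · exact ⟨Submodule.zero_mem _, Submodule.zero_mem _, by simp⟩
    · exact absurd trivial hm
    · funext m
      simp only [Mor.step_g, LinearMap.pi_apply, LinearMap.smul_apply, LinearMap.comp_apply,
        LinearMap.proj_apply, wtScalar, Pi.smul_apply]
      split_ifs with hm
      · rw [hx2, smul_smul, ← zpow_natCast, ← zpow_add₀ hlam]
        congr 2
        have : (m + 1) / 2 = m := by omega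
        rw [this]
        push_cast
        ring
      · simp
    · refine (bd_step fun m hm => ?_).2 fun m => ?_
      · have hm' : ¬ m ≤ 1 := hm
        simp [hS m hm', hm']
      · by_cases hm : m ≤ 1
        · simpa [truncScalar, hm] using hx3 m
        · refine Bd.of_mem ?_
          simp [hm, hS m hm]
  bound {i n z} hz hab := by
    obtain ⟨h1, h2⟩ := cy_step.1 hz
    refine (bd_step h2).2 fun m => ?_
    by_cases hm : m ≤ 1
    · refine h.bound (h1 m) ?_
      rcases hab with hab | hab
      · left
        push_cast at hab
        omega
      · right
        omega
    · refine Bd.of_mem ?_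
      rw [h2 m hm]
      exact Submodule.zero_mem _

lemma FirstPage.K {lam : k} (hlam : lam ≠ 0) {κ a b : ℕ} (hκ : 0 < κ) {B : OpCx k M ⊤ s}
    {C : OpCx k M' (LowerSet.Iic 1) s} {f : Mor (truncScalar k) B C}
    {Λ : Mor (wtScalar lam κ) B B} (h : FirstPage lam κ a b f Λ) :
    FirstPage lam κ (a + s) b f.K Λ.K := by
  induction s generalizing M M' a with
  | zero => exact h
  | succ s ih =>
    have := ih (h.step hlam hκ)
    rw [add_assoc, add_comm 1] at this
    exact this

/-- The projection onto an eigenspace of an operator of finite order `N` prime to the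
characteristic. -/
lemma exists_eigen_projection {N : ℕ} (hN : (N : k) ≠ 0) {lam : k} (hlam : lam ^ N = 1)
    (T : M →ₗ[k] M) (hT : ∀ x, (T ^ N) x = x) (w : ℤ) :
    ∃ π : M →ₗ[k] M, (∀ x, T (π x) = lam ^ w • π x) ∧ (∀ x, T x = lam ^ w • x → π x = x) ∧
      (∀ V : Submodule k M, (∀ x ∈ V, T x ∈ V) → ∀ x ∈ V, π x ∈ V) ∧
      (∀ V : Submodule k M, (∀ x ∈ V, T x ∈ V) → ∀ x, T x - lam ^ w • x ∈ V → π x - x ∈ V) ∧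
      ∀ d : M →ₗ[k] M, (∀ x, T (d x) = d (T x)) → ∀ x, π (d x) = d (π x) := by
  have hN0 : N ≠ 0 := by rintro rfl; simp at hN
  have hlam0 : lam ≠ 0 := by rintro rfl; simp [hN0] at hlam
  set μ : k := lam ^ w with hμ
  have hμ0 : μ ≠ 0 := zpow_ne_zero _ hlam0
  have hμN : μ⁻¹ ^ N = 1 := by
    rw [inv_pow, hμ, ← zpow_natCast, ← zpow_mul, mul_comm, zpow_mul, zpow_natCast, hlam, one_zpow,
      inv_one]
  refine ⟨(N : k)⁻¹ • ∑ a ∈ Finset.range N, (μ⁻¹ • T) ^ a, fun x => ?_, fun x hx => ?_,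
    fun V hV x hx => ?_,
    fun V hV x hx => ?_, fun d hd x => ?_⟩
  · have h1 : (μ⁻¹ • T) ^ N = 1 := by
      ext x
      rw [smul_pow, hμN, one_smul, hT]
      rfl
    have h2 : (μ⁻¹ • T) * ∑ a ∈ Finset.range N, (μ⁻¹ • T) ^ a =
        ∑ a ∈ Finset.range N, (μ⁻¹ • T) ^ a := by
      have := mul_geom_sum (μ⁻¹ • T) N
      rw [h1, sub_self, sub_mul, one_mul, sub_eq_zero] at this
      exact this
    have h3 := congrArg (fun g : Module.End k M => (N : k)⁻¹ • μ • g x) h2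
    simp only [Module.End.mul_apply, LinearMap.smul_apply, smul_smul, mul_inv_cancel₀ hμ0] at h3
    rw [LinearMap.smul_apply, map_smul, smul_smul, mul_comm μ, ← h3, mul_one]
  · have h1 : ∀ a : ℕ, ((μ⁻¹ • T) ^ a) x = x := by
      intro a
      induction a with
      | zero => simp
      | succ a ih =>
        rw [pow_succ, Module.End.mul_apply, LinearMap.smul_apply, hx, smul_smul,
          inv_mul_cancel₀ hμ0, one_smul, ih]
    rw [LinearMap.smul_apply, LinearMap.sum_apply]
    simp only [h1, Finset.sum_const, Finset.card_range]
    rw [← Nat.cast_smul_eq_nsmul k, smul_smul, inv_mul_cancel₀ hN, one_smul]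
  · have h1 : ∀ a : ℕ, ((μ⁻¹ • T) ^ a) x ∈ V := by
      intro a
      induction a with
      | zero => simpa using hx
      | succ a ih =>
        rw [pow_succ', Module.End.mul_apply, LinearMap.smul_apply]
        exact V.smul_mem _ (hV _ ih)
    rw [LinearMap.smul_apply, LinearMap.sum_apply]
    exact V.smul_mem _ (V.sum_mem fun a _ => h1 a)
  · have h1 : ∀ a : ℕ, ((μ⁻¹ • T) ^ a) x - x ∈ V := by
      intro a
      induction a with
      | zero => simp
      | succ a ih =>
        have e : ((μ⁻¹ • T) ^ (a + 1)) x - x =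
            μ⁻¹ • T (((μ⁻¹ • T) ^ a) x - x) + μ⁻¹ • (T x - μ • x) := by
          rw [pow_succ', Module.End.mul_apply, LinearMap.smul_apply, map_sub, smul_sub, smul_sub,
            smul_smul, inv_mul_cancel₀ hμ0, one_smul]
          abel
        rw [e]
        exact add_mem (V.smul_mem _ (hV _ ih)) (V.smul_mem _ hx)
    have e : ((N : k)⁻¹ • ∑ a ∈ Finset.range N, (μ⁻¹ • T) ^ a) x - x =
        (N : k)⁻¹ • ∑ a ∈ Finset.range N, (((μ⁻¹ • T) ^ a) x - x) := by
      rw [Finset.sum_sub_distrib, smul_sub, Finset.sum_const, Finset.card_range,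
        ← Nat.cast_smul_eq_nsmul k, smul_smul, inv_mul_cancel₀ hN, one_smul, LinearMap.smul_apply,
        LinearMap.sum_apply]
    rw [e]
    exact V.smul_mem _ (V.sum_mem fun a _ => h1 a)
  · have h1 : ∀ (a : ℕ) x, ((μ⁻¹ • T) ^ a) (d x) = d (((μ⁻¹ • T) ^ a) x) := by
      intro a
      induction a with
      | zero => simp
      | succ a ih =>
        intro x
        rw [pow_succ', Module.End.mul_apply, LinearMap.smul_apply, ih, hd, Module.End.mul_apply,
          LinearMap.smul_apply, map_smul]
    simp only [LinearMap.smul_apply, LinearMap.sum_apply, h1, map_smul, map_sum]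

section chase
variable {lam : k} {N a b : ℕ} {B : OpCx k M S s} {C : OpCx k M' S' s}
  {f : Mor (truncScalar k) B C} {Λ : Mor (wtScalar lam 1) B B}

/-- Homogeneous correction: if the obstruction `d c` vanishes on the first page, then `c` can be
changed within its weight and its filtration step so that `d c` moves one step further. -/
lemma exists_improve (hN : (N : k) ≠ 0) (hlam : lam ^ N = 1) (hΛ : ∀ x, (Λ.g ^ N) x = x)
    {i q n w : ℤ} (hq : i < q) {z : M'} {c : M} (hc : c ∈ B.F i) (hcG : c ∈ B.G n)
    (hw : Λ.g c = lam ^ w • c) (hf : Bd C i n (f.g c - z)) (hd : Bd B q (n + 1) (B.d c)) :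
    ∃ c ∈ B.F i, c ∈ B.G n ∧ Λ.g c = lam ^ w • c ∧ Bd C i n (f.g c - z) ∧ B.d c ∈ B.F (q + 1) := by
  obtain ⟨v, h1, h2, h3⟩ := hd
  obtain ⟨π, p1, p2, p3, -, p4⟩ := exists_eigen_projection hN hlam Λ.g hΛ w
  have hv : π v ∈ B.F q := p3 _ (fun x hx => Λ.g_memF hx) _ h1
  refine ⟨c - π v, sub_mem hc (B.F_anti hq.le hv), sub_mem hcG (p3 _ (fun x hx => Λ.g_mem hx) _
    (by simpa using h2)), by rw [map_sub, hw, p1, smul_sub], ?_, ?_⟩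
  · rw [map_sub, sub_right_comm]
    exact hf.sub (Bd.of_mem (C.F_anti (by omega) (f.g_memF hv)))
  · have : π (B.d c - B.d v) ∈ B.F (q + 1) := p3 _ (fun x hx => Λ.g_memF hx) _ h3
    rwa [map_sub, p4 _ Λ.g_d, p4 _ Λ.g_d, p2 c hw, ← map_sub] at this

/-- A class on the first page of `C` that comes from a cocycle lifts to a cocycle of `B`. The lift
of top weight survives: the obstruction on the second page is of top weight and maps to zero in `C`,
and the later obstructions lie in bidegrees in which the weight in question does not occur. -/
lemma FirstPage.exists_lift (h : FirstPage lam 1 a b f Λ) (hN : (N : k) ≠ 0) (hlam : lam ^ N = 1)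
    (hprim : ∀ δ : ℕ, lam ^ δ = 1 → N ∣ δ) (hΛ : ∀ x, (Λ.g ^ N) x = x)
    (hab : (a : ℤ) + 3 * b - 1 < 2 * N) {i n : ℤ} {z : M'}
    (hz : z ∈ C.F i) (hzG : z ∈ C.G n) (hdz : C.d z = 0) :
    ∃ c ∈ B.G n, B.d c = 0 ∧ Bd C i n (f.g c - z) := by
  have hN0 : N ≠ 0 := by rintro rfl; simp at hN
  have hlam0 : lam ≠ 0 := by rintro rfl; simp [hN0] at hlam
  have hne : ∀ (w : ℤ) (δ : ℕ), 1 ≤ δ → δ < N → lam ^ w ≠ lam ^ (w - δ) := by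
    intro w δ h1 h2 heq
    rw [zpow_sub₀ hlam0, eq_div_iff (zpow_ne_zero _ hlam0), mul_eq_left₀ (zpow_ne_zero _ hlam0),
      zpow_natCast] at heq
    exact absurd (Nat.le_of_dvd (by omega) (hprim δ heq)) (by omega)
  have hzC : Cy C i n z := ⟨hz, hzG, by rw [hdz]; exact Submodule.zero_mem _⟩
  have htriv : Bd C i n z → ∃ c ∈ B.G n, B.d c = 0 ∧ Bd C i n (f.g c - z) := fun hb =>
    ⟨0, Submodule.zero_mem _, map_zero _, by simpa using hb.neg⟩
  by_cases hi : (a : ℤ) < i ∨ (b : ℤ) < n - i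
  · exact htriv (h.bound hzC hi)
  push Not at hi
  by_cases hi0 : i < 0
  · exact htriv (Bd.of_mem (C.F_top (by omega)))
  by_cases hj0 : n < i
  · rw [C.F_big hj0 hz hzG]
    exact ⟨0, Submodule.zero_mem _, map_zero _, by simpa using Bd.of_mem (Submodule.zero_mem _)⟩
  obtain ⟨c₀, hc₀, hw₀, hf₀⟩ := h.top_surj hzC
  set w : ℤ := (1 : ℕ) * i + 2 * (n - i) with hwdef
  have claim : ∀ m : ℕ, ∃ c ∈ B.F i, c ∈ B.G n ∧ Λ.g c = lam ^ w • c ∧ Bd C i n (f.g c - z) ∧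
      B.d c ∈ B.F (i + 2 + m) := by
    intro m
    induction m with
    | zero =>
      have := exists_improve hN hlam hΛ (lt_add_one i) hc₀.1 hc₀.2.1 hw₀ hf₀
        (h.degen_left.d_bd hc₀)
      simpa [add_assoc] using this
    | succ m ih =>
      obtain ⟨c, hc, hcG, hw, hf, hd⟩ := ih
      have hdG := B.d_mem hcG
      rw [show i + 2 + ((m + 1 : ℕ) : ℤ) = i + 2 + m + 1 by push_cast; ring]
      refine exists_improve hN hlam hΛ (by omega) hc hcG hw hf ?_
      by_cases hbig : n + 1 < i + 2 + m
      · rw [B.F_big hbig hd hdG]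
        exact Bd.of_mem (Submodule.zero_mem _)
      have hcy : Cy B (i + 2 + m) (n + 1) (B.d c) :=
        ⟨hd, hdG, by rw [B.d_d]; exact Submodule.zero_mem _⟩
      have hwd : Λ.g (B.d c) = lam ^ w • B.d c := by rw [Λ.g_d, hw, map_smul]
      have htop : (1 : ℕ) * (i + 2 + (m : ℤ)) + 2 * (n + 1 - (i + 2 + m)) = w - m := by
        rw [hwdef]
        push_cast
        ring
      rcases m with _ | m
      · refine h.top_inj w hcy hwd (fun δ hδ1 hδ => ?_) ?_
        · rw [htop] at hδ ⊢
          rw [Nat.cast_zero, sub_zero] at hδ ⊢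
          refine hne w δ hδ1 ?_
          push_cast at hwdef hbig
          omega
        · obtain ⟨y, hy1, hy2, hy3⟩ := hf
          have hg : Cy C (i + 1) n (f.g c - z - C.d y) := by
            refine ⟨hy3, sub_mem (sub_mem (f.g_mem hcG) hzG) (by simpa using C.d_mem hy2), ?_⟩
            rw [map_sub, map_sub, C.d_d, hdz, sub_zero, sub_zero, ← f.g_d]
            have := f.g_memF hd
            simpa [add_assoc] using this
          have := h.degen_right.d_bd hg
          rw [map_sub, map_sub, C.d_d, hdz, sub_zero, sub_zero, ← f.g_d] at this
          simpa [add_assoc] using this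
      · refine h.vanish w hcy hwd (fun δ hδ => ?_)
        rw [htop] at hδ ⊢
        rw [sub_sub, ← Nat.cast_add]
        refine hne w _ (by omega) ?_
        push_cast at hwdef hbig hδ
        omega
  obtain ⟨c, hc, hcG, hw, hf, hd⟩ := claim (n - i).toNat
  exact ⟨c, hcG, B.F_big (by omega) hd (B.d_mem hcG), hf⟩

/-- Under the numerical bound, `f` is surjective on cohomology. -/
theorem FirstPage.surjective (h : FirstPage lam 1 a b f Λ) (hN : (N : k) ≠ 0) (hlam : lam ^ N = 1)
    (hprim : ∀ δ : ℕ, lam ^ δ = 1 → N ∣ δ) (hΛ : ∀ x, (Λ.g ^ N) x = x)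
    (hab : (a : ℤ) + 3 * b - 1 < 2 * N) {n : ℤ} {z : M'} (hzG : z ∈ C.G n) (hdz : C.d z = 0) :
    ∃ c ∈ B.G n, B.d c = 0 ∧ ∃ y ∈ C.G (n - 1), f.g c - z = C.d y := by
  have key : ∀ (t : ℕ) (z : M'), z ∈ C.F (n + 1 - t) → z ∈ C.G n → C.d z = 0 →
      ∃ c ∈ B.G n, B.d c = 0 ∧ ∃ y ∈ C.G (n - 1), f.g c - z = C.d y := by
    intro t
    induction t with
    | zero =>
      intro z hz hzG _
      rw [C.F_big (by push_cast; omega) hz hzG]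
      exact ⟨0, Submodule.zero_mem _, map_zero _, 0, Submodule.zero_mem _, by simp⟩
    | succ t ih =>
      intro z hz hzG hdz
      obtain ⟨c, hcG, hdc, y, _, hy, hcy⟩ := h.exists_lift hN hlam hprim hΛ hab hz hzG hdz
      obtain ⟨c', hcG', hdc', y', hy', e⟩ := ih (z - f.g c + C.d y)
        (by
          have := Submodule.neg_mem _ hcy
          rw [show n + 1 - ((t + 1 : ℕ) : ℤ) + 1 = n + 1 - t by push_cast; ring] at this
          convert this using 1
          abel)
        (add_mem (sub_mem hzG (f.g_mem hcG)) (by simpa using C.d_mem hy))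
        (by rw [map_add, map_sub, C.d_d, hdz, ← f.g_d, hdc, map_zero, sub_zero, add_zero])
      refine ⟨c + c', add_mem hcG hcG', by rw [map_add, hdc, hdc', add_zero], y' + y,
        add_mem hy' hy, ?_⟩
      rw [map_add, map_add, ← e]
      abel
  exact key (n + 1).toNat z (C.F_top (by omega)) hzG hdz

end chase

end OpCx

namespace OpCx

variable {k : Type*} [Field k] {S S' : LowerSet ℕ} {s r : ℕ}

/-! ### Invariants under operators that come from an acyclic resolution -/

section triv
variable {V : Type u} [AddCommGroup V] [Module k V]

/-- The filtration with `F i` everything for `i ≤ 0` and zero for `i > 0`. -/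
def trivF (k : Type*) [Field k] (V : Type u) [AddCommGroup V] [Module k V] (i : ℤ) :
    Submodule k V := if i ≤ 0 then ⊤ else ⊥

lemma trivF_of_le {i : ℤ} (h : i ≤ 0) : trivF k V i = ⊤ := if_pos h
lemma trivF_of_lt {i : ℤ} (h : 0 < i) : trivF k V i = ⊥ := if_neg (not_le.2 h)

lemma mem_trivF {i : ℤ} {x : V} : x ∈ trivF k V i ↔ (0 < i → x = 0) := by
  by_cases h : i ≤ 0
  · simp [trivF_of_le h, not_lt.2 h]
  · push Not at h
    simp [trivF_of_lt h, h]

/-- The module `V`, placed in degree zero, with zero operators. -/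
def trivCx (k : Type*) [Field k] (V : Type u) [AddCommGroup V] [Module k V] (S : LowerSet ℕ)
    (hS : 0 ∈ S) (s : ℕ) : OpCx k V S s where
  d := 0
  G n := if n = 0 then ⊤ else ⊥
  F := trivF k V
  θ _ _ := 0
  zero_mem := hS
  d_d _ := rfl
  d_mem _ := Submodule.zero_mem _
  d_memF _ := Submodule.zero_mem _
  G_neg {n x} hn hx := by simpa [hn.ne] using hx
  F_anti {i j} h x hx := by
    rw [mem_trivF] at hx ⊢
    exact fun hi => hx (hi.trans_le h)
  F_top h := mem_trivF.2 fun h' => absurd h (not_le.2 h')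
  F_big {i n x} h hF hG := by
    by_cases hn : n = 0
    · exact mem_trivF.1 hF (by omega)
    · simpa [hn] using hG
  θ_d _ _ _ := by simp
  θ_mem _ _ _ _ _ := Submodule.zero_mem _
  θ_memF _ _ _ _ _ := Submodule.zero_mem _
  θ_comm _ _ _ _ _ _ := by simp
  θ_θ _ _ _ := rfl
  θ_out _ _ _ _ := rfl

variable {hS : 0 ∈ S} {hS' : 0 ∈ S'}

lemma trivCx_G {n : ℤ} {x : V} : x ∈ (trivCx k V S hS s).G n ↔ (n ≠ 0 → x = 0) := by
  by_cases h : n = 0 <;> simp [trivCx, h]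

lemma trivCx_F {i : ℤ} {x : V} : x ∈ (trivCx k V S hS s).F i ↔ (0 < i → x = 0) := mem_trivF

/-- The identity of `V`, with arbitrary scalars. -/
def trivMor (c : ℕ → k) (hc : ∀ m, m ∈ S → m ∉ S' → c m = 0) :
    Mor c (trivCx k V S hS s) (trivCx k V S' hS' s) where
  g := LinearMap.id
  g_d _ := rfl
  g_mem h := h
  g_memF h := h
  g_θ _ _ _ := by simp [trivCx]
  supp := hc

lemma K_d_eq_zero {M : Type u} [AddCommGroup M] [Module k M] {C : OpCx k M S s}
    (hd : ∀ x, C.d x = 0) (hθ : ∀ l m x, C.θ l m x = 0) (x : KM s M) : C.K.d x = 0 := by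
  induction s generalizing M with
  | zero => exact hd x
  | succ s ih =>
    refine ih (C := C.step) (fun x => ?_) (fun l m x => ?_) x
    · funext m
      rcases m with _ | m
      · simp [hd]
      · simp [hd, hθ]
    · funext m
      simp [hθ]

lemma K_G_le_F {M : Type u} [AddCommGroup M] [Module k M] {C : OpCx k M S s}
    (h : ∀ n, C.G n ≤ C.F n) (n : ℤ) : C.K.G n ≤ C.K.F n := by
  induction s generalizing M with
  | zero => exact h n
  | succ s ih => exact ih (C := C.step) fun n x hx m => h _ (hx m).1

lemma trivCx_K_d (x : KM s V) : (trivCx k V S hS s).K.d x = 0 :=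
  K_d_eq_zero (fun _ => rfl) (fun _ _ _ => rfl) x

lemma trivCx_K_cy {n : ℤ} {x : KM s V} (hx : x ∈ (trivCx k V S hS s).K.G n) :
    Cy (trivCx k V S hS s).K n n x := by
  refine ⟨K_G_le_F (fun n x hx => ?_) n hx, hx, by rw [trivCx_K_d]; exact Submodule.zero_mem _⟩
  rw [trivCx_G] at hx
  exact trivCx_F.2 fun h => hx h.ne'

lemma trivCx_K_eq_zero {n : ℤ} {x : KM s V} (hx : x ∈ (trivCx k V S hS s).K.G n)
    (h : Bd (trivCx k V S hS s).K n n x) : x = 0 := by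
  obtain ⟨y, -, -, hy⟩ := h
  rw [trivCx_K_d, sub_zero] at hy
  exact OpCx.F_big _ (by omega) hy hx

lemma trivCx_degen : Degen (trivCx k V S hS s) where
  d_bd _ := Bd.of_mem (Submodule.zero_mem _)
  θ_bd _ _ _ _ _ _ := Bd.of_mem (Submodule.zero_mem _)

lemma trivCx_cy {i n : ℤ} {x : V} (hx : Cy (trivCx k V S hS s) i n x) (hi : i < 0 ∨ i ≠ n) :
    Bd (trivCx k V S hS s) i n x := by
  refine Bd.of_mem (trivCx_F.2 fun h => ?_)
  by_cases h0 : n = 0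
  · exact trivCx_F.1 hx.1 (by omega)
  · exact trivCx_G.1 hx.2.1 h0

lemma trivCx_bd {n : ℤ} {x : V} (h : Bd (trivCx k V S hS s) n n x) (hn : 0 ≤ n) : x = 0 := by
  obtain ⟨y, -, -, hy⟩ := h
  have : x ∈ (trivCx k V S hS s).F (n + 1) := by simpa [trivCx] using hy
  exact trivCx_F.1 this (by omega)

lemma trivCx_firstPage (lam : k) (κ : ℕ) (hc : ∀ m, m ∈ S → m ∉ S' → truncScalar k m = 0) :
    FirstPage lam κ 0 0 (trivMor (V := V) (s := s) (hS := hS) (hS' := hS') (truncScalar k) hc)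
      (trivMor (V := V) (s := s) (hS := hS) (hS' := hS) (wtScalar lam κ)
        (fun _ h h' => absurd h h')) where
  degen_left := trivCx_degen
  degen_right := trivCx_degen
  vanish {i n x} w hx hΛ hw := by
    by_cases hi : i < 0 ∨ i ≠ n
    · exact trivCx_cy hx hi
    push Not at hi
    obtain ⟨hi, rfl⟩ := hi
    by_cases h0 : i = 0
    · subst h0
      by_cases hx0 : x = 0
      · rw [hx0]; exact Bd.of_mem (Submodule.zero_mem _)
      have h1 : x = lam ^ w • x := hΛ
      have h2 : lam ^ w = 1 := by
        have : (lam ^ w - 1) • x = 0 := by rw [sub_smul, ← h1, one_smul, sub_self]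
        exact sub_eq_zero.1 ((smul_eq_zero.1 this).resolve_right hx0)
      exact absurd (by simp [h2]) (hw 0 (by simp))
    · rw [trivCx_G.1 hx.2.1 h0]
      exact Bd.of_mem (Submodule.zero_mem _)
  top_inj {i n x} w hx _ _ hf := by
    by_cases hi : i < 0 ∨ i ≠ n
    · exact trivCx_cy hx hi
    push Not at hi
    obtain ⟨hi, rfl⟩ := hi
    have : x = 0 := trivCx_bd hf hi
    rw [this]
    exact Bd.of_mem (Submodule.zero_mem _)
  top_surj {i n z} hz := by
    by_cases hi : i < 0 ∨ i ≠ n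
    · refine ⟨0, ⟨Submodule.zero_mem _, Submodule.zero_mem _, by simp⟩, by simp, ?_⟩
      simpa using (trivCx_cy hz hi).neg
    push Not at hi
    obtain ⟨hi, rfl⟩ := hi
    refine ⟨z, ⟨trivCx_F.2 (trivCx_F.1 hz.1), trivCx_G.2 (trivCx_G.1 hz.2.1),
      Submodule.zero_mem _⟩, ?_, ?_⟩
    · by_cases h0 : i = 0
      · subst h0
        simp [trivMor]
      · rw [trivCx_G.1 hz.2.1 h0]
        simp
    · simpa [trivMor] using Bd.of_mem (Submodule.zero_mem _)
  bound {i n z} hz h := by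
    by_cases hi : 0 < i
    · rw [trivCx_F.1 hz.1 hi]
      exact Bd.of_mem (Submodule.zero_mem _)
    · exact trivCx_cy hz (by push_cast at h; omega)

end triv

section transfer
variable {V M M' : Type u} [AddCommGroup V] [Module k V] [AddCommGroup M] [Module k M]
  [AddCommGroup M'] [Module k M']

/-- An acyclic complex with operators that resolves `V` as a complex with operators. -/
structure IsResolution (hS : 0 ∈ S) (C : OpCx k M S r)
    (α : Mor (fun _ => (1 : k)) (trivCx k V S hS r) C) : Prop where
  acyc : Acyc C
  qi : IsQI (trivCx k V S hS r) C α.g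

variable {hS : 0 ∈ S} {C : OpCx k M S r} {α : Mor (fun _ => (1 : k)) (trivCx k V S hS r) C}

lemma ι_mem_K {n : ℤ} {x : M} (hx : x ∈ C.inv.G n) : C.ι x ∈ C.K.G n := ι_mem C hx.1

/-- A cocycle of invariants is represented, in the total complex, by an element of the total complex
of `V`. -/
lemma IsResolution.exists_rep (h : IsResolution hS C α) {n : ℤ} {x : M} (hx : x ∈ C.inv.G n)
    (hdx : C.d x = 0) : ∃ v ∈ (trivCx k V S hS r).K.G n, ∃ z ∈ C.K.G (n - 1),
      C.ι x = α.K.g v + C.K.d z := by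
  obtain ⟨v, hv, -, z, hz, e⟩ := (IsQI.K α h.qi).surj (ι_mem_K hx)
    (by rw [← ι_d C hx.2, hdx, map_zero])
  exact ⟨v, hv, z, hz, e⟩

/-- The representative in the total complex of `V` is unique, since the latter has zero
differential. -/
lemma IsResolution.rep_unique (h : IsResolution hS C α) {n : ℤ} {v : KM r V} {z : KM r M}
    (hv : v ∈ (trivCx k V S hS r).K.G n) (hz : z ∈ C.K.G (n - 1)) (e : α.K.g v = C.K.d z) :
    v = 0 := by
  obtain ⟨v', -, rfl⟩ := (IsQI.K α h.qi).inj hv (trivCx_K_d _) hz e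
  exact trivCx_K_d _

lemma IsResolution.inv_of_ι (h : IsResolution hS C α) {n : ℤ} {x : M} {z : KM r M}
    (hx : x ∈ C.inv.G n) (hdx : C.d x = 0) (hz : z ∈ C.K.G (n - 1)) (e : C.ι x = C.K.d z) :
    ∃ y ∈ C.inv.G (n - 1), C.d y = x :=
  (isQI_ι h.acyc).inj (C := C.inv) hx hdx hz e

/-- A map of resolutions that is zero on `V` is zero on the cohomology of the invariants. -/
lemma IsResolution.exists_of_zero (h : IsResolution hS C α) (η : Mor (fun _ => (1 : k)) C C)
    (hη : ∀ v, η.g (α.g v) = 0) {n : ℤ} {x : M} (hx : x ∈ C.inv.G n) (hdx : C.d x = 0) :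
    ∃ y ∈ C.inv.G (n - 1), C.d y = η.g x := by
  obtain ⟨v, hv, z, hz, e⟩ := h.exists_rep hx hdx
  have hK : ∀ {s : ℕ} {V M : Type u} [AddCommGroup V] [Module k V] [AddCommGroup M] [Module k M]
      {A : OpCx k V S s} {C : OpCx k M S s} (α : Mor (fun _ => (1 : k)) A C)
      (η : Mor (fun _ => (1 : k)) C C), (∀ v, η.g (α.g v) = 0) → ∀ v, η.K.g (α.K.g v) = 0 := by
    intro s
    induction s with
    | zero => exact fun _ _ h => h
    | succ s ih =>
      intro V M _ _ _ _ A C α η h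
      refine ih α.step η.step fun v => ?_
      funext m
      simp [h]
  have hinv : η.g x ∈ C.inv.G n := by
    refine ⟨η.g_mem hx.1, fun l => ?_⟩
    have := η.g_θ l 0 x
    rw [hx.2 l] at this
    simpa using this.symm
  refine h.inv_of_ι hinv (by rw [← η.g_d, hdx, map_zero]) (η.K.g_mem hz) ?_
  rw [← Mor.K_ι rfl, e, map_add, hK α η hη, zero_add, η.K.g_d]

variable {hS' : 0 ∈ S'} {C' : OpCx k M' S' r}
  {α' : Mor (fun _ => (1 : k)) (trivCx k V S' hS' r) C'}

lemma mor_inv_mem {c : ℕ → k} (hc0 : c 0 = 1) (φ : Mor c C C')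
    {n : ℤ} {x : M} (hx : x ∈ C.inv.G n) : φ.g x ∈ C'.inv.G n := by
  refine ⟨φ.g_mem hx.1, fun l => ?_⟩
  have := φ.g_θ l 0 x
  rw [hx.2 l, hc0] at this
  simpa using this.symm

end transfer

section facts
variable {V M M' : Type u} [AddCommGroup V] [Module k V] [AddCommGroup M] [Module k M]
  [AddCommGroup M'] [Module k M'] {lam : k}
  {hS : 0 ∈ (⊤ : LowerSet ℕ)} {hS' : 0 ∈ LowerSet.Iic (1 : ℕ)}
  {B : OpCx k M ⊤ r} {C : OpCx k M' (LowerSet.Iic 1) r}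
  {α : Mor (fun _ => (1 : k)) (trivCx k V ⊤ hS r) B}
  {β : Mor (fun _ => (1 : k)) (trivCx k V (LowerSet.Iic 1) hS' r) C}
  {f : Mor (truncScalar k) B C} {Λ : Mor (wtScalar lam 2) B B}

lemma trivCx_K_firstPage (hlam : lam ≠ 0) :
    FirstPage lam 2 (0 + r) 0
      (trivMor (V := V) (s := r) (hS := hS) (hS' := hS') (truncScalar k)
        (fun _ _ hm => if_neg hm)).K
      (trivMor (V := V) (s := r) (hS := hS) (hS' := hS) (wtScalar lam 2)
        (fun _ h h' => absurd h h')).K :=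
  (trivCx_firstPage lam 2 _).K hlam two_pos

section
variable (hα : IsResolution hS B α) (hΛα : ∀ v, Λ.g (α.g v) = α.g v)
include hα hΛα

/-- The weight of a cocycle of invariants is the weight of its representative. -/
lemma rep_weight {n w : ℤ} {x : M} {v : KM r V} {z : KM r M}
    (hw : Λ.g x = lam ^ w • x) (hv : v ∈ (trivCx k V ⊤ hS r).K.G n) (hz : z ∈ B.K.G (n - 1))
    (e : B.ι x = α.K.g v + B.K.d z) :
    (trivMor (V := V) (s := r) (hS := hS) (hS' := hS) (wtScalar lam 2)
        (fun _ h h' => absurd h h')).K.g v = lam ^ w • v := by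
  rw [← sub_eq_zero]
  set Λ₀ := trivMor (V := V) (s := r) (hS := hS) (hS' := hS) (wtScalar lam 2)
        (fun _ h h' => absurd h h')
  refine hα.rep_unique (n := n) (z := lam ^ w • z - Λ.K.g z)
    (sub_mem (Λ₀.K.g_mem hv) (Submodule.smul_mem _ _ hv))
    (sub_mem (Submodule.smul_mem _ _ hz) (Λ.K.g_mem hz)) ?_
  have h1 : Λ.K.g (α.K.g v) = α.K.g (Λ₀.K.g v) :=
    Mor.K_square (fun _ => by rw [mul_comm]) α Λ Λ₀ α (fun v => hΛα v) v
  have h2 : Λ.K.g (B.ι x) = lam ^ w • B.ι x := by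
    rw [Mor.K_ι (by simp [wtScalar]), hw, map_smul]
  rw [e, map_add, h1, Λ.K.g_d, smul_add] at h2
  rw [map_sub, map_smul, map_sub, map_smul]
  rw [sub_eq_sub_iff_add_eq_add, h2, add_comm]

theorem inv_vanish (hlam : lam ≠ 0) {n w : ℤ} {x : M} (hx : x ∈ B.inv.G n) (hdx : B.d x = 0)
    (hw : Λ.g x = lam ^ w • x)
    (h : ∀ δ : ℕ, 2 * (δ : ℤ) ≤ 2 * n → lam ^ w ≠ lam ^ (2 * n - δ)) :
    ∃ y ∈ B.inv.G (n - 1), B.d y = x := by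
  obtain ⟨v, hv, z, hz, e⟩ := hα.exists_rep hx hdx
  have h1 := (trivCx_K_firstPage (V := V) (r := r) (hS := hS)
    (hS' := LowerSet.mem_Iic_iff.2 zero_le_one) hlam).vanish w (trivCx_K_cy hv)
    (rep_weight hα hΛα hw hv hz e) (by simpa using h)
  rw [trivCx_K_eq_zero hv h1, map_zero, zero_add] at e
  exact hα.inv_of_ι hx hdx hz e

end

lemma K_f_rep (hfα : ∀ v, f.g (α.g v) = β.g v) (v : KM r V) :
    f.K.g (α.K.g v) = β.K.g ((trivMor (V := V) (s := r) (hS := hS) (hS' := hS') (truncScalar k)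
      (fun _ _ hm => if_neg hm)).K.g v) :=
  Mor.K_square (fun _ => by rw [mul_comm]) α f (trivMor _ _) β (fun v => hfα v) v

lemma ι_inv_d {n : ℤ} {y : M'} (hy : y ∈ C.inv.G n) : C.ι (C.d y) = C.K.d (C.ι y) := ι_d C hy.2

variable (hα : IsResolution hS B α) (hβ : IsResolution hS' C β)
  (hΛα : ∀ v, Λ.g (α.g v) = α.g v) (hfα : ∀ v, f.g (α.g v) = β.g v)
include hβ

theorem inv_bound (hlam : lam ≠ 0) {n : ℤ} {z : M'} (hz : z ∈ C.inv.G n) (hdz : C.d z = 0)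
    (hn : r < n) : ∃ y ∈ C.inv.G (n - 1), C.d y = z := by
  obtain ⟨v, hv, z', hz', e⟩ := hβ.exists_rep hz hdz
  have h1 := (trivCx_K_firstPage (V := V) (r := r) (hS := LowerSet.mem_top) (hS' := hS') hlam).bound
    (trivCx_K_cy hv) (Or.inl (by push_cast; omega))
  rw [trivCx_K_eq_zero hv h1, map_zero, zero_add] at e
  exact hβ.inv_of_ι hz hdz hz' e

include hα hΛα hfα

theorem inv_top_inj (hlam : lam ≠ 0) {n w : ℤ} {x : M} (hx : x ∈ B.inv.G n) (hdx : B.d x = 0)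
    (hw : Λ.g x = lam ^ w • x)
    (h : ∀ δ : ℕ, 1 ≤ δ → 2 * (δ : ℤ) ≤ 2 * n → lam ^ w ≠ lam ^ (2 * n - δ)) {y : M'}
    (hy : y ∈ C.inv.G (n - 1)) (hfx : f.g x = C.d y) :
    ∃ y ∈ B.inv.G (n - 1), B.d y = x := by
  obtain ⟨v, hv, z, hz, e⟩ := hα.exists_rep hx hdx
  set f₀ := trivMor (V := V) (s := r) (hS := hS) (hS' := hS') (truncScalar k)
      (fun _ _ hm => if_neg hm) with hf₀
  have h0 : f₀.K.g v = 0 := by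
    refine hβ.rep_unique (z := C.ι y - f.K.g z) (f₀.K.g_mem hv)
      (sub_mem (ι_mem_K hy) (f.K.g_mem hz)) ?_
    have h2 : f.K.g (B.ι x) = C.K.d (C.ι y) := by
      rw [Mor.K_ι (by simp [truncScalar]), hfx, ι_inv_d hy]
    rw [e, map_add, K_f_rep hfα, f.K.g_d] at h2
    rw [map_sub, ← h2, add_sub_cancel_right]
  have h1 := (trivCx_K_firstPage (V := V) (r := r) (hS := hS) (hS' := hS') hlam).top_inj
    w (trivCx_K_cy hv) (rep_weight hα hΛα hw hv hz e) (by simpa using h)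
    (by rw [← hf₀, h0]; exact Bd.of_mem (Submodule.zero_mem _))
  rw [trivCx_K_eq_zero hv h1, map_zero, zero_add] at e
  exact hα.inv_of_ι hx hdx hz e

theorem inv_top_surj {N : ℕ} (hN : (N : k) ≠ 0) (hlamN : lam ^ N = 1)
    (hΛN : ∀ x, (Λ.g ^ N) x = x) {n : ℤ} {z : M'} (hz : z ∈ C.inv.G n) (hdz : C.d z = 0) :
    ∃ x ∈ B.inv.G n, B.d x = 0 ∧ Λ.g x = lam ^ (2 * n) • x ∧
      ∃ y ∈ C.inv.G (n - 1), C.d y = f.g x - z := by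
  have hN0 : N ≠ 0 := by rintro rfl; simp at hN
  have hlam : lam ≠ 0 := by rintro rfl; simp [hN0] at hlamN
  obtain ⟨v, hv, z', hz', e⟩ := hβ.exists_rep hz hdz
  obtain ⟨u, hu, hwu, hfu⟩ :=
    (trivCx_K_firstPage (V := V) (r := r) (hS := hS) (hS' := hS') hlam).top_surj (trivCx_K_cy hv)
  set f₀ := trivMor (V := V) (s := r) (hS := hS) (hS' := hS') (truncScalar k)
      (fun _ _ hm => if_neg hm) with hf₀
  set Λ₀ := trivMor (V := V) (s := r) (hS := hS) (hS' := hS) (wtScalar lam 2)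
        (fun _ h h' => absurd h h')
  have hwu' : Λ₀.K.g u = lam ^ (2 * n) • u := by simpa using hwu
  have hfu' : f₀.K.g u = v :=
    sub_eq_zero.1 (trivCx_K_eq_zero (sub_mem (f₀.K.g_mem hu.2.1) hv) hfu)
  obtain ⟨x, hx, hdx, z'', hz'', e'⟩ := (isQI_ι hα.acyc).surj (C := B.inv) (α.K.g_mem hu.2.1)
    (by rw [← α.K.g_d, trivCx_K_d, map_zero])
  have hcob : ∃ t ∈ B.inv.G (n - 1), B.d t = Λ.g x - lam ^ (2 * n) • x := by
    refine hα.inv_of_ι (z := lam ^ (2 * n) • z'' - Λ.K.g z'')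
      (sub_mem (mor_inv_mem (by simp [wtScalar]) Λ hx) (Submodule.smul_mem _ _ hx))
      (by rw [map_sub, map_smul, ← Λ.g_d, show B.d x = 0 from hdx, map_zero, smul_zero, sub_zero])
      (sub_mem (Submodule.smul_mem _ _ hz'') (Λ.K.g_mem hz'')) ?_
    have h1 : Λ.K.g (α.K.g u) = α.K.g (Λ₀.K.g u) :=
      Mor.K_square (fun _ => by rw [mul_comm]) α Λ Λ₀ α (fun v => hΛα v) u
    rw [hwu', map_smul, e', map_add, Λ.K.g_d, Mor.K_ι (by simp [wtScalar]), smul_add] at h1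
    rw [map_sub, map_smul, map_sub, map_smul, sub_eq_sub_iff_add_eq_add, h1, add_comm]
  obtain ⟨π, p1, -, p3, p4, p5⟩ := exists_eigen_projection hN hlamN Λ.g hΛN (2 * n)
  have hstab : ∀ m, ∀ x ∈ B.inv.G m, Λ.g x ∈ B.inv.G m := fun m x hx =>
    mor_inv_mem (by simp [wtScalar]) Λ hx
  obtain ⟨t, ht, hdt⟩ : π x - x ∈ (B.inv.G (n - 1)).map B.d := by
    refine p4 _ ?_ x hcob
    rintro _ ⟨t, ht, rfl⟩
    exact ⟨Λ.g t, hstab _ t ht, (Λ.g_d t).symm⟩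
  have hfx : ∃ y ∈ C.inv.G (n - 1), C.d y = f.g x - z := by
    refine hβ.inv_of_ι (z := -f.K.g z'' - z')
      (sub_mem (mor_inv_mem (by simp [truncScalar]) f hx) hz)
      (by rw [map_sub, ← f.g_d, show B.d x = 0 from hdx, hdz, map_zero, sub_zero])
      (sub_mem (Submodule.neg_mem _ (f.K.g_mem hz'')) hz') ?_
    have h1 := K_f_rep hfα u
    rw [← hf₀, hfu', e', map_add, Mor.K_ι (by simp [truncScalar]), f.K.g_d] at h1
    rw [map_sub, e, ← h1, map_sub, map_neg]
    abel
  obtain ⟨y, hy, hdy⟩ := hfx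
  refine ⟨π x, p3 _ (hstab n) x hx, by rw [← p5 B.d Λ.g_d, show B.d x = 0 from hdx, map_zero],
    p1 x, f.g t + y, add_mem (mor_inv_mem (by simp [truncScalar]) f ht) hy, ?_⟩
  have : B.d t = π x - x := hdt
  rw [map_add, hdy, ← f.g_d, this, map_sub]
  abel

/-- The complex of invariants of an acyclic resolution of `V`, with the trivial filtration, has the
first page required for surjectivity. The complexes of invariants are presented by injective maps
`i` and `i'` whose images are the invariants; new operators are allowed on them as long as they
extend to maps of resolutions that are zero on `V`. -/
theorem firstPage_of_resolution {N : ℕ} (hN : (N : k) ≠ 0) (hlamN : lam ^ N = 1)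
    (hΛN : ∀ x, (Λ.g ^ N) x = x)
    {P P' : Type u} [AddCommGroup P] [Module k P] [AddCommGroup P'] [Module k P']
    {D : OpCx k P ⊤ s} {D' : OpCx k P' (LowerSet.Iic 1) s}
    {fD : Mor (truncScalar k) D D'} {ΛD : Mor (wtScalar lam 1) D D}
    (hF : ∀ n, D.F n = trivF k P n) (hF' : ∀ n, D'.F n = trivF k P' n)
    (i : P →ₗ[k] M) (i' : P' →ₗ[k] M') (hi : Function.Injective i) (hi' : Function.Injective i')
    (id : ∀ x, i (D.d x) = B.d (i x)) (id' : ∀ x, i' (D'.d x) = C.d (i' x))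
    (iG : ∀ {n x}, x ∈ D.G n → i x ∈ B.inv.G n) (iG' : ∀ {n x}, x ∈ D'.G n → i' x ∈ C.inv.G n)
    (iS : ∀ {n y}, y ∈ B.inv.G n → ∃ x ∈ D.G n, i x = y)
    (iS' : ∀ {n y}, y ∈ C.inv.G n → ∃ x ∈ D'.G n, i' x = y)
    (hf : ∀ x, i' (fD.g x) = f.g (i x)) (hΛ : ∀ x, i (ΛD.g x) = Λ.g (i x))
    (hη : ∀ l m, ∃ η : Mor (fun _ => (1 : k)) B B, (∀ v, η.g (α.g v) = 0) ∧
      ∀ x, i (D.θ l m x) = η.g (i x))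
    (hη' : ∀ l m, ∃ η : Mor (fun _ => (1 : k)) C C, (∀ v, η.g (β.g v) = 0) ∧
      ∀ x, i' (D'.θ l m x) = η.g (i' x)) :
    FirstPage lam 1 0 r fD ΛD := by
  have hN0 : N ≠ 0 := by rintro rfl; simp at hN
  have hlam : lam ≠ 0 := by rintro rfl; simp [hN0] at hlamN
  have dz : ∀ {n x}, Cy D 0 n x → i x ∈ B.inv.G n ∧ B.d (i x) = 0 := fun {n x} hx =>
    ⟨iG hx.2.1, by
      have := hx.2.2
      rw [hF, mem_trivF] at this
      rw [← id, this (by omega), map_zero]⟩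
  have dz' : ∀ {n x}, Cy D' 0 n x → i' x ∈ C.inv.G n ∧ C.d (i' x) = 0 := fun {n x} hx =>
    ⟨iG' hx.2.1, by
      have := hx.2.2
      rw [hF', mem_trivF] at this
      rw [← id', this (by omega), map_zero]⟩
  have bd : ∀ {n x}, (∃ y ∈ B.inv.G (n - 1), B.d y = i x) → Bd D 0 n x := by
    rintro n x ⟨y, hy, e⟩
    obtain ⟨y, hy', rfl⟩ := iS hy
    refine ⟨y, D.F_top le_rfl, hy', ?_⟩
    rw [← id] at e
    rw [← hi e, sub_self]
    exact Submodule.zero_mem _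
  have bd' : ∀ {n x}, (∃ y ∈ C.inv.G (n - 1), C.d y = i' x) → Bd D' 0 n x := by
    rintro n x ⟨y, hy, e⟩
    obtain ⟨y, hy', rfl⟩ := iS' hy
    refine ⟨y, D'.F_top le_rfl, hy', ?_⟩
    rw [← id'] at e
    rw [← hi' e, sub_self]
    exact Submodule.zero_mem _
  have neg : ∀ {j n x}, j < 0 → Bd D j n x := fun h => Bd.of_mem (D.F_top (by omega))
  have neg' : ∀ {j n x}, j < 0 → Bd D' j n x := fun h => Bd.of_mem (D'.F_top (by omega))
  have pos : ∀ {j n x}, 0 < j → Cy D j n x → x = 0 := fun h hx => by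
    have := hx.1
    rw [hF, mem_trivF] at this
    exact this h
  have pos' : ∀ {j n x}, 0 < j → Cy D' j n x → x = 0 := fun h hx => by
    have := hx.1
    rw [hF', mem_trivF] at this
    exact this h
  have zero : ∀ {j n}, Bd D j n 0 := Bd.of_mem (Submodule.zero_mem _)
  have zero' : ∀ {j n}, Bd D' j n 0 := Bd.of_mem (Submodule.zero_mem _)
  refine ⟨⟨fun {j n x} hx => ?_, fun l m {j n x} hx => ?_⟩,
    ⟨fun {j n x} hx => ?_, fun l m {j n x} hx => ?_⟩, fun {j n x} w hx hw h => ?_,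
    fun {j n x} w hx hw h hb => ?_, fun {j n z} hz => ?_, fun {j n z} hz h => ?_⟩
  · rcases lt_trichotomy j 0 with hj | rfl | hj
    · by_cases hj' : j + 1 < 0
      · exact neg hj'
      · obtain rfl : j = -1 := by omega
        exact Bd.d_of_mem (D.F_top (by omega)) (by simpa using hx.2.1)
    · have := hx.2.2
      rw [hF, mem_trivF] at this
      rw [this (by omega)]
      exact zero
    · rw [pos hj hx, map_zero]; exact zero
  · rcases lt_trichotomy j 0 with hj | rfl | hj
    · exact neg hj
    · obtain ⟨η, h1, h2⟩ := hη l m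
      refine bd ?_
      rw [h2]
      exact hα.exists_of_zero η h1 (dz hx).1 (dz hx).2
    · rw [pos hj hx, map_zero]; exact zero
  · rcases lt_trichotomy j 0 with hj | rfl | hj
    · by_cases hj' : j + 1 < 0
      · exact neg' hj'
      · obtain rfl : j = -1 := by omega
        exact Bd.d_of_mem (D'.F_top (by omega)) (by simpa using hx.2.1)
    · have := hx.2.2
      rw [hF', mem_trivF] at this
      rw [this (by omega)]
      exact zero'
    · rw [pos' hj hx, map_zero]; exact zero'
  · rcases lt_trichotomy j 0 with hj | rfl | hj
    · exact neg' hj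
    · obtain ⟨η, h1, h2⟩ := hη' l m
      refine bd' ?_
      rw [h2]
      exact hβ.exists_of_zero η h1 (dz' hx).1 (dz' hx).2
    · rw [pos' hj hx, map_zero]; exact zero'
  · rcases lt_trichotomy j 0 with hj | rfl | hj
    · exact neg hj
    · exact bd (inv_vanish hα hΛα hlam (dz hx).1 (dz hx).2 (by rw [← hΛ, hw, map_smul])
        (by simpa using h))
    · rw [pos hj hx]; exact zero
  · rcases lt_trichotomy j 0 with hj | rfl | hj
    · exact neg hj
    · obtain ⟨y, -, hy, e⟩ := hb
      rw [hF', mem_trivF] at e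
      refine bd (inv_top_inj hα hβ hΛα hfα hlam (dz hx).1 (dz hx).2 (by rw [← hΛ, hw, map_smul])
        (by simpa using h) (iG' hy) ?_)
      rw [← hf, sub_eq_zero.1 (e (by omega)), id']
    · rw [pos hj hx]; exact zero
  · rcases lt_trichotomy j 0 with hj | rfl | hj
    · exact ⟨0, ⟨Submodule.zero_mem _, Submodule.zero_mem _, by simp⟩, by simp, neg' hj⟩
    · obtain ⟨x, hx, hdx, hwx, y, hy, e⟩ :=
        inv_top_surj hα hβ hΛα hfα hN hlamN hΛN (dz' hz).1 (dz' hz).2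
      obtain ⟨x, hx', rfl⟩ := iS hx
      refine ⟨x, ⟨D.F_top le_rfl, hx', ?_⟩, ?_, bd' ⟨y, hy, ?_⟩⟩
      · rw [← id] at hdx
        rw [hi (hdx.trans (map_zero i).symm)]
        exact Submodule.zero_mem _
      · apply hi
        rw [hΛ, hwx, map_smul]
        simp
      · rw [e, map_sub, hf]
    · rw [pos' hj hz]
      exact ⟨0, ⟨Submodule.zero_mem _, Submodule.zero_mem _, by simp⟩, by simp,
        by simpa using zero'⟩
  · rcases lt_trichotomy j 0 with hj | rfl | hj
    · exact neg' hj
    · exact bd' (inv_bound hβ hlam (dz' hz).1 (dz' hz).2 (by omega))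
    · rw [pos' hj hz]; exact zero'

end facts

end OpCx

/-! ### The weight generator of the group algebra of a cyclic group -/

section weightGenerator
open Polynomial

variable (p : ℕ) [Fact p.Prime]

/-- The polynomial `∑ a⁻¹ t ^ a` over `a` modulo `p`. Evaluated at a generator `T` of the group of
order `p` it generates the augmentation ideal of the group algebra, and it is an eigenvector for the
automorphisms `T ↦ T ^ b`. -/
noncomputable def wtPoly : (ZMod p)[X] := ∑ a : ZMod p, C a⁻¹ * X ^ a.val

lemma sum_zmod_eq_zero (hp2 : 2 < p) : ∑ a : ZMod p, a = 0 := by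
  have h := FiniteField.sum_pow_lt_card_sub_one (ZMod p) 1 (by rw [ZMod.card]; omega)
  simpa using h

lemma wtPoly_eval_one (hp2 : 2 < p) : (wtPoly p).eval 1 = 0 := by
  simp only [wtPoly, eval_finsetSum, eval_mul, eval_C, eval_pow, eval_X, one_pow, mul_one]
  rw [← sum_zmod_eq_zero p hp2]
  exact Fintype.sum_equiv (Equiv.inv (ZMod p)) _ _ fun a => rfl

/-- `wtPoly p = (t - 1) U` with `U 1 = -1`. -/
lemma exists_wtPoly_factor (hp2 : 2 < p) : ∃ U : (ZMod p)[X], wtPoly p = (X - C 1) * U ∧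
    U.eval 1 = -1 := by
  obtain ⟨U, hU⟩ := dvd_iff_isRoot.2 (wtPoly_eval_one p hp2)
  refine ⟨U, hU, ?_⟩
  have h1 : (derivative (wtPoly p)).eval 1 = U.eval 1 := by
    rw [hU]
    simp
  rw [← h1, wtPoly]
  simp only [derivative_sum, derivative_C_mul, derivative_X_pow, eval_finsetSum, eval_mul, eval_C,
    eval_pow, eval_X, one_pow, mul_one, ZMod.natCast_val, ZMod.cast_id', id_eq]
  have h2 : ∀ a : ZMod p, a⁻¹ * a = if a = 0 then 0 else 1 := by
    intro a
    split_ifs with h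
    · simp [h]
    · exact inv_mul_cancel₀ h
  simp only [h2]
  rw [Finset.sum_ite, Finset.sum_const_zero, zero_add, Finset.sum_const, nsmul_eq_mul, mul_one,
    Finset.filter_ne', Finset.card_erase_of_mem (Finset.mem_univ _), Finset.card_univ, ZMod.card,
    Nat.cast_sub (by omega)]
  simp

variable {p} {M : Type u} [AddCommGroup M] [Module (ZMod p) M]

/-- The operator `∑ a⁻¹ T ^ a` over `a` modulo `p`. -/
noncomputable def wtOp (T : Module.End (ZMod p) M) : Module.End (ZMod p) M := aeval T (wtPoly p)

lemma wtOp_eq (T : Module.End (ZMod p) M) : wtOp T = ∑ a : ZMod p, a⁻¹ • T ^ a.val := by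
  simp [wtOp, wtPoly, Algebra.smul_def]

lemma wtOp_apply (T : Module.End (ZMod p) M) (x : M) :
    wtOp T x = ∑ a : ZMod p, a⁻¹ • (T ^ a.val) x := by
  simp [wtOp_eq]

lemma aeval_mem {T : Module.End (ZMod p) M} {V : Submodule (ZMod p) M} (hV : ∀ x ∈ V, T x ∈ V)
    (P : (ZMod p)[X]) {x : M} (hx : x ∈ V) : aeval T P x ∈ V := by
  have hpow : ∀ n : ℕ, (T ^ n) x ∈ V := by
    intro n
    induction n with
    | zero => simpa using hx
    | succ n ih => rw [pow_succ', Module.End.mul_apply]; exact hV _ ih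
  rw [aeval_eq_sum_range, LinearMap.sum_apply]
  exact V.sum_mem fun i _ => V.smul_mem _ (hpow i)

lemma wtOp_mem {T : Module.End (ZMod p) M} {V : Submodule (ZMod p) M} (hV : ∀ x ∈ V, T x ∈ V)
    {x : M} (hx : x ∈ V) : wtOp T x ∈ V := aeval_mem hV _ hx

lemma pow_eq_of_fixed {T : Module.End (ZMod p) M} {x : M} (hx : T x = x) (n : ℕ) :
    (T ^ n) x = x := by
  induction n with
  | zero => simp
  | succ n ih => rw [pow_succ, Module.End.mul_apply, hx, ih]

lemma aeval_eq_of_fixed {T : Module.End (ZMod p) M} {x : M} (hx : T x = x) (P : (ZMod p)[X]) :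
    aeval T P x = P.eval 1 • x := by
  rw [aeval_eq_sum_range, eval_eq_sum_range, LinearMap.sum_apply, Finset.sum_smul]
  simp [pow_eq_of_fixed hx]

lemma wtOp_eq_zero_of_fixed (hp2 : 2 < p) {T : Module.End (ZMod p) M} {x : M} (hx : T x = x) :
    wtOp T x = 0 := by
  rw [wtOp, aeval_eq_of_fixed hx, wtPoly_eval_one p hp2, zero_smul]

lemma sub_one_pow_char_pow (T : Module.End (ZMod p) M) (m : ℕ) :
    aeval T ((X - C 1 : (ZMod p)[X]) ^ p ^ m) = T ^ p ^ m - 1 := by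
  rw [sub_pow_char_pow, ← C_pow, one_pow]
  simp

/-- The factor `U` of `wtPoly p` is invertible modulo powers of `t - 1`. -/
lemma exists_bezout {U : (ZMod p)[X]} (hU : U.eval 1 = -1) (m : ℕ) :
    ∃ A : (ZMod p)[X], ∀ {T : Module.End (ZMod p) M} {x : M}, (T ^ p ^ m) x = x →
      aeval T (A * U) x = x := by
  have h1 : IsCoprime U ((X - C 1 : (ZMod p)[X]) ^ p ^ m) := by
    refine IsCoprime.pow_right (IsCoprime.symm ?_)
    rw [(irreducible_X_sub_C (1 : ZMod p)).coprime_iff_not_dvd, dvd_iff_isRoot, IsRoot, hU]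
    simp
  obtain ⟨A, B, hAB⟩ := h1
  refine ⟨A, fun {T x} hx => ?_⟩
  have h2 : aeval T (A * U) x + aeval T (B * (X - C 1) ^ p ^ m) x = x := by
    rw [← LinearMap.add_apply, ← map_add, hAB, map_one, Module.End.one_apply]
  rw [map_mul _ B, sub_one_pow_char_pow, Module.End.mul_apply, LinearMap.sub_apply, hx,
    Module.End.one_apply, sub_self, map_zero, add_zero] at h2
  exact h2

lemma fixed_of_wtOp_eq_zero (hp2 : 2 < p) {T : Module.End (ZMod p) M} {x : M} {m : ℕ}
    (hT : (T ^ p ^ m) x = x) (hx : wtOp T x = 0) : T x = x := by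
  obtain ⟨U, hU, hU1⟩ := exists_wtPoly_factor p hp2
  obtain ⟨A, hA⟩ := exists_bezout (M := M) hU1 m
  have h1 : aeval T U (T x - x) = 0 := by
    rw [wtOp, hU, mul_comm, map_mul, Module.End.mul_apply] at hx
    simpa using hx
  have h2 : (T ^ p ^ m) (T x - x) = T x - x := by
    rw [map_sub, hT, ← Module.End.mul_apply, ← pow_succ, pow_succ', Module.End.mul_apply, hT]
  have h3 := hA h2
  rw [map_mul, Module.End.mul_apply, h1, map_zero] at h3
  exact sub_eq_zero.1 h3.symm

/-- If `T` has locally finite `p`-power order and `T - 1` is surjective, then so is the weight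
generator. -/
lemma exists_wtOp_eq (hp2 : 2 < p) {T : Module.End (ZMod p) M} {V : Submodule (ZMod p) M}
    (hV : ∀ x ∈ V, T x ∈ V) (hT : ∀ x ∈ V, ∃ m : ℕ, (T ^ p ^ m) x = x)
    (hs : ∀ x ∈ V, ∃ y ∈ V, T y - y = x) {x : M} (hx : x ∈ V) : ∃ y ∈ V, wtOp T y = x := by
  obtain ⟨U, hU, hU1⟩ := exists_wtPoly_factor p hp2
  obtain ⟨y, hy, rfl⟩ := hs x hx
  obtain ⟨m, hm⟩ := hT y hy
  obtain ⟨A, hA⟩ := exists_bezout (M := M) hU1 m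
  refine ⟨aeval T A y, aeval_mem hV _ hy, ?_⟩
  rw [wtOp, hU, mul_comm, ← Module.End.mul_apply, ← map_mul,
    show U * (X - C 1) * A = (X - C 1) * (A * U) by ring, map_mul, Module.End.mul_apply, hA hm]
  simp

lemma wtOp_pow_char (hp2 : 2 < p) {T : Module.End (ZMod p) M} (hT : T ^ p = 1) :
    wtOp T ^ p = 0 := by
  obtain ⟨U, hU, -⟩ := exists_wtPoly_factor p hp2
  have h := sub_one_pow_char_pow T 1
  rw [pow_one, hT, sub_self] at h
  rw [wtOp, ← map_pow, hU, mul_pow, map_mul, h, zero_mul]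

/-- If `T ^ p = 1` and invariants are norms, then the kernel of the weight generator is the image of
its power of exponent `p - 1`. -/
lemma exists_wtOp_pow_eq (hp2 : 2 < p) {T : Module.End (ZMod p) M} (hT : T ^ p = 1) {x y : M}
    (hx : wtOp T x = 0) (hy : ∑ a ∈ Finset.range p, (T ^ a) y = x) :
    (wtOp T ^ (p - 1)) y = x := by
  obtain ⟨U, hU, hU1⟩ := exists_wtPoly_factor p hp2
  have hTx : T x = x := fixed_of_wtOp_eq_zero hp2 (m := 1) (by rw [pow_one, hT]; rfl) hx
  have hnorm : (X - C 1 : (ZMod p)[X]) ^ (p - 1) = ∑ a ∈ Finset.range p, X ^ a := by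
    have h1 : (X - C 1 : (ZMod p)[X]) ≠ 0 := X_sub_C_ne_zero 1
    apply mul_left_cancel₀ h1
    have h2 := mul_geom_sum (X : (ZMod p)[X]) p
    rw [← pow_succ', Nat.sub_add_cancel (by omega), C_1, h2, sub_pow_char, one_pow]
  rw [wtOp, ← map_pow, hU, mul_comm, mul_pow, hnorm, map_mul, Module.End.mul_apply, map_sum,
    LinearMap.sum_apply]
  simp only [map_pow, aeval_X]
  rw [hy, ← map_pow, aeval_eq_of_fixed hTx, eval_pow, hU1,
    ZMod.pow_card_sub_one_eq_one (neg_ne_zero.2 one_ne_zero), one_smul]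

/-- If the kernel of a nilpotent operator of order `p` is the image of its `(p - 1)`-st power, then
the kernel of the latter is the image of the operator. -/
lemma exists_eq_of_pow_eq_zero {X : Module.End (ZMod p) M} {V : Submodule (ZMod p) M}
    (hV : ∀ x ∈ V, X x ∈ V) (h : ∀ x ∈ V, X x = 0 → ∃ y ∈ V, (X ^ (p - 1)) y = x)
    {x : M} (hx : x ∈ V) (hx0 : (X ^ (p - 1)) x = 0) (hp2 : 2 < p) : ∃ y ∈ V, X y = x := by
  have hpow : ∀ (n : ℕ) {x}, x ∈ V → (X ^ n) x ∈ V := by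
    intro n x hx
    induction n with
    | zero => simpa using hx
    | succ n ih => rw [pow_succ', Module.End.mul_apply]; exact hV _ ih
  have key : ∀ a : ℕ, a + 1 < p → ∀ x ∈ V, (X ^ (a + 1)) x = 0 →
      ∃ y ∈ V, (X ^ (p - 1 - a)) y = x := by
    intro a
    induction a with
    | zero => intro _ x hx h0; exact h x hx (by simpa using h0)
    | succ a ih =>
      intro ha x hx h0
      obtain ⟨y, hy, e⟩ := h ((X ^ (a + 1)) x) (hpow _ hx)
        (by rw [← Module.End.mul_apply, ← pow_succ', h0])
      obtain ⟨z, hz, e'⟩ := ih (by omega) (x - (X ^ (p - 1 - (a + 1))) y)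
        (sub_mem hx (hpow _ hy)) (by
          rw [map_sub, ← Module.End.mul_apply, ← pow_add,
            show a + 1 + (p - 1 - (a + 1)) = p - 1 by omega, e, sub_self])
      refine ⟨y + X z, add_mem hy (hV _ hz), ?_⟩
      rw [map_add, ← Module.End.mul_apply (X ^ (p - 1 - (a + 1))) X, ← pow_succ,
        show p - 1 - (a + 1) + 1 = p - 1 - a by omega, e']
      abel
  obtain ⟨y, hy, e⟩ := key (p - 2) (by omega) x hx
    (by rwa [show p - 2 + 1 = p - 1 by omega])
  exact ⟨y, hy, by rwa [show p - 1 - (p - 2) = 1 by omega, pow_one] at e⟩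

/-- If `Λ` conjugates `T ^ b` into `T`, then the weight generator is an eigenvector. -/
lemma wtOp_conj {M' : Type v} [AddCommGroup M'] [Module (ZMod p) M'] {T : Module.End (ZMod p) M}
    {T' : Module.End (ZMod p) M'} (hT : T ^ p = 1) (Λ : M →ₗ[ZMod p] M') {b : ℕ}
    (hb : (b : ZMod p) ≠ 0) (hΛ : ∀ x, Λ ((T ^ b) x) = T' (Λ x)) (x : M) :
    (b : ZMod p) • Λ (wtOp T x) = wtOp T' (Λ x) := by
  have h1 : ∀ (n : ℕ) x, (T' ^ n) (Λ x) = Λ ((T ^ (b * n)) x) := by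
    intro n
    induction n with
    | zero => simp
    | succ n ih =>
      intro x
      rw [pow_succ, Module.End.mul_apply, ← hΛ, ih, ← Module.End.mul_apply, ← pow_add, mul_add,
        mul_one]
  have h2 : ∀ n : ℕ, T ^ n = T ^ (n : ZMod p).val := by
    intro n
    rw [ZMod.val_natCast, ← pow_mod_orderOf, ← pow_mod_orderOf T (n % p),
      Nat.mod_mod_of_dvd _ (orderOf_dvd_of_pow_eq_one hT)]
  rw [wtOp_apply, wtOp_apply, map_sum, Finset.smul_sum]
  refine Fintype.sum_equiv (Equiv.mulLeft₀ (b : ZMod p)⁻¹ (inv_ne_zero hb)) _ _ fun a => ?_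
  have e : Equiv.mulLeft₀ (b : ZMod p)⁻¹ (inv_ne_zero hb) a = (b : ZMod p)⁻¹ * a := rfl
  rw [e, h1, h2 (b * _), map_smul, smul_smul, mul_inv, inv_inv]
  congr 3
  push_cast
  rw [ZMod.natCast_val, ZMod.cast_id', id_eq, mul_inv_cancel_left₀ hb]

/-- A map that intertwines two operators intertwines their weight generators. -/
lemma wtOp_map {M' : Type v} [AddCommGroup M'] [Module (ZMod p) M'] {T : Module.End (ZMod p) M}
    {T' : Module.End (ZMod p) M'} (f : M →ₗ[ZMod p] M') (hf : ∀ x, f (T x) = T' (f x)) (x : M) :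
    f (wtOp T x) = wtOp T' (f x) := by
  have h1 : ∀ (n : ℕ) x, f ((T ^ n) x) = (T' ^ n) (f x) := by
    intro n
    induction n with
    | zero => simp
    | succ n ih =>
      intro x
      rw [pow_succ, Module.End.mul_apply, ih, hf, pow_succ, Module.End.mul_apply]
  simp [wtOp_apply, h1]

end weightGenerator

/-! ### Complexes with weight generators as operators -/

/-- A cochain complex modelled on one ambient module. -/
structure GrCx (k : Type*) [Field k] (M : Type*) [AddCommGroup M] [Module k M] where
  d : M →ₗ[k] M
  G : ℤ → Submodule k M
  d_d : ∀ x, d (d x) = 0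
  d_mem : ∀ {n x}, x ∈ G n → d x ∈ G (n + 1)
  G_neg : ∀ {n x}, n < 0 → x ∈ G n → x = 0

namespace GrCx

variable {k : Type*} [Field k] {M : Type u} [AddCommGroup M] [Module k M] {s : ℕ}

/-- Commuting operators on a complex. -/
structure Ops (A : GrCx k M) (s : ℕ) where
  X : Fin s → Module.End k M
  X_d : ∀ l x, X l (A.d x) = A.d (X l x)
  X_mem : ∀ l {n x}, x ∈ A.G n → X l x ∈ A.G n
  comm : ∀ l l' x, X l (X l' x) = X l' (X l x)

variable {A : GrCx k M}

lemma Ops.pow_d (O : Ops A s) (l : Fin s) (n : ℕ) (x : M) :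
    (O.X l ^ n) (A.d x) = A.d ((O.X l ^ n) x) := by
  induction n generalizing x with
  | zero => rfl
  | succ n ih => rw [pow_succ, Module.End.mul_apply, O.X_d, ih, Module.End.mul_apply]

lemma Ops.pow_mem (O : Ops A s) (l : Fin s) (n : ℕ) {i : ℤ} {x : M} (hx : x ∈ A.G i) :
    (O.X l ^ n) x ∈ A.G i := by
  induction n with
  | zero => exact hx
  | succ n ih => rw [pow_succ', Module.End.mul_apply]; exact O.X_mem l ih

lemma Ops.pow_comm (O : Ops A s) (l l' : Fin s) (n m : ℕ) (x : M) :
    (O.X l ^ n) ((O.X l' ^ m) x) = (O.X l' ^ m) ((O.X l ^ n) x) := by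
  have h : Commute (O.X l) (O.X l') := by
    ext x
    exact O.comm l l' x
  exact LinearMap.congr_fun (h.pow_pow n m) x

open OpCx

/-- For operators with `X ^ p = 0`: the periodic families `X, X ^ (p - 1), X, …`. -/
@[simps d G F θ]
def Ops.fin (O : Ops A s) (p : ℕ) (hp : 0 < p) (hX : ∀ l x, (O.X l ^ p) x = 0) :
    OpCx k M ⊤ s where
  d := A.d
  G := A.G
  F := trivF k M
  θ l m := if Even m then O.X l else O.X l ^ (p - 1)
  zero_mem := LowerSet.mem_top
  d_d := A.d_d
  d_mem := A.d_mem
  d_memF h := mem_trivF.2 fun hi => by rw [mem_trivF.1 h hi, map_zero]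
  G_neg := A.G_neg
  F_anti h _ hx := mem_trivF.2 fun hi => mem_trivF.1 hx (hi.trans_le h)
  F_top h := mem_trivF.2 fun h' => absurd h (not_le.2 h')
  F_big {i n x} h hF hG := by
    by_cases hn : n < 0
    · exact A.G_neg hn hG
    · exact mem_trivF.1 hF (by omega)
  θ_d l m x := by
    split_ifs
    · exact O.X_d l x
    · exact O.pow_d l _ x
  θ_mem l m n x h := by
    split_ifs
    · exact O.X_mem l h
    · exact O.pow_mem l _ h
  θ_memF l m i x h := mem_trivF.2 fun hi => by rw [mem_trivF.1 h hi, map_zero]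
  θ_comm l m l' m' x _ := by
    split_ifs
    · exact O.comm _ _ _
    · exact O.pow_comm l l' 1 _ x
    · exact O.pow_comm l l' _ 1 x
    · exact O.pow_comm _ _ _ _ _
  θ_θ l m x := by
    have h1 : (O.X l ^ (p - 1)) (O.X l x) = 0 := by
      rw [← Module.End.mul_apply, ← pow_succ, Nat.sub_add_cancel hp, hX]
    have h2 : O.X l ((O.X l ^ (p - 1)) x) = 0 := by
      rw [← Module.End.mul_apply, ← pow_succ', Nat.sub_add_cancel hp, hX]
    by_cases hm : Even m
    · simpa [hm, Nat.even_add_one] using h1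
    · simpa [hm, Nat.even_add_one] using h2
  θ_out l m x h := absurd trivial h

/-- The families `X, 0, 0, …` with two-term complexes `M → M`. -/
@[simps d G F θ]
def Ops.pro (O : Ops A s) : OpCx k M (LowerSet.Iic 1) s where
  d := A.d
  G := A.G
  F := trivF k M
  θ l m := if m = 0 then O.X l else 0
  zero_mem := LowerSet.mem_Iic_iff.2 zero_le_one
  d_d := A.d_d
  d_mem := A.d_mem
  d_memF h := mem_trivF.2 fun hi => by rw [mem_trivF.1 h hi, map_zero]
  G_neg := A.G_neg
  F_anti h _ hx := mem_trivF.2 fun hi => mem_trivF.1 hx (hi.trans_le h)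
  F_top h := mem_trivF.2 fun h' => absurd h (not_le.2 h')
  F_big {i n x} h hF hG := by
    by_cases hn : n < 0
    · exact A.G_neg hn hG
    · exact mem_trivF.1 hF (by omega)
  θ_d l m x := by
    split_ifs
    · exact O.X_d l x
    · simp
  θ_mem l m n x h := by
    split_ifs
    · exact O.X_mem l h
    · exact Submodule.zero_mem _
  θ_memF l m i x h := mem_trivF.2 fun hi => by rw [mem_trivF.1 h hi, map_zero]
  θ_comm l m l' m' x _ := by
    split_ifs
    · exact O.comm _ _ _
    · simp
    · simp
    · simp
  θ_θ l m x := by simp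
  θ_out l m x h := by
    rw [LowerSet.mem_Iic_iff] at h
    simp [show m ≠ 0 by omega]

section acyc
variable {p : ℕ} [Fact p.Prime] {M : Type u} [AddCommGroup M] [Module (ZMod p) M]
  {A : GrCx (ZMod p) M}

/-- The cochains of degree `n` that are killed by the operators after the `l`-th one. -/
def Ops.later (O : Ops A s) (l : Fin s) (n : ℤ) : Submodule (ZMod p) M where
  carrier := {x | x ∈ A.G n ∧ ∀ l', l < l' → O.X l' x = 0}
  add_mem' ha hb := ⟨add_mem ha.1 hb.1, fun l' h => by simp [ha.2 l' h, hb.2 l' h]⟩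
  zero_mem' := ⟨Submodule.zero_mem _, fun _ _ => map_zero _⟩
  smul_mem' r a ha := ⟨Submodule.smul_mem _ _ ha.1, fun l' h => by simp [ha.2 l' h]⟩

lemma Ops.X_mem_later (O : Ops A s) (l : Fin s) (n : ℤ) (x : M) (hx : x ∈ O.later l n) :
    O.X l x ∈ O.later l n :=
  ⟨O.X_mem l hx.1, fun l' h => by rw [O.comm, hx.2 l' h, map_zero]⟩

lemma Ops.fin_acyc (hp2 : 2 < p) (O : Ops A s) (hp : 0 < p) (hX : ∀ l x, (O.X l ^ p) x = 0)
    (h : ∀ l n, ∀ x ∈ O.later l n, O.X l x = 0 → ∃ y ∈ O.later l n, (O.X l ^ (p - 1)) y = x) :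
    Acyc (O.fin p hp hX) := by
  intro l m n x hx hx' hx0 _
  have hx'' : x ∈ O.later l n := ⟨hx, fun l' hl => by simpa using hx' l' hl⟩
  by_cases hm : Even m
  · obtain ⟨y, hy, e⟩ := exists_eq_of_pow_eq_zero (O.X_mem_later l n) (h l n) hx''
      (by simpa [hm, Nat.even_add_one] using hx0) hp2
    exact ⟨y, hy.1, fun l' hl => by simpa using hy.2 l' hl, by simpa [hm] using e⟩
  · obtain ⟨y, hy, e⟩ := h l n x hx'' (by simpa [hm, Nat.even_add_one] using hx0)
    exact ⟨y, hy.1, fun l' hl => by simpa using hy.2 l' hl, by simpa [hm] using e⟩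

lemma Ops.pro_acyc (O : Ops A s)
    (h : ∀ l n, ∀ x ∈ O.later l n, ∃ y ∈ O.later l n, O.X l y = x) : Acyc O.pro := by
  intro l m n x hx hx' _ hm
  rw [LowerSet.mem_Iic_iff] at hm
  obtain rfl : m = 0 := by omega
  obtain ⟨y, hy, e⟩ := h l n x ⟨hx, fun l' hl => by simpa using hx' l' hl⟩
  exact ⟨y, hy.1, fun l' hl => by simpa using hy.2 l' hl, by simpa using e⟩

end acyc

section mor
variable {M' : Type v} [AddCommGroup M'] [Module k M'] {A' : GrCx k M'} {p : ℕ} {hp : 0 < p}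
  {O : Ops A s} {O' : Ops A' s} {hX : ∀ l x, (O.X l ^ p) x = 0}

/-- A map that commutes with the operators, from the periodic to the two-term families. -/
@[simps g]
def Ops.morTrunc (g : M →ₗ[k] M') (g_d : ∀ x, g (A.d x) = A'.d (g x))
    (g_mem : ∀ {n x}, x ∈ A.G n → g x ∈ A'.G n) (g_X : ∀ l x, g (O.X l x) = O'.X l (g x)) :
    Mor (truncScalar k) (O.fin p hp hX) O'.pro where
  g := g
  g_d := g_d
  g_mem := g_mem
  g_memF h := mem_trivF.2 fun hi => by rw [mem_trivF.1 h hi, map_zero]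
  g_θ l m x := by
    rcases m with _ | m
    · simp [truncScalar, g_X]
    · simp [truncScalar]
  supp m _ h := if_neg h

/-- A map of weight `κ`, in the sense that `lam ^ κ • g (X x) = X (g x)`. -/
@[simps g]
def Ops.morWt {lam : k} (hlam : lam ^ (p - 1) = 1) (κ : ℕ) (g : M →ₗ[k] M)
    (g_d : ∀ x, g (A.d x) = A.d (g x)) (g_mem : ∀ {n x}, x ∈ A.G n → g x ∈ A.G n)
    (g_X : ∀ l x, lam ^ κ • g (O.X l x) = O.X l (g x)) :
    Mor (wtScalar lam κ) (O.fin p hp hX) (O.fin p hp hX) where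
  g := g
  g_d := g_d
  g_mem := g_mem
  g_memF h := mem_trivF.2 fun hi => by rw [mem_trivF.1 h hi, map_zero]
  g_θ l m x := by
    rcases Nat.even_or_odd' m with ⟨q, rfl | rfl⟩
    · simp only [wtScalar, Ops.fin_θ, even_two_mul, if_true]
      rw [show (2 * q + 1 + 1) / 2 = q + 1 by omega, show (2 * q + 1) / 2 = q by omega, mul_add,
        mul_one, pow_add, mul_smul, g_X]
    · have hodd : ¬ Even (2 * q + 1) := by simp
      simp only [wtScalar, Ops.fin_θ, hodd, if_false]
      rw [show (2 * q + 1 + 1 + 1) / 2 = q + 1 by omega, show (2 * q + 1 + 1) / 2 = q + 1 by omega]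
      congr 1
      have key : ∀ (n : ℕ) x, (lam ^ κ) ^ n • g ((O.X l ^ n) x) = (O.X l ^ n) (g x) := by
        intro n
        induction n with
        | zero => simp
        | succ n ih =>
          intro x
          rw [pow_succ (O.X l), Module.End.mul_apply, pow_succ (lam ^ κ), mul_comm, mul_smul, ih,
            ← map_smul, g_X, Module.End.mul_apply]
      rw [← key, ← pow_mul, mul_comm, pow_mul, hlam, one_pow, one_smul]
  supp m _ h := absurd trivial h

/-- An endomorphism commuting with the operators. -/
@[simps g]
def Ops.morFin (g : M →ₗ[k] M) (g_d : ∀ x, g (A.d x) = A.d (g x))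
    (g_mem : ∀ {n x}, x ∈ A.G n → g x ∈ A.G n) (g_X : ∀ l x, g (O.X l x) = O.X l (g x)) :
    Mor (fun _ => (1 : k)) (O.fin p hp hX) (O.fin p hp hX) where
  g := g
  g_d := g_d
  g_mem := g_mem
  g_memF h := mem_trivF.2 fun hi => by rw [mem_trivF.1 h hi, map_zero]
  g_θ l m x := by
    have key : ∀ (n : ℕ) x, g ((O.X l ^ n) x) = (O.X l ^ n) (g x) := by
      intro n
      induction n with
      | zero => simp
      | succ n ih =>
        intro x
        rw [pow_succ, Module.End.mul_apply, ih, g_X, Module.End.mul_apply]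
    simp only [Ops.fin_θ, one_smul]
    split_ifs
    · exact g_X l x
    · exact key _ x
  supp m _ h := absurd trivial h

/-- An endomorphism commuting with the operators. -/
@[simps g]
def Ops.morPro (g : M →ₗ[k] M) (g_d : ∀ x, g (A.d x) = A.d (g x))
    (g_mem : ∀ {n x}, x ∈ A.G n → g x ∈ A.G n) (g_X : ∀ l x, g (O.X l x) = O.X l (g x)) :
    Mor (fun _ => (1 : k)) O.pro O.pro where
  g := g
  g_d := g_d
  g_mem := g_mem
  g_memF h := mem_trivF.2 fun hi => by rw [mem_trivF.1 h hi, map_zero]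
  g_θ l m x := by
    rcases m with _ | m
    · simp [g_X]
    · simp
  supp m h h' := absurd h h'

variable {V : Type w} [AddCommGroup V] [Module k V]

/-- An augmentation with values in the cocycles of degree zero that are killed by the operators. -/
@[simps g]
def Ops.augFin (O : Ops A s) (hp : 1 < p) (hX : ∀ l x, (O.X l ^ p) x = 0) (g : V →ₗ[k] M)
    (g_d : ∀ x, A.d (g x) = 0) (g_mem : ∀ x, g x ∈ A.G 0) (g_X : ∀ l x, O.X l (g x) = 0) :
    Mor (fun _ => (1 : k)) (trivCx k V ⊤ LowerSet.mem_top s) (O.fin p (by omega) hX) where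
  g := g
  g_d x := by simp [trivCx, g_d]
  g_mem {n x} h := by
    by_cases hn : n = 0
    · subst hn; exact g_mem x
    · rw [trivCx_G.1 h hn, map_zero]; exact Submodule.zero_mem _
  g_memF h := mem_trivF.2 fun hi => by rw [trivCx_F.1 h hi, map_zero]
  g_θ l m x := by
    obtain ⟨q, hq⟩ : ∃ q, p - 1 = q + 1 := ⟨p - 2, by omega⟩
    simp only [trivCx, Ops.fin_θ]
    split_ifs
    · simp [g_X]
    · rw [hq, pow_succ, Module.End.mul_apply, g_X]; simp
  supp m h h' := absurd h h'

/-- An augmentation with values in the cocycles of degree zero that are killed by the operators. -/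
@[simps g]
def Ops.augPro (O : Ops A s) (g : V →ₗ[k] M)
    (g_d : ∀ x, A.d (g x) = 0) (g_mem : ∀ x, g x ∈ A.G 0) (g_X : ∀ l x, O.X l (g x) = 0) :
    Mor (fun _ => (1 : k))
      (trivCx k V (LowerSet.Iic 1) (LowerSet.mem_Iic_iff.2 zero_le_one) s) O.pro where
  g := g
  g_d x := by simp [trivCx, g_d]
  g_mem {n x} h := by
    by_cases hn : n = 0
    · subst hn; exact g_mem x
    · rw [trivCx_G.1 h hn, map_zero]; exact Submodule.zero_mem _
  g_memF h := mem_trivF.2 fun hi => by rw [trivCx_F.1 h hi, map_zero]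
  g_θ l m x := by
    rcases m with _ | m
    · simp [trivCx, g_X]
    · simp [trivCx]
  supp m h h' := absurd h h'

end mor

end GrCx

/-! ### Iterated cochains -/

/-- Iterated functions `G → (G → ⋯ → (G → V))` in `j` variables. This is the recursive description
of homogeneous cochains that underlies `TopRep.resolutionX`. -/
def Co (V G : Type u) : ℕ → Type u
  | 0 => V
  | j + 1 => G → Co V G j

namespace Co

section algebra
variable (k : Type*) [Field k] {V G G' : Type u} [AddCommGroup V] [Module k V]

instance instAddCommGroup : ∀ j, AddCommGroup (Co V G j)
  | 0 => inferInstanceAs (AddCommGroup V)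
  | j + 1 => @Pi.addCommGroup G (fun _ => Co V G j) fun _ => instAddCommGroup j

instance instModule : ∀ j, Module k (Co V G j)
  | 0 => inferInstanceAs (Module k V)
  | j + 1 => @Pi.module G (fun _ => Co V G j) k _ _ fun _ => instModule j

lemma sum_apply {ι : Type*} {j : ℕ} (s : Finset ι) (φ : ι → Co V G (j + 1)) (x : G) :
    (∑ i ∈ s, φ i) x = ∑ i ∈ s, φ i x :=
  map_sum (⟨⟨fun ψ : Co V G (j + 1) => ψ x, rfl⟩, fun _ _ => rfl⟩ : Co V G (j + 1) →+ Co V G j) φ s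

/-- The simplicial differential, in the recursive form of `TopRep.d`. -/
def dd : ∀ j, Co V G j →ₗ[k] Co V G (j + 1)
  | 0 =>
    { toFun := fun c _ => c
      map_add' := fun _ _ => rfl
      map_smul' := fun _ _ => rfl }
  | j + 1 =>
    { toFun := fun φ x => φ - dd j (φ x)
      map_add' := fun φ ψ => by
        funext x
        change φ + ψ - dd j (φ x + ψ x) = φ - dd j (φ x) + (ψ - dd j (ψ x))
        rw [map_add, add_sub_add_comm]
      map_smul' := fun c φ => by
        funext x
        change c • φ - dd j (c • φ x) = c • (φ - dd j (φ x))
        rw [map_smul, smul_sub] }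

lemma dd_succ_apply {j : ℕ} (φ : Co V G (j + 1)) (x : G) :
    dd k (j + 1) φ x = φ - dd k j (φ x) := rfl

lemma dd_dd : ∀ {j : ℕ} (φ : Co V G j), dd k (j + 1) (dd k j φ) = 0
  | 0, c => by
    funext x
    exact sub_self _
  | j + 1, φ => by
    funext x
    rw [dd_succ_apply, dd_succ_apply, map_sub, dd_dd, sub_zero, sub_self]
    rfl

section pull
variable (f : G → G')

/-- Pullback along a function `G → G'`. -/
def pull : ∀ j, Co V G' j →ₗ[k] Co V G j
  | 0 => LinearMap.id
  | j + 1 =>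
    { toFun := fun φ x => pull j (φ (f x))
      map_add' := fun φ ψ => by
        funext x
        exact map_add _ _ _
      map_smul' := fun c φ => by
        funext x
        exact map_smul _ _ _ }

lemma pull_succ_apply {j : ℕ} (φ : Co V G' (j + 1)) (x : G) :
    pull k f (j + 1) φ x = pull k f j (φ (f x)) := rfl

lemma pull_dd : ∀ {j : ℕ} (φ : Co V G' j), pull k f (j + 1) (dd k j φ) = dd k j (pull k f j φ)
  | 0, _ => rfl
  | j + 1, φ => by
    funext x
    rw [pull_succ_apply, dd_succ_apply, map_sub, pull_dd, dd_succ_apply, pull_succ_apply]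

end pull

lemma pull_id : ∀ {j : ℕ} (φ : Co V G j), pull k id j φ = φ
  | 0, _ => rfl
  | j + 1, φ => by
    funext x
    rw [pull_succ_apply, pull_id]
    rfl

lemma pull_pull {G'' : Type u} (f : G → G') (f' : G' → G'') :
    ∀ {j : ℕ} (φ : Co V G'' j), pull k f j (pull k f' j φ) = pull k (f' ∘ f) j φ
  | 0, _ => rfl
  | j + 1, φ => by
    funext x
    rw [pull_succ_apply, pull_succ_apply, pull_pull]
    rfl

variable [Group G] [Group G']

/-- The diagonal action, in the recursive form of `ContRepresentation.coind₁`. -/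
def act (g : G) (j : ℕ) : Co V G j →ₗ[k] Co V G j := pull k (fun x => g⁻¹ * x) j

lemma act_succ_apply (g : G) {j : ℕ} (φ : Co V G (j + 1)) (x : G) :
    act k g (j + 1) φ x = act k g j (φ (g⁻¹ * x)) := rfl

lemma act_one {j : ℕ} (φ : Co V G j) : act k (1 : G) j φ = φ := by
  have : (fun x : G => 1⁻¹ * x) = id := by funext x; simp
  rw [act, this, pull_id]

lemma act_mul (g h : G) {j : ℕ} (φ : Co V G j) : act k (g * h) j φ = act k g j (act k h j φ) := by
  rw [act, act, act, pull_pull]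
  congr 2
  funext x
  simp [mul_assoc]

lemma pull_act (f : G →* G') (g : G) {j : ℕ} (φ : Co V G' j) :
    pull k f j (act k (f g) j φ) = act k g j (pull k f j φ) := by
  rw [act, act, pull_pull, pull_pull]
  congr 2
  funext x
  simp

end algebra

section topology
variable (k : Type*) [Field k] {V G G' : Type u} [AddCommGroup V] [Module k V]
  [TopologicalSpace G] [TopologicalSpace G']

/-- The cochains that are locally constant in each variable, uniformly in the remaining ones. -/
def Lc (V G : Type u) [AddCommGroup V] [Module k V] [TopologicalSpace G] :
    ∀ j, Submodule k (Co V G j)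
  | 0 => ⊤
  | j + 1 =>
    { carrier := {φ | IsLocallyConstant (φ : G → Co V G j) ∧ ∀ x, φ x ∈ Lc V G j}
      add_mem' := fun ha hb => ⟨ha.1.add hb.1, fun x => add_mem (ha.2 x) (hb.2 x)⟩
      zero_mem' := ⟨IsLocallyConstant.const 0, fun _ => Submodule.zero_mem _⟩
      smul_mem' := fun c _ h => ⟨h.1.comp (c • ·), fun x => Submodule.smul_mem _ _ (h.2 x)⟩ }

variable {k}

lemma dd_mem : ∀ {j : ℕ} {φ : Co V G j}, φ ∈ Lc k V G j → dd k j φ ∈ Lc k V G (j + 1)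
  | 0, c, _ => ⟨IsLocallyConstant.const (X := G) c, fun _ => Submodule.mem_top⟩
  | _ + 1, φ, h => ⟨h.1.comp fun y => φ - dd k _ y, fun x => sub_mem h (dd_mem (h.2 x))⟩

lemma pull_mem {f : G → G'} (hf : Continuous f) :
    ∀ {j : ℕ} {φ : Co V G' j}, φ ∈ Lc k V G' j → pull k f j φ ∈ Lc k V G j
  | 0, _, _ => Submodule.mem_top
  | _ + 1, _, h => ⟨(h.1.comp_continuous hf).comp (pull k f _), fun x => pull_mem hf (h.2 (f x))⟩

/-- Gluing cochains along a locally constant function of the outermost variable. -/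
lemma glue_mem {ι : Type*} {j : ℕ} {τ : G → ι} (hτ : IsLocallyConstant τ)
    {φ : ι → Co V G (j + 1)} (hφ : ∀ i, φ i ∈ Lc k V G (j + 1)) :
    (fun x => φ (τ x) x : Co V G (j + 1)) ∈ Lc k V G (j + 1) := by
  refine ⟨(IsLocallyConstant.iff_eventually_eq _).2 fun x => ?_, fun x => (hφ _).2 x⟩
  filter_upwards [(IsLocallyConstant.iff_eventually_eq _).1 hτ x,
    (IsLocallyConstant.iff_eventually_eq _).1 (hφ (τ x)).1 x] with y h1 h2
  rw [h1, h2]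

variable [Group G] [IsTopologicalGroup G]

/-- A locally constant cochain on a compact group is fixed by a neighbourhood of the identity. -/
lemma eventually_act_eq [CompactSpace G] : ∀ {j : ℕ} {φ : Co V G j}, φ ∈ Lc k V G j →
    ∀ᶠ g in nhds (1 : G), act k g j φ = φ
  | 0, _, _ => Filter.Eventually.of_forall fun _ => rfl
  | j + 1, φ, h => by
    have h1 : ∀ x ∈ Set.univ, ∀ᶠ z : G × G in nhds 1 ×ˢ nhds x,
        act k z.1 (j + 1) φ z.2 = φ z.2 := by
      intro x _
      have h2 := eventually_act_eq (h.2 x)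
      have h3 := (IsLocallyConstant.iff_eventually_eq _).1 h.1 x
      have h4 : Filter.Tendsto (fun z : G × G => z.1⁻¹ * z.2) (nhds 1 ×ˢ nhds x) (nhds x) := by
        have : Continuous fun z : G × G => z.1⁻¹ * z.2 := by fun_prop
        have h5 := this.tendsto (1, x)
        rw [nhds_prod_eq] at h5
        simpa using h5
      filter_upwards [h2.prod_inl (nhds x), h3.prod_inr (nhds 1), h4.eventually h3] with z e1 e2 e3
      rw [act_succ_apply, e3, e1, e2]
    have h2 := isCompact_univ.eventually_forall_of_forall_eventually (x₀ := (1 : G))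
      (P := fun g x => act k g (j + 1) φ x = φ x)
      (by intro x hx; rw [nhds_prod_eq]; exact h1 x hx)
    filter_upwards [h2] with g hg
    funext x
    exact hg x trivial

end topology

end Co

/-! ### The complex of locally constant cochains -/

/-- The ambient module of the complex of cochains: families of cochains, with component `j` in
`j + 1` variables. -/
abbrev Tot (V G : Type u) : Type u := ∀ j, Co V G (j + 1)

namespace Tot

variable (k : Type*) [Field k] {V G G' : Type u} [AddCommGroup V] [Module k V]

/-- The differential of the complex of cochains. -/
def d : Tot V G →ₗ[k] Tot V G where
  toFun φ
    | 0 => 0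
    | j + 1 => Co.dd k (j + 1) (φ j)
  map_add' φ ψ := by
    funext j
    rcases j with _ | j
    · exact (add_zero 0).symm
    · exact map_add (Co.dd k (j + 1)) (φ j) (ψ j)
  map_smul' c φ := by
    funext j
    rcases j with _ | j
    · exact (smul_zero c).symm
    · exact map_smul (Co.dd k (j + 1)) c (φ j)

lemma d_succ (φ : Tot V G) (j : ℕ) : d k φ (j + 1) = Co.dd k (j + 1) (φ j) := rfl

/-- Pullback along a function `G → G'`. -/
def pull (f : G → G') : Tot V G' →ₗ[k] Tot V G where
  toFun φ j := Co.pull k f (j + 1) (φ j)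
  map_add' φ ψ := by funext j; exact map_add (Co.pull k f (j + 1)) (φ j) (ψ j)
  map_smul' c φ := by funext j; exact map_smul (Co.pull k f (j + 1)) c (φ j)

lemma pull_apply (f : G → G') (φ : Tot V G') (j : ℕ) :
    pull k f φ j = Co.pull k f (j + 1) (φ j) := rfl

lemma pull_d (f : G → G') (φ : Tot V G') : pull k f (d k φ) = d k (pull k f φ) := by
  funext j
  rcases j with _ | j
  · exact map_zero (Co.pull k f 1 : Co V G' 1 →ₗ[k] Co V G 1)
  · exact Co.pull_dd k f (j := j + 1) (φ j)

lemma pull_id (φ : Tot V G) : pull k id φ = φ := by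
  funext j
  exact Co.pull_id k (φ j)

lemma pull_pull {G'' : Type u} (f : G → G') (f' : G' → G'') (φ : Tot V G'') :
    pull k f (pull k f' φ) = pull k (f' ∘ f) φ := by
  funext j
  exact Co.pull_pull k f f' (φ j)

/-- The constants, in degree zero. -/
def aug : V →ₗ[k] Tot V G where
  toFun v
    | 0 => fun _ => v
    | _ + 1 => 0
  map_add' v w := by
    funext j
    rcases j with _ | j
    · rfl
    · exact (add_zero 0).symm
  map_smul' c v := by
    funext j
    rcases j with _ | j
    · rfl
    · exact (smul_zero c).symm

lemma d_aug (v : V) : d k (aug k v : Tot V G) = 0 := by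
  funext j
  rcases j with _ | _ | j
  · rfl
  · exact Co.dd_dd k (j := 0) v
  · exact map_zero (Co.dd k (j + 2))

lemma pull_aug (f : G → G') (v : V) : pull k f (aug k v) = aug k v := by
  funext j
  rcases j with _ | j
  · rfl
  · exact map_zero (Co.pull k f (j + 2))

/-- The cochain with a single component. -/
def single (n : ℕ) (φ : Co V G (n + 1)) : Tot V G := Pi.single n φ

lemma single_same (n : ℕ) (φ : Co V G (n + 1)) : single n φ n = φ := Pi.single_eq_same _ _

lemma single_of_ne {n j : ℕ} (h : j ≠ n) (φ : Co V G (n + 1)) : single n φ j = 0 :=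
  Pi.single_eq_of_ne h _

lemma aug_injective [Nonempty G] : Function.Injective (aug k : V →ₗ[k] Tot V G) := by
  intro v w h
  obtain ⟨x⟩ := ‹Nonempty G›
  exact congrFun (congrFun h 0) x

section action
variable [Group G] [Group G']

/-- The diagonal action. -/
def act (g : G) : Module.End k (Tot V G) := pull k fun x => g⁻¹ * x

lemma act_apply (g : G) (φ : Tot V G) (j : ℕ) : act k g φ j = Co.act k g (j + 1) (φ j) := rfl

lemma act_one (φ : Tot V G) : act k (1 : G) φ = φ := by
  funext j
  exact Co.act_one k (φ j)

lemma act_mul (g h : G) (φ : Tot V G) : act k (g * h) φ = act k g (act k h φ) := by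
  funext j
  exact Co.act_mul k g h (φ j)

lemma act_pow (g : G) (n : ℕ) (φ : Tot V G) : (act k g ^ n) φ = act k (g ^ n) φ := by
  induction n with
  | zero => rw [pow_zero, pow_zero, act_one]; rfl
  | succ n ih => rw [pow_succ', pow_succ', Module.End.mul_apply, ih, act_mul]

lemma act_d (g : G) (φ : Tot V G) : act k g (d k φ) = d k (act k g φ) := pull_d k _ φ

lemma act_aug (g : G) (v : V) : act k g (aug k v) = aug k v := pull_aug k _ v

lemma pull_act (f : G →* G') (g : G) (φ : Tot V G') :
    pull k f (act k (f g) φ) = act k g (pull k f φ) := by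
  funext j
  exact Co.pull_act k f g (φ j)

/-- The stabilizer of a cochain. -/
def stab (φ : Tot V G) : Subgroup G where
  carrier := {g | act k g φ = φ}
  one_mem' := act_one k φ
  mul_mem' {g h} hg hh := by
    change act k (g * h) φ = φ
    rw [act_mul, hh, hg]
  inv_mem' {g} hg := by
    change act k g⁻¹ φ = φ
    conv_lhs => rw [← show act k g φ = φ from hg]
    rw [← act_mul, inv_mul_cancel, act_one]

lemma mem_stab {φ : Tot V G} {g : G} : g ∈ stab k φ ↔ act k g φ = φ := Iff.rfl

end action

end Tot

section complex
variable (k : Type*) [Field k] (V G : Type u) {G' : Type u} [AddCommGroup V] [Module k V]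
  [TopologicalSpace G] [TopologicalSpace G']

/-- The complex of locally constant cochains on `G` with values in `V`. -/
@[simps d]
def lcCx : GrCx k (Tot V G) where
  d := Tot.d k
  G n :=
    { carrier := {φ | ∀ j : ℕ, φ j ∈ Co.Lc k V G (j + 1) ∧ ((j : ℤ) ≠ n → φ j = 0)}
      add_mem' := fun ha hb j => ⟨add_mem (ha j).1 (hb j).1, fun h => by
        rw [Pi.add_apply, (ha j).2 h, (hb j).2 h, add_zero]⟩
      zero_mem' := fun j => ⟨Submodule.zero_mem _, fun _ => rfl⟩
      smul_mem' := fun c a ha j => ⟨Submodule.smul_mem _ _ (ha j).1, fun h => by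
        rw [Pi.smul_apply, (ha j).2 h, smul_zero]⟩ }
  d_d φ := by
    funext j
    rcases j with _ | _ | j
    · rfl
    · exact map_zero (Co.dd k 1)
    · exact Co.dd_dd k (φ j)
  d_mem {n φ} h j := by
    rcases j with _ | j
    · exact ⟨Submodule.zero_mem _, fun _ => rfl⟩
    · refine ⟨Co.dd_mem (h j).1, fun hj => ?_⟩
      rw [Tot.d_succ, (h j).2 (by push_cast at hj; omega), map_zero]
  G_neg {n φ} hn h := by
    funext j
    exact (h j).2 (by omega)

variable {k V G}

lemma Tot.single_mem {n : ℕ} {φ : Co V G (n + 1)} (h : φ ∈ Co.Lc k V G (n + 1)) :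
    Tot.single n φ ∈ (lcCx k V G).G n := by
  intro j
  by_cases hj : j = n
  · subst hj
    exact ⟨by rwa [Tot.single_same], fun h => absurd rfl h⟩
  · rw [Tot.single_of_ne hj]
    exact ⟨Submodule.zero_mem _, fun _ => rfl⟩

lemma Tot.ext_of_mem {n : ℕ} {φ ψ : Tot V G} (hφ : φ ∈ (lcCx k V G).G n)
    (hψ : ψ ∈ (lcCx k V G).G n) (h : φ n = ψ n) : φ = ψ := by
  funext j
  by_cases hj : j = n
  · subst hj; exact h
  · rw [(hφ j).2 (by exact_mod_cast hj), (hψ j).2 (by exact_mod_cast hj)]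

lemma Tot.pull_mem {f : G → G'} (hf : Continuous f) {n : ℤ} {φ : Tot V G'}
    (h : φ ∈ (lcCx k V G').G n) : Tot.pull k f φ ∈ (lcCx k V G).G n := fun j =>
  ⟨Co.pull_mem hf (h j).1, fun hj => by rw [Tot.pull_apply, (h j).2 hj, map_zero]⟩

lemma Tot.aug_mem (v : V) : (Tot.aug k v : Tot V G) ∈ (lcCx k V G).G 0 := by
  intro j
  rcases j with _ | j
  · exact ⟨Co.dd_mem (j := 0) (φ := v) Submodule.mem_top, fun h => absurd rfl h⟩
  · exact ⟨Submodule.zero_mem _, fun _ => rfl⟩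

/-- Evaluation of the outermost variable contracts the augmented complex. -/
lemma Tot.exists_contraction (x : G) {n : ℤ} {φ : Tot V G} (h : φ ∈ (lcCx k V G).G n)
    (hd : Tot.d k φ = 0) : ∃ v : V, ∃ ψ ∈ (lcCx k V G).G (n - 1),
      φ = Tot.aug k v + Tot.d k ψ := by
  obtain hn | ⟨n, rfl⟩ : n < 0 ∨ ∃ m : ℕ, n = m := by
    rcases n with m | m
    · exact Or.inr ⟨m, rfl⟩
    · exact Or.inl (Int.negSucc_lt_zero m)
  · exact ⟨0, 0, Submodule.zero_mem _, by rw [map_zero, map_zero, add_zero,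
      (lcCx k V G).G_neg hn h]⟩
  have key : ∀ y, φ n y - Co.dd k n (φ n x) y = 0 := by
    intro y
    have h1 := congrFun (congrFun hd (n + 1)) x
    rw [Tot.d_succ, Co.dd_succ_apply] at h1
    exact congrFun h1 y
  have key' : φ n = Co.dd k n (φ n x) := by
    funext y
    exact sub_eq_zero.1 (key y)
  rcases n with _ | n
  · refine ⟨φ 0 x, 0, Submodule.zero_mem _, ?_⟩
    rw [map_zero, add_zero]
    exact Tot.ext_of_mem h (Tot.aug_mem _) key'
  · have hm := Tot.single_mem (n := n) ((h (n + 1)).1.2 x)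
    refine ⟨0, Tot.single n (φ (n + 1) x), ?_, ?_⟩
    · rwa [show ((n + 1 : ℕ) : ℤ) - 1 = n by push_cast; ring]
    · rw [map_zero, zero_add]
      refine Tot.ext_of_mem h ((lcCx k V G).d_mem hm) ?_
      rw [Tot.d_succ, Tot.single_same]
      exact key'

open OpCx in
/-- The complex of locally constant cochains resolves the coefficients. -/
lemma isQI_aug [Nonempty G] {S S' : LowerSet ℕ} {hS : 0 ∈ S} {r s : ℕ} {C : OpCx k (Tot V G) S' s}
    (hG : C.G = (lcCx k V G).G) (hd : C.d = Tot.d k) :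
    IsQI (trivCx k V S hS r) C (Tot.aug k) := by
  obtain ⟨x⟩ := ‹Nonempty G›
  intro n a z ha hz _ e
  have ha0 : a = 0 := by
    rw [trivCx_G] at ha
    by_cases hn : n + 1 = 0
    · rw [C.G_neg (by omega) hz, map_zero] at e
      exact Tot.aug_injective k (e.trans (map_zero (Tot.aug k)).symm)
    · exact ha hn
  subst ha0
  rw [map_zero, hd] at e
  rw [hG] at hz
  obtain ⟨v, ψ, hψ, rfl⟩ := Tot.exists_contraction x hz e.symm
  by_cases hn : n = 0
  · exact ⟨v, trivCx_G.2 fun h => absurd hn h, ψ, by rwa [hG], rfl, by rw [hd]⟩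
  · refine ⟨0, Submodule.zero_mem _, ψ, by rwa [hG], map_zero _, ?_⟩
    have h0 : Tot.d k ψ ∈ (lcCx k V G).G n := by simpa using (lcCx k V G).d_mem hψ
    have h1 := sub_mem hz h0
    rw [add_sub_cancel_right] at h1
    have h2 : (Tot.aug k v : Tot V G) = 0 := by
      funext j
      rcases j with _ | j
      · exact (h1 0).2 (by push_cast; omega)
      · rfl
    rw [hd, h2, map_zero]

variable [Group G] [IsTopologicalGroup G]

lemma Tot.act_mem (g : G) {n : ℤ} {φ : Tot V G} (h : φ ∈ (lcCx k V G).G n) :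
    Tot.act k g φ ∈ (lcCx k V G).G n := Tot.pull_mem (by fun_prop) h

lemma Tot.isOpen_stab [CompactSpace G] {n : ℤ} {φ : Tot V G} (h : φ ∈ (lcCx k V G).G n) :
    IsOpen (Tot.stab k φ : Set G) := by
  refine Subgroup.isOpen_of_mem_nhds _ (g := 1) ?_
  by_cases hn : n < 0
  · filter_upwards with g
    rw [SetLike.mem_coe, Tot.mem_stab, (lcCx k V G).G_neg hn h, map_zero]
  · obtain ⟨n, rfl⟩ := Int.eq_ofNat_of_zero_le (not_lt.1 hn)
    filter_upwards [Co.eventually_act_eq (h n).1] with g hg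
    exact Tot.ext_of_mem (Tot.act_mem g h) h hg

end complex

/-! ### Solving for invariants and norms along a coordinate function -/

section glue
variable {p : ℕ} [Fact p.Prime]

lemma sum_pow_apply_eq_zero {M : Type*} [AddCommGroup M] [Module (ZMod p) M]
    {T : Module.End (ZMod p) M} {x : M} {n : ℕ} (h : (T ^ n) x = x) :
    ∑ a ∈ Finset.range (n * p), (T ^ a) x = 0 := by
  have h1 : ∀ c : ℕ, (T ^ (n * c)) x = x ∧
      ∑ a ∈ Finset.range (n * c), (T ^ a) x = (c : ZMod p) • ∑ a ∈ Finset.range n, (T ^ a) x := by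
    intro c
    induction c with
    | zero => simp
    | succ c ih =>
      refine ⟨by rw [mul_add, mul_one, pow_add, Module.End.mul_apply, h, ih.1], ?_⟩
      rw [mul_add, mul_one, Finset.sum_range_add, ih.2, Nat.cast_succ, add_smul, one_smul]
      congr 1
      refine Finset.sum_congr rfl fun a _ => ?_
      rw [add_comm, pow_add, Module.End.mul_apply, ih.1]
  rw [(h1 p).2, CharP.cast_eq_zero, zero_smul]

namespace Tot
variable {V G : Type u} [AddCommGroup V] [Module (ZMod p) V] {ι : Type*}

/-- The cochain that agrees with `F (τ x)` when its outermost variable is `x`. -/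
def glue (τ : G → ι) (F : ι → Tot V G) : Tot V G := fun j x => F (τ x) j x

omit [AddCommGroup V] in
lemma glue_congr {ι' : Type*} {τ : G → ι} {F : ι → Tot V G} {τ' : G → ι'} {F' : ι' → Tot V G}
    (h : ∀ x, F (τ x) = F' (τ' x)) : glue τ F = glue τ' F' := by
  funext j x
  exact congrFun (congrFun (h x) j) x

omit [AddCommGroup V] in
lemma glue_const (τ : G → ι) (φ : Tot V G) : glue τ (fun _ => φ) = φ := rfl

lemma glue_sub (τ : G → ι) (F F' : ι → Tot V G) : glue τ F - glue τ F' = glue τ (F - F') := rfl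

lemma glue_sum {κ : Type*} (s : Finset κ) (τ : G → ι) (F : κ → ι → Tot V G) :
    ∑ a ∈ s, glue τ (F a) = glue τ (fun i => ∑ a ∈ s, F a i) := by
  funext j x
  rw [Finset.sum_apply, Co.sum_apply, glue, Finset.sum_apply, Co.sum_apply]
  rfl

lemma glue_mem [TopologicalSpace G] {τ : G → ι} (hτ : IsLocallyConstant τ) {F : ι → Tot V G} {n : ℤ}
    (hF : ∀ i, F i ∈ (lcCx (ZMod p) V G).G n) : glue τ F ∈ (lcCx (ZMod p) V G).G n := fun j => by
  refine ⟨Co.glue_mem hτ fun i => (hF i j).1, fun h => ?_⟩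
  funext x
  exact congrFun ((hF (τ x) j).2 h) x

variable [Group G]

lemma act_glue (g : G) (τ : G → ι) (F : ι → Tot V G) :
    act (ZMod p) g (glue τ F) = glue (fun x => τ (g⁻¹ * x)) fun i => act (ZMod p) g (F i) := rfl

lemma comp_inv_mul {A : Type*} [AddGroup A] {τ : G → A} {g : G} {a : A}
    (h : ∀ x, τ (g * x) = τ x + a) (x : G) : τ (g⁻¹ * x) = τ x - a := by
  rw [eq_sub_iff_add_eq, ← h, mul_inv_cancel_left]

variable [TopologicalSpace G] [IsTopologicalGroup G]

/-- A coordinate modulo `p ^ (m + 1)` along `g` solves `g ψ - ψ = φ` when `φ` is fixed by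
`g ^ p ^ m`: take for `ψ x` the partial sum of `g ^ a φ` up to the coordinate of `x`. -/
lemma exists_act_sub_eq {m : ℕ} {g : G} {τ : G → ZMod (p ^ (m + 1))} (hτ : IsLocallyConstant τ)
    (hτg : ∀ x, τ (g * x) = τ x + 1) {n : ℤ} {φ : Tot V G} (hφ : φ ∈ (lcCx (ZMod p) V G).G n)
    (hT : act (ZMod p) (g ^ p ^ m) φ = φ) :
    ∃ ψ ∈ (lcCx (ZMod p) V G).G n, act (ZMod p) g ψ - ψ = φ ∧
      ∀ h, (∀ a : ℕ, act (ZMod p) h (act (ZMod p) (g ^ a) φ) = act (ZMod p) (g ^ a) φ) →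
        (∀ x, τ (h * x) = τ x) → act (ZMod p) h ψ = ψ := by
  have : NeZero (p ^ (m + 1)) := ⟨pow_ne_zero _ (Fact.out : p.Prime).ne_zero⟩
  set S : ℕ → Tot V G := fun c => ∑ a ∈ Finset.range c, act (ZMod p) (g ^ a) φ with hS
  have hSq : S (p ^ (m + 1)) = 0 := by
    have h1 := sum_pow_apply_eq_zero (T := act (ZMod p) g) (x := φ) (n := p ^ m)
      (by rw [act_pow, hT])
    simp only [act_pow, ← pow_succ] at h1
    exact h1
  have hS1 : ∀ c, S (c + 1) = act (ZMod p) g (S c) + φ := by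
    intro c
    simp only [hS]
    rw [Finset.sum_range_succ', map_sum, pow_zero, act_one]
    congr 1
    exact Finset.sum_congr rfl fun a _ => by rw [pow_succ', act_mul]
  have hSi : ∀ i : ZMod (p ^ (m + 1)), S ((i - 1).val + 1) = S i.val := by
    intro i
    have h1 : (i - 1).val + 1 < p ^ (m + 1) ∨ (i - 1).val + 1 = p ^ (m + 1) := by
      have := ZMod.val_lt (i - 1)
      omega
    have h2 : (((i - 1).val + 1 : ℕ) : ZMod (p ^ (m + 1))) = i := by
      rw [Nat.cast_succ, ZMod.natCast_zmod_val, sub_add_cancel]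
    rcases h1 with h1 | h1
    · rw [← ZMod.val_cast_of_lt h1, h2]
    · rw [h1, ZMod.natCast_self] at h2
      rw [h1, hSq, ← h2, ZMod.val_zero]
      rfl
  refine ⟨glue τ fun i => -S i.val, glue_mem hτ fun i => neg_mem (sum_mem fun a _ => act_mem _ hφ),
    ?_, fun h hh hτh => ?_⟩
  · rw [act_glue]
    have h1 : (glue (fun x => τ (g⁻¹ * x)) fun i => act (ZMod p) g (-S i.val)) =
        glue τ fun i => φ - S i.val :=
      glue_congr fun x => by
        have h2 := hSi (τ x)
        rw [hS1] at h2
        rw [comp_inv_mul hτg, ← h2, map_neg]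
        abel
    rw [h1, glue_sub]
    refine (glue_congr (τ' := τ) (F' := fun _ => φ) fun x => ?_).trans (glue_const τ φ)
    simp
  · rw [act_glue]
    refine glue_congr fun x => ?_
    rw [comp_inv_mul (τ := τ) (g := h) (a := 0) (by simpa using hτh), sub_zero, map_neg, hS,
      map_sum]
    simp [hh]

omit [IsTopologicalGroup G] in
/-- A coordinate modulo `p` along `g` presents every cochain fixed by `g` as a norm: restrict the
cochain to the points with coordinate zero. -/
lemma exists_norm_eq {g : G} {τ : G → ZMod p} (hτ : IsLocallyConstant τ)
    (hτg : ∀ x, τ (g * x) = τ x + 1) {n : ℤ} {φ : Tot V G} (hφ : φ ∈ (lcCx (ZMod p) V G).G n)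
    (hT : act (ZMod p) g φ = φ) :
    ∃ ψ ∈ (lcCx (ZMod p) V G).G n,
      ∑ a ∈ Finset.range p, (act (ZMod p) g ^ a) ψ = φ ∧
      ∀ h, act (ZMod p) h φ = φ → (∀ x, τ (h * x) = τ x) → act (ZMod p) h ψ = ψ := by
  have hact : ∀ h, act (ZMod p) h φ = φ → ∀ i : ZMod p,
      act (ZMod p) h (if i = 0 then φ else 0) = if i = 0 then φ else 0 := by
    intro h hh i
    split_ifs
    · exact hh
    · exact map_zero _
  refine ⟨glue τ fun i => if i = 0 then φ else 0, glue_mem hτ fun i => ?_, ?_, fun h hh hτh => ?_⟩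
  · split_ifs
    · exact hφ
    · exact Submodule.zero_mem _
  · have h1 : ∀ a : ℕ, (act (ZMod p) g ^ a) (glue τ fun i => if i = 0 then φ else 0) =
        glue τ fun i => if i = (a : ZMod p) then φ else 0 := by
      intro a
      rw [act_pow, act_glue]
      have hτa : ∀ x, τ (g ^ a * x) = τ x + a := by
        induction a with
        | zero => simp
        | succ a ih =>
          intro x
          rw [pow_succ', mul_assoc, hτg, ih, Nat.cast_succ, add_assoc]
      refine glue_congr fun x => ?_
      rw [hact _ (by rw [← act_pow]; exact pow_eq_of_fixed hT a), comp_inv_mul hτa]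
      simp only [sub_eq_zero]
    simp only [h1]
    rw [glue_sum]
    refine (glue_congr (τ' := τ) (F' := fun _ => φ) fun x => ?_).trans (glue_const τ φ)
    have : NeZero p := ⟨(Fact.out : p.Prime).ne_zero⟩
    rw [Finset.sum_eq_single (τ x).val]
    · rw [if_pos (by simp)]
    · intro b hb hne
      rw [if_neg]
      rintro h
      apply hne
      rw [h, ZMod.val_cast_of_lt (Finset.mem_range.1 hb)]
    · intro h
      exact absurd (Finset.mem_range.2 (ZMod.val_lt _)) h
  · rw [act_glue]
    refine glue_congr fun x => ?_
    rw [hact h hh, comp_inv_mul (τ := τ) (g := h) (a := 0) (by simpa using hτh), sub_zero]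

end Tot
end glue

/-! ### Operators from commuting automorphisms of `p`-power order -/

namespace GrCx
open OpCx

variable {p : ℕ} [Fact p.Prime] {M : Type u} [AddCommGroup M] [Module (ZMod p) M]
  {A : GrCx (ZMod p) M} {s : ℕ}

/-- Commuting endomorphisms of a complex that have locally finite `p`-power order. -/
structure Auts (A : GrCx (ZMod p) M) (s : ℕ) where
  T : Fin s → Module.End (ZMod p) M
  T_d : ∀ l x, T l (A.d x) = A.d (T l x)
  T_mem : ∀ l {n x}, x ∈ A.G n → T l x ∈ A.G n
  comm : ∀ l l' x, T l (T l' x) = T l' (T l x)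
  order : ∀ l {n x}, x ∈ A.G n → ∃ m : ℕ, (T l ^ p ^ m) x = x

/-- The weight generators of commuting automorphisms. -/
@[simps]
noncomputable def Auts.ops (U : Auts A s) : Ops A s where
  X l := wtOp (U.T l)
  X_d l x := (wtOp_map A.d (fun y => (U.T_d l y).symm) x).symm
  X_mem l _ _ hx := wtOp_mem (fun _ => U.T_mem l) hx
  comm l l' x := by
    have h1 : ∀ y, U.T l' (wtOp (U.T l) y) = wtOp (U.T l) (U.T l' y) :=
      wtOp_map _ fun y => U.comm l' l y
    exact wtOp_map (wtOp (U.T l)) (fun y => (h1 y).symm) x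

variable {U : Auts A s}

lemma Auts.ops_eq_zero_iff (hp2 : 2 < p) {l : Fin s} {n : ℤ} {x : M} (hx : x ∈ A.G n) :
    U.ops.X l x = 0 ↔ U.T l x = x := by
  obtain ⟨m, hm⟩ := U.order l hx
  exact ⟨fixed_of_wtOp_eq_zero hp2 hm, wtOp_eq_zero_of_fixed hp2⟩

lemma Auts.mem_later_iff (hp2 : 2 < p) {l : Fin s} {n : ℤ} {x : M} :
    x ∈ U.ops.later l n ↔ x ∈ A.G n ∧ ∀ l', l < l' → U.T l' x = x :=
  ⟨fun h => ⟨h.1, fun l' hl => (ops_eq_zero_iff hp2 h.1).1 (h.2 l' hl)⟩,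
    fun h => ⟨h.1, fun l' hl => (ops_eq_zero_iff hp2 h.1).2 (h.2 l' hl)⟩⟩

lemma Auts.pro_acyc (hp2 : 2 < p)
    (h : ∀ l n x, x ∈ A.G n → (∀ l', l < l' → U.T l' x = x) →
      ∃ y ∈ A.G n, (∀ l', l < l' → U.T l' y = y) ∧ U.T l y - y = x) : Acyc U.ops.pro := by
  refine U.ops.pro_acyc fun l n x hx => ?_
  refine exists_wtOp_eq (V := U.ops.later l n) hp2 (fun x hx => ?_) (fun x hx => U.order l hx.1)
    (fun x hx => ?_) hx
  · rw [mem_later_iff hp2] at hx ⊢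
    exact ⟨U.T_mem l hx.1, fun l' hl => by rw [U.comm, hx.2 l' hl]⟩
  · rw [mem_later_iff hp2] at hx
    obtain ⟨y, h1, h2, h3⟩ := h l n x hx.1 hx.2
    exact ⟨y, (mem_later_iff hp2).2 ⟨h1, h2⟩, h3⟩

lemma Auts.ops_pow (hp2 : 2 < p) (hT : ∀ l, U.T l ^ p = 1) (l : Fin s) (x : M) :
    (U.ops.X l ^ p) x = 0 := by
  rw [ops_X, wtOp_pow_char hp2 (hT l)]
  rfl

lemma Auts.fin_acyc (hp2 : 2 < p) (hp : 0 < p) (hT : ∀ l, U.T l ^ p = 1)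
    (h : ∀ l n x, x ∈ A.G n → (∀ l', l < l' → U.T l' x = x) → U.T l x = x →
      ∃ y ∈ A.G n, (∀ l', l < l' → U.T l' y = y) ∧
        ∑ a ∈ Finset.range p, (U.T l ^ a) y = x) :
    Acyc (U.ops.fin p hp (ops_pow hp2 hT)) := by
  refine U.ops.fin_acyc hp2 hp _ fun l n x hx hx0 => ?_
  rw [mem_later_iff hp2] at hx
  obtain ⟨y, h1, h2, h3⟩ := h l n x hx.1 hx.2 ((ops_eq_zero_iff hp2 hx.1).1 hx0)
  exact ⟨y, (mem_later_iff hp2).2 ⟨h1, h2⟩, exists_wtOp_pow_eq hp2 (hT l) hx0 h3⟩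

end GrCx

/-! ### Generators and coordinates of a central extension -/

/-- A central subgroup `Z` of a pro-`p` group `G`, topological generators `ν` of `Z`, and
elements `ε` whose images topologically generate the abelian group `G ⧸ Z`. -/
structure CentralGens (p : ℕ) (G : Type u) [Group G] [TopologicalSpace G] (r s : ℕ) where
  Z : Subgroup G
  ν : Fin r → G
  ε : Fin s → G
  central : Z ≤ Subgroup.center G
  ν_mem : ∀ l, ν l ∈ Z
  ν_gen : ∀ K : Subgroup G, IsOpen (K : Set G) → (∀ l, ν l ∈ K) → Z ≤ K
  ε_gen : ∀ K : Subgroup G, IsOpen (K : Set G) → Z ≤ K → (∀ l, ε l ∈ K) → K = ⊤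
  ε_comm : ∀ l l', ∃ z ∈ Z, ε l * ε l' = z * (ε l' * ε l)
  pow_mem : ∀ K : Subgroup G, IsOpen (K : Set G) → ∀ g, ∃ m : ℕ, g ^ p ^ m ∈ K

namespace CentralGens

variable {p : ℕ} {G : Type u} [Group G] [TopologicalSpace G] {r s : ℕ}

/-- The generators form a basis modulo `q`: there are locally constant dual coordinates. -/
structure Coords (D : CentralGens p G r s) (q : ℕ) : Prop where
  exists_left : ∀ l, ∃ τ : G → ZMod q, IsLocallyConstant τ ∧ (∀ x, τ (D.ν l * x) = τ x + 1) ∧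
    ∀ l', l' ≠ l → ∀ x, τ (D.ν l' * x) = τ x
  exists_right : ∀ l, ∃ τ : G → ZMod q, IsLocallyConstant τ ∧ (∀ x, τ (D.ε l * x) = τ x + 1) ∧
    (∀ l', l' ≠ l → ∀ x, τ (D.ε l' * x) = τ x) ∧ ∀ z ∈ D.Z, ∀ x, τ (z * x) = τ x

variable [Fact p.Prime] (D : CentralGens p G r s) (V : Type u) [AddCommGroup V] [Module (ZMod p) V]

omit [Fact p.Prime] in
lemma mul_comm_of_mem {z : G} (hz : z ∈ D.Z) (g : G) : z * g = g * z :=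
  (Subgroup.mem_center_iff.1 (D.central hz) g).symm

/-- The cochains that are invariant under the central subgroup. -/
def inv : Submodule (ZMod p) (Tot V G) where
  carrier := {φ | ∀ z ∈ D.Z, Tot.act (ZMod p) z φ = φ}
  add_mem' ha hb z hz := by rw [map_add, ha z hz, hb z hz]
  zero_mem' _ _ := map_zero _
  smul_mem' c φ h z hz := by rw [map_smul, h z hz]

variable {V}

lemma act_comm {z : G} (hz : z ∈ D.Z) (g : G) (φ : Tot V G) :
    Tot.act (ZMod p) z (Tot.act (ZMod p) g φ) = Tot.act (ZMod p) g (Tot.act (ZMod p) z φ) := by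
  rw [← Tot.act_mul, ← Tot.act_mul, D.mul_comm_of_mem hz]

lemma act_mem_inv (g : G) {φ : Tot V G} (h : φ ∈ D.inv V) : Tot.act (ZMod p) g φ ∈ D.inv V :=
  fun z hz => by rw [D.act_comm hz, h z hz]

variable (V) in
/-- The action of `G` on the invariants of the central subgroup. -/
def actInv (g : G) : Module.End (ZMod p) (D.inv V) :=
  (Tot.act (ZMod p) g).restrict fun _ h => D.act_mem_inv g h

@[simp] lemma coe_actInv (g : G) (φ : D.inv V) :
    (D.actInv V g φ : Tot V G) = Tot.act (ZMod p) g φ := rfl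

lemma coe_actInv_pow (g : G) (n : ℕ) (φ : D.inv V) :
    ((D.actInv V g ^ n) φ : Tot V G) = Tot.act (ZMod p) (g ^ n) φ := by
  induction n with
  | zero => rw [pow_zero, pow_zero, Tot.act_one]; rfl
  | succ n ih => rw [pow_succ', pow_succ', Module.End.mul_apply, coe_actInv, ih, Tot.act_mul]

variable (V) in
/-- The complex of invariants of the central subgroup. -/
@[simps]
def invCx : GrCx (ZMod p) (D.inv V) where
  d := (Tot.d (ZMod p)).restrict fun φ h z hz => by rw [Tot.act_d, h z hz]
  G n := ((lcCx (ZMod p) V G).G n).comap (D.inv V).subtype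
  d_d φ := Subtype.ext ((lcCx (ZMod p) V G).d_d φ)
  d_mem h := (lcCx (ZMod p) V G).d_mem h
  G_neg hn h := Subtype.ext ((lcCx (ZMod p) V G).G_neg hn h)

variable [IsTopologicalGroup G] [CompactSpace G]

variable (V) in
/-- The action of the generators of the central subgroup on cochains. -/
@[simps T]
def auts : GrCx.Auts (lcCx (ZMod p) V G) r where
  T l := Tot.act (ZMod p) (D.ν l)
  T_d l x := Tot.act_d _ _ _
  T_mem l n x h := Tot.act_mem _ h
  comm l l' x := D.act_comm (D.ν_mem l) _ _
  order l n x hx := by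
    obtain ⟨m, hm⟩ := D.pow_mem _ (Tot.isOpen_stab hx) (D.ν l)
    exact ⟨m, by rw [Tot.act_pow]; exact hm⟩

variable (V) in
/-- The action of the remaining generators on the invariants of the central subgroup. -/
@[simps T]
def autsInv : GrCx.Auts (D.invCx V) s where
  T l := D.actInv V (D.ε l)
  T_d l x := Subtype.ext (Tot.act_d _ _ _)
  T_mem l n x h := Tot.act_mem (V := V) _ h
  comm l l' x := by
    obtain ⟨z, hz, e⟩ := D.ε_comm l l'
    refine Subtype.ext ?_
    rw [coe_actInv, coe_actInv, coe_actInv, coe_actInv, ← Tot.act_mul, e, Tot.act_mul, Tot.act_mul]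
    exact D.act_mem_inv _ (D.act_mem_inv _ x.2) z hz
  order l n x hx := by
    obtain ⟨m, hm⟩ := D.pow_mem _ (Tot.isOpen_stab (V := V) hx) (D.ε l)
    exact ⟨m, Subtype.ext (by rw [coe_actInv_pow]; exact hm)⟩

section
variable (hp2 : 2 < p)
include hp2

lemma forall_ops_eq_zero_iff {n : ℤ} {φ : Tot V G} (hφ : φ ∈ (lcCx (ZMod p) V G).G n) :
    (∀ l, (D.auts V).ops.X l φ = 0) ↔ φ ∈ D.inv V := by
  simp only [GrCx.Auts.ops_eq_zero_iff hp2 hφ, auts_T]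
  exact ⟨fun h => D.ν_gen _ (Tot.isOpen_stab hφ) h, fun h l => h _ (D.ν_mem l)⟩

lemma forall_opsInv_eq_zero_iff {n : ℤ} {φ : D.inv V} (hφ : φ ∈ (D.invCx V).G n) :
    (∀ l, (D.autsInv V).ops.X l φ = 0) ↔ ∀ g, Tot.act (ZMod p) g (φ : Tot V G) = φ := by
  simp only [GrCx.Auts.ops_eq_zero_iff hp2 hφ, autsInv_T]
  refine ⟨fun h g => ?_, fun h l => Subtype.ext (h _)⟩
  have h1 := D.ε_gen _ (Tot.isOpen_stab (V := V) hφ) φ.2 fun l => congrArg Subtype.val (h l)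
  have h2 : g ∈ (⊤ : Subgroup G) := trivial
  rwa [← h1] at h2

lemma pro_acyc (hD : ∀ m, D.Coords (p ^ m)) : OpCx.Acyc (D.auts V).ops.pro := by
  refine GrCx.Auts.pro_acyc hp2 fun l n φ hφ h => ?_
  obtain ⟨m, hm⟩ := (D.auts V).order l hφ
  obtain ⟨τ, h1, h2, h3⟩ := (hD (m + 1)).exists_left l
  rw [auts_T, Tot.act_pow] at hm
  obtain ⟨ψ, hψ, e, h4⟩ := Tot.exists_act_sub_eq h1 h2 hφ hm
  refine ⟨ψ, hψ, fun l' hl => h4 _ (fun a => ?_) (h3 l' hl.ne'), e⟩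
  rw [D.act_comm (D.ν_mem l'), show Tot.act (ZMod p) (D.ν l') φ = φ from h l' hl]

lemma pro_acyc_inv (hD : ∀ m, D.Coords (p ^ m)) : OpCx.Acyc (D.autsInv V).ops.pro := by
  refine GrCx.Auts.pro_acyc hp2 fun l n φ hφ h => ?_
  obtain ⟨m, hm⟩ := (D.autsInv V).order l hφ
  obtain ⟨τ, h1, h2, h3, h4⟩ := (hD (m + 1)).exists_right l
  have hm' : Tot.act (ZMod p) (D.ε l ^ p ^ m) (φ : Tot V G) = φ := by
    rw [← coe_actInv_pow]; exact congrArg Subtype.val hm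
  obtain ⟨ψ, hψ, e, h5⟩ := Tot.exists_act_sub_eq h1 h2 (V := V) hφ hm'
  refine ⟨⟨ψ, fun z hz => h5 _ (fun a => D.act_mem_inv _ φ.2 z hz) (h4 z hz)⟩, hψ,
    fun l' hl => Subtype.ext (h5 _ (fun a => ?_) (h3 l' hl.ne')), Subtype.ext e⟩
  have h6 : D.actInv V (D.ε l') ((D.actInv V (D.ε l) ^ a) φ) = (D.actInv V (D.ε l) ^ a) φ := by
    have hc : Commute (D.actInv V (D.ε l')) (D.actInv V (D.ε l)) :=
      LinearMap.ext fun x => (D.autsInv V).comm l' l x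
    have := LinearMap.congr_fun (hc.pow_right a).eq φ
    rw [Module.End.mul_apply, Module.End.mul_apply] at this
    rw [this]
    congr 1
    exact h l' hl
  have h7 := congrArg Subtype.val h6
  rwa [coe_actInv, coe_actInv_pow] at h7

lemma fin_acyc (hp : 0 < p) (hD : D.Coords p) (hT : ∀ l, (D.auts V).T l ^ p = 1) :
    OpCx.Acyc ((D.auts V).ops.fin p hp (GrCx.Auts.ops_pow hp2 hT)) := by
  refine GrCx.Auts.fin_acyc hp2 hp hT fun l n φ hφ h h0 => ?_
  obtain ⟨τ, h1, h2, h3⟩ := hD.exists_left l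
  obtain ⟨ψ, hψ, e, h4⟩ := Tot.exists_norm_eq h1 h2 hφ h0
  exact ⟨ψ, hψ, fun l' hl => h4 _ (h l' hl) (h3 l' hl.ne'), e⟩

lemma fin_acyc_inv (hp : 0 < p) (hD : D.Coords p) (hT : ∀ l, (D.autsInv V).T l ^ p = 1) :
    OpCx.Acyc ((D.autsInv V).ops.fin p hp (GrCx.Auts.ops_pow hp2 hT)) := by
  refine GrCx.Auts.fin_acyc hp2 hp hT fun l n φ hφ h h0 => ?_
  obtain ⟨τ, h1, h2, h3, h4⟩ := hD.exists_right l
  obtain ⟨ψ, hψ, e, h5⟩ := Tot.exists_norm_eq h1 h2 (V := V) hφ (congrArg Subtype.val h0)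
  refine ⟨⟨ψ, fun z hz => h5 _ (φ.2 z hz) (h4 z hz)⟩, hψ,
    fun l' hl => Subtype.ext (h5 _ (congrArg Subtype.val (h l' hl)) (h3 l' hl.ne')),
    Subtype.ext ?_⟩
  refine Eq.trans ?_ e
  rw [AddSubmonoidClass.coe_finsetSum]
  refine Finset.sum_congr rfl fun a _ => ?_
  rw [autsInv_T, coe_actInv_pow, Tot.act_pow]

end

lemma auts_pow (hν : ∀ l, D.ν l ^ p = 1) (l : Fin r) : (D.auts V).T l ^ p = 1 := by
  ext1 φ
  rw [auts_T, Tot.act_pow, hν, Tot.act_one]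
  rfl

lemma autsInv_pow (hε : ∀ l, D.ε l ^ p ∈ D.Z) (l : Fin s) : (D.autsInv V).T l ^ p = 1 := by
  ext1 φ
  refine Subtype.ext ?_
  rw [autsInv_T, coe_actInv_pow]
  exact φ.2 _ (hε l)

end CentralGens

/-! ### Surjectivity on the cohomology of invariant cochains -/

namespace CentralGens
open OpCx

variable {p : ℕ} [Fact p.Prime] {r s : ℕ} {V G G' : Type u} [AddCommGroup V] [Module (ZMod p) V]
  [Group G] [TopologicalSpace G] [IsTopologicalGroup G] [CompactSpace G]
  [Group G'] [TopologicalSpace G'] [IsTopologicalGroup G'] [CompactSpace G']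

lemma isResolution_pro (hp2 : 2 < p) (D : CentralGens p G r s) (hD : ∀ m, D.Coords (p ^ m)) :
    IsResolution (LowerSet.mem_Iic_iff.2 zero_le_one) (D.auts V).ops.pro
      ((D.auts V).ops.augPro (Tot.aug (ZMod p)) (Tot.d_aug (ZMod p)) Tot.aug_mem
        fun l v => wtOp_eq_zero_of_fixed hp2 (Tot.act_aug (ZMod p) (D.ν l) v)) where
  acyc := D.pro_acyc hp2 hD
  qi := isQI_aug rfl rfl

lemma isResolution_fin (hp2 : 2 < p) (D : CentralGens p G r s) (hD : D.Coords p)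
    (hT : ∀ l, (D.auts V).T l ^ p = 1) :
    IsResolution LowerSet.mem_top ((D.auts V).ops.fin p (by omega) (GrCx.Auts.ops_pow hp2 hT))
      ((D.auts V).ops.augFin (by omega) (GrCx.Auts.ops_pow hp2 hT) (Tot.aug (ZMod p))
        (Tot.d_aug (ZMod p)) Tot.aug_mem
        fun l v => wtOp_eq_zero_of_fixed hp2 (Tot.act_aug (ZMod p) (D.ν l) v)) where
  acyc := D.fin_acyc hp2 _ hD hT
  qi := isQI_aug rfl rfl

/-- A compatible map between groups with central generators. -/
structure IsMap (D : CentralGens p G r s) (D' : CentralGens p G' r s) (f : G →* G') : Prop where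
  continuous : Continuous f
  map_Z : ∀ z ∈ D.Z, f z ∈ D'.Z
  map_ν : ∀ l, f (D.ν l) = D'.ν l
  map_ε : ∀ l, f (D.ε l) = D'.ε l

omit [IsTopologicalGroup G] [CompactSpace G] [IsTopologicalGroup G'] [CompactSpace G'] in
lemma pull_mem_inv {D : CentralGens p G r s} {D' : CentralGens p G' r s} {f : G →* G'}
    (hf : ∀ z ∈ D.Z, f z ∈ D'.Z) {φ : Tot V G'} (hφ : φ ∈ D'.inv V) :
    Tot.pull (ZMod p) f φ ∈ D.inv V := fun z hz => by
  rw [← Tot.pull_act, hφ _ (hf z hz)]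

/-- Pullback on the invariants of the central subgroups. -/
def pullInv {D : CentralGens p G r s} {D' : CentralGens p G' r s} {f : G →* G'}
    (hf : ∀ z ∈ D.Z, f z ∈ D'.Z) : D'.inv V →ₗ[ZMod p] D.inv V :=
  (Tot.pull (ZMod p) f).restrict fun _ => pull_mem_inv hf

omit [IsTopologicalGroup G] [CompactSpace G] [IsTopologicalGroup G'] [CompactSpace G'] in
@[simp] lemma coe_pullInv {D : CentralGens p G r s} {D' : CentralGens p G' r s} {f : G →* G'}
    (hf : ∀ z ∈ D.Z, f z ∈ D'.Z) (φ : D'.inv V) :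
    (pullInv hf φ : Tot V G) = Tot.pull (ZMod p) f φ := rfl

/-- An endomorphism of weight two on the central subgroup and of weight one modulo it. -/
structure IsScaling (D : CentralGens p G r s) (ℓ : G →* G) (L : ℕ) : Prop where
  continuous : Continuous ℓ
  map_Z : ∀ z ∈ D.Z, ℓ z ∈ D.Z
  map_ν : ∀ l, ℓ (D.ν l) = D.ν l ^ L ^ 2
  map_ε : ∀ l, ∃ z ∈ D.Z, ℓ (D.ε l) = z * D.ε l ^ L
  iterate : (ℓ : G → G)^[p - 1] = id

section scaling
variable {D : CentralGens p G r s} {ℓ : G →* G} {L : ℕ} (hℓ : D.IsScaling ℓ L)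
  (hL : (L : ZMod p) ≠ 0)
include hℓ hL

lemma IsScaling.pull_ops (hν : ∀ l, D.ν l ^ p = 1) (l : Fin r) (φ : Tot V G) :
    (L : ZMod p) ^ 2 • Tot.pull (ZMod p) ℓ ((D.auts V).ops.X l φ) =
      (D.auts V).ops.X l (Tot.pull (ZMod p) ℓ φ) := by
  have h := wtOp_conj (D.auts_pow hν l) (Tot.pull (ZMod p) ℓ) (b := L ^ 2)
    (T' := (D.auts V).T l) (by rw [Nat.cast_pow]; exact pow_ne_zero _ hL) (fun x => by
      rw [auts_T, Tot.act_pow, ← hℓ.map_ν, Tot.pull_act]) φ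
  rwa [Nat.cast_pow] at h

lemma IsScaling.pull_opsInv (hε : ∀ l, D.ε l ^ p ∈ D.Z) (l : Fin s) (φ : D.inv V) :
    (L : ZMod p) ^ 1 • pullInv hℓ.map_Z ((D.autsInv V).ops.X l φ) =
      (D.autsInv V).ops.X l (pullInv hℓ.map_Z φ) := by
  rw [pow_one]
  refine wtOp_conj (D.autsInv_pow hε l) (pullInv hℓ.map_Z) (T' := (D.autsInv V).T l) hL
    (fun x => Subtype.ext ?_) φ
  obtain ⟨z, hz, e⟩ := hℓ.map_ε l
  rw [autsInv_T, coe_pullInv, coe_actInv_pow, coe_actInv, coe_pullInv, ← Tot.pull_act, e,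
    Tot.act_mul, D.act_mem_inv _ x.2 z hz]

end scaling

omit [IsTopologicalGroup G] [CompactSpace G] in
lemma IsScaling.pull_iterate {D : CentralGens p G r s} {ℓ : G →* G} {L : ℕ}
    (hℓ : D.IsScaling ℓ L) (φ : Tot V G) : (Tot.pull (ZMod p) ℓ ^ (p - 1)) φ = φ := by
  have h : ∀ n : ℕ, ∀ φ : Tot V G,
      (Tot.pull (ZMod p) ℓ ^ n) φ = Tot.pull (ZMod p) (ℓ : G → G)^[n] φ := by
    intro n
    induction n with
    | zero => intro φ; exact (Tot.pull_id (ZMod p) φ).symm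
    | succ n ih =>
      intro φ
      rw [pow_succ', Module.End.mul_apply, ih, Tot.pull_pull, Function.iterate_succ]
  rw [h, hℓ.iterate, Tot.pull_id]

omit [IsTopologicalGroup G] [CompactSpace G] in
lemma IsScaling.pullInv_iterate {D : CentralGens p G r s} {ℓ : G →* G} {L : ℕ}
    (hℓ : D.IsScaling ℓ L) (φ : D.inv V) :
    ((pullInv hℓ.map_Z : Module.End (ZMod p) (D.inv V)) ^ (p - 1)) φ = φ := by
  have h : ∀ (n : ℕ), (((pullInv hℓ.map_Z : Module.End (ZMod p) (D.inv V)) ^ n) φ : Tot V G) =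
      (Tot.pull (ZMod p) ℓ ^ n) φ := by
    intro n
    induction n with
    | zero => rfl
    | succ n ih => rw [pow_succ', pow_succ', Module.End.mul_apply, Module.End.mul_apply,
        coe_pullInv, ih]
  exact Subtype.ext ((h _).trans (hℓ.pull_iterate _))

section main
variable {D : CentralGens p G r s} {D' : CentralGens p G' r s} {f : G →* G'} {ℓ : G' →* G'} {L : ℕ}

lemma natCast_pred_ne_zero (hp2 : 2 < p) : ((p - 1 : ℕ) : ZMod p) ≠ 0 := by
  rw [Ne, ZMod.natCast_eq_zero_iff]
  exact fun h => absurd (Nat.le_of_dvd (by omega) h) (by omega)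

variable (V) in
/-- The map of two-step invariants induced by `f`, from the finite to the profinite side. -/
noncomputable def morInv (hp2 : 2 < p) (hf : IsMap D D' f)
    (hε : ∀ l, D'.ε l ^ p ∈ D'.Z) :
    Mor (truncScalar (ZMod p))
      ((D'.autsInv V).ops.fin p (by omega) (GrCx.Auts.ops_pow hp2 (D'.autsInv_pow hε)))
      (D.autsInv V).ops.pro :=
  GrCx.Ops.morTrunc (pullInv hf.map_Z) (fun _ => Subtype.ext (Tot.pull_d _ _ _))
    (fun h => Tot.pull_mem (V := V) hf.continuous h)
    (fun l x => wtOp_map (pullInv hf.map_Z) (fun y => Subtype.ext (by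
      rw [autsInv_T, autsInv_T, coe_pullInv, coe_actInv, coe_actInv, coe_pullInv, ← hf.map_ε,
        Tot.pull_act])) x)

variable (V) in
/-- The weight automorphism of the two-step invariants. -/
noncomputable def morScale (hp2 : 2 < p) (hℓ : D'.IsScaling ℓ L) (hL : (L : ZMod p) ≠ 0)
    (hε : ∀ l, D'.ε l ^ p ∈ D'.Z) :
    Mor (wtScalar (L : ZMod p) 1)
      ((D'.autsInv V).ops.fin p (by omega) (GrCx.Auts.ops_pow hp2 (D'.autsInv_pow hε)))
      ((D'.autsInv V).ops.fin p (by omega) (GrCx.Auts.ops_pow hp2 (D'.autsInv_pow hε))) :=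
  GrCx.Ops.morWt (ZMod.pow_card_sub_one_eq_one hL) 1 (pullInv hℓ.map_Z)
    (fun _ => Subtype.ext (Tot.pull_d _ _ _)) (fun h => Tot.pull_mem (V := V) hℓ.continuous h)
    (hℓ.pull_opsInv hL hε)

/-- The first page of the spectral sequence of the central subgroups: the invariants of the central
subgroups satisfy the hypotheses of the weight argument. -/
theorem firstPage_inv (hp2 : 2 < p) (hf : IsMap D D' f) (hD : ∀ m, D.Coords (p ^ m))
    (hD' : D'.Coords p) (hν : ∀ l, D'.ν l ^ p = 1) (hε : ∀ l, D'.ε l ^ p ∈ D'.Z)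
    (hℓ : D'.IsScaling ℓ L) (hL : (L : ZMod p) ≠ 0) :
    FirstPage (L : ZMod p) 1 0 r (morInv V hp2 hf hε) (morScale V hp2 hℓ hL hε) := by
  have hp : 0 < p := by omega
  have hLp := ZMod.pow_card_sub_one_eq_one hL
  have hX := GrCx.Auts.ops_pow hp2 (D'.auts_pow (V := V) hν)
  set B := (D'.auts V).ops.fin p hp hX with hB
  set C := (D.auts V).ops.pro with hC
  let F : Mor (truncScalar (ZMod p)) B C :=
    GrCx.Ops.morTrunc (Tot.pull (ZMod p) f) (fun _ => Tot.pull_d _ _ _)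
      (fun h => Tot.pull_mem hf.continuous h)
      (fun l x => wtOp_map (Tot.pull (ZMod p) f) (fun y => by
        rw [auts_T, auts_T, ← hf.map_ν, Tot.pull_act]) x)
  let Λ : Mor (wtScalar (L : ZMod p) 2) B B :=
    GrCx.Ops.morWt hLp 2 (Tot.pull (ZMod p) ℓ) (fun _ => Tot.pull_d _ _ _)
      (fun h => Tot.pull_mem hℓ.continuous h) (hℓ.pull_ops hL hν)
  have hmem : ∀ {n : ℤ} {x : D'.inv V}, x ∈ (D'.invCx V).G n → (x : Tot V G') ∈ B.inv.G n :=
    fun {n x} h => ⟨h, fun l => by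
      have := (D'.forall_ops_eq_zero_iff hp2 (φ := (x : Tot V G')) h).2 x.2 l
      simpa [hB] using this⟩
  have hmem' : ∀ {n : ℤ} {x : D.inv V}, x ∈ (D.invCx V).G n → (x : Tot V G) ∈ C.inv.G n :=
    fun {n x} h => ⟨h, fun l => by
      have := (D.forall_ops_eq_zero_iff hp2 (φ := (x : Tot V G)) h).2 x.2 l
      simpa [hC] using this⟩
  refine firstPage_of_resolution (B := B) (C := C) (f := F) (Λ := Λ)
    (isResolution_fin hp2 D' hD' (D'.auts_pow hν)) (isResolution_pro hp2 D hD)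
    (fun v => Tot.pull_aug _ _ _) (fun v => Tot.pull_aug _ _ _) (natCast_pred_ne_zero hp2) hLp
    hℓ.pull_iterate (fun _ => rfl) (fun _ => rfl) (D'.inv V).subtype (D.inv V).subtype
    Subtype.val_injective Subtype.val_injective (fun _ => rfl) (fun _ => rfl) hmem hmem' ?_ ?_
    (fun _ => rfl) (fun _ => rfl) ?_ ?_
  · intro n y hy
    have h1 := (D'.forall_ops_eq_zero_iff hp2 hy.1).1 fun l => by simpa [hB] using hy.2 l
    exact ⟨⟨y, h1⟩, hy.1, rfl⟩
  · intro n y hy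
    have h1 := (D.forall_ops_eq_zero_iff hp2 hy.1).1 fun l => by simpa [hC] using hy.2 l
    exact ⟨⟨y, h1⟩, hy.1, rfl⟩
  · intro l m
    set X : Module.End (ZMod p) (Tot V G') := wtOp (Tot.act (ZMod p) (D'.ε l))
    have hsub : ∀ x : D'.inv V, ((wtOp (D'.actInv V (D'.ε l)) x : D'.inv V) : Tot V G') = X x :=
      fun x => wtOp_map (D'.inv V).subtype (fun _ => rfl) x
    have hd : ∀ x, X (Tot.d (ZMod p) x) = Tot.d (ZMod p) (X x) := fun x =>
      (wtOp_map (Tot.d (ZMod p)) (fun y => (Tot.act_d _ _ y).symm) x).symm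
    have hmemX : ∀ {n : ℤ} {x : Tot V G'}, x ∈ (lcCx (ZMod p) V G').G n →
        X x ∈ (lcCx (ZMod p) V G').G n := fun h => wtOp_mem (fun _ => Tot.act_mem _) h
    have hcomm : ∀ l' x, X ((D'.auts V).ops.X l' x) = (D'.auts V).ops.X l' (X x) := fun l' x =>
      wtOp_map X (fun y => (wtOp_map (Tot.act (ZMod p) (D'.ν l'))
        (fun y => D'.act_comm (D'.ν_mem l') _ y) y).symm) x
    have haug : ∀ v : V, X (Tot.aug (ZMod p) v) = 0 := fun v =>
      wtOp_eq_zero_of_fixed hp2 (Tot.act_aug (ZMod p) _ v)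
    by_cases hm : Even m
    · refine ⟨GrCx.Ops.morFin X hd hmemX hcomm, haug, fun x => ?_⟩
      refine Eq.trans ?_ (hsub x)
      simp [hm]
    · have hpow : ∀ (n : ℕ) (x : D'.inv V),
          (((wtOp (D'.actInv V (D'.ε l)) ^ n) x : D'.inv V) : Tot V G') = (X ^ n) x := by
        intro n x
        induction n with
        | zero => rfl
        | succ n ih => rw [pow_succ', pow_succ', Module.End.mul_apply, hsub, ih,
            Module.End.mul_apply]
      refine ⟨GrCx.Ops.morFin (X ^ (p - 1)) (fun x => ?_) (fun h => ?_) (fun l' x => ?_),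
        fun v => ?_, fun x => ?_⟩
      · exact LinearMap.congr_fun (Commute.pow_left (LinearMap.ext hd : Commute X _) (p - 1)).eq x
      · generalize p - 1 = n
        induction n with
        | zero => exact h
        | succ n ih => rw [pow_succ', Module.End.mul_apply]; exact hmemX ih
      · exact LinearMap.congr_fun
          (Commute.pow_left (LinearMap.ext (hcomm l') : Commute X _) (p - 1)).eq x
      · obtain ⟨q, hq⟩ : ∃ q, p - 1 = q + 1 := ⟨p - 2, by omega⟩
        change (X ^ (p - 1)) (Tot.aug (ZMod p) v) = 0
        rw [hq, pow_succ, Module.End.mul_apply, haug, map_zero]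
      · refine Eq.trans ?_ (hpow (p - 1) x)
        simp [hm]
  · intro l m
    by_cases hm : m = 0
    · set X : Module.End (ZMod p) (Tot V G) := wtOp (Tot.act (ZMod p) (D.ε l))
      refine ⟨GrCx.Ops.morPro X
        (fun x => (wtOp_map (Tot.d (ZMod p)) (fun y => (Tot.act_d _ _ y).symm) x).symm)
        (fun h => wtOp_mem (fun _ => Tot.act_mem _) h)
        (fun l' x => wtOp_map X (fun y => (wtOp_map (Tot.act (ZMod p) (D.ν l'))
          (fun y => D.act_comm (D.ν_mem l') _ y) y).symm) x),
        fun v => wtOp_eq_zero_of_fixed hp2 (Tot.act_aug (ZMod p) _ v), fun x => ?_⟩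
      have h1 := wtOp_map (D.inv V).subtype (T := D.actInv V (D.ε l))
        (T' := Tot.act (ZMod p) (D.ε l)) (fun _ => rfl) x
      refine Eq.trans ?_ h1
      simp [hm]
    · refine ⟨GrCx.Ops.morPro 0 (fun _ => ?_) (fun _ => Submodule.zero_mem _) (fun _ _ => ?_),
        fun _ => rfl, fun x => ?_⟩
      · simp
      · simp
      · simp [hm]

/-- Invariant cocycles on the profinite side are cohomologous to pullbacks. -/
theorem exists_pullback (hp2 : 2 < p) (hf : IsMap D D' f) (hD : ∀ m, D.Coords (p ^ m))
    (hD' : D'.Coords p) (hν : ∀ l, D'.ν l ^ p = 1) (hε : ∀ l, D'.ε l ^ p ∈ D'.Z)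
    (hℓ : D'.IsScaling ℓ L) (hL : (L : ZMod p) ≠ 0)
    (hprim : ∀ δ : ℕ, (L : ZMod p) ^ δ = 1 → p - 1 ∣ δ)
    (hbound : (s : ℤ) + 3 * r - 1 < 2 * (p - 1 : ℕ)) {n : ℤ} {φ : Tot V G}
    (hφ : φ ∈ (lcCx (ZMod p) V G).G n) (hinv : ∀ g, Tot.act (ZMod p) g φ = φ)
    (hdφ : Tot.d (ZMod p) φ = 0) :
    ∃ c ∈ (lcCx (ZMod p) V G').G n, (∀ g, Tot.act (ZMod p) g c = c) ∧ Tot.d (ZMod p) c = 0 ∧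
      ∃ y ∈ (lcCx (ZMod p) V G).G (n - 1), (∀ g, Tot.act (ZMod p) g y = y) ∧
        Tot.pull (ZMod p) f c - φ = Tot.d (ZMod p) y := by
  have hLp := ZMod.pow_card_sub_one_eq_one hL
  have hpage := (firstPage_inv (V := V) hp2 hf hD hD' hν hε hℓ hL).K hL one_pos
  have hq' := isQI_ι (D'.fin_acyc_inv (V := V) hp2 (by omega) hD' (D'.autsInv_pow hε))
  have hq := isQI_ι (D.pro_acyc_inv (V := V) hp2 hD)
  set B := (D'.autsInv V).ops.fin p (by omega : 0 < p)
    (GrCx.Auts.ops_pow hp2 (D'.autsInv_pow hε)) with hB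
  set C := (D.autsInv V).ops.pro with hC
  set F : Mor _ B C := morInv V hp2 hf hε with hF
  set φ₀ : D.inv V := ⟨φ, fun z _ => hinv z⟩ with hφ₀
  have h0 : φ₀ ∈ C.inv.G n := ⟨hφ, fun l => by
    simpa [hC] using (D.forall_opsInv_eq_zero_iff hp2 (φ := φ₀) hφ).2 hinv l⟩
  have hd0 : C.d φ₀ = 0 := Subtype.ext hdφ
  obtain ⟨c, hc, hdc, y, hy, e⟩ := hpage.surjective (natCast_pred_ne_zero hp2) hLp hprim
    (Mor.K_iterate (fun m => by
      rw [wtScalar, ← pow_mul, mul_comm, pow_mul, hLp, one_pow]) _ fun x => hℓ.pullInv_iterate x)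
    (by push_cast at hbound ⊢; linarith) (z := C.ι φ₀) (ι_mem C hφ)
    (by rw [← ι_d C h0.2, hd0, map_zero])
  obtain ⟨c', hc', hdc', y', hy', rfl⟩ := hq'.surj hc hdc
  have hFc := mor_inv_mem rfl F hc'
  obtain ⟨w, hw, hdw⟩ := hq.inj (n := n) (a := F.g c' - φ₀) (z := y - F.K.g y')
    (sub_mem hFc h0) (by
      change C.d _ = 0
      rw [map_sub, ← F.g_d, hd0, sub_zero]
      have : B.d c' = 0 := hdc'
      rw [this, map_zero]) (sub_mem hy (F.K.g_mem hy')) (by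
      rw [map_add, Mor.K_ι rfl, F.K.g_d] at e
      rw [map_sub, map_sub, ← e]
      abel)
  refine ⟨(c' : Tot V G'), hc'.1, ?_, congrArg Subtype.val hdc', (w : Tot V G), hw.1, ?_,
    (congrArg Subtype.val hdw).symm⟩
  · exact (D'.forall_opsInv_eq_zero_iff hp2 hc'.1).1 fun l => by simpa [hB] using hc'.2 l
  · exact (D.forall_opsInv_eq_zero_iff hp2 hw.1).1 fun l => by simpa [hC] using hw.2 l

end main

end CentralGens

/-! ### Free abelian pro-`p` groups -/

namespace FreeProP
variable {p : ℕ} [Fact p.Prime] {r : ℕ} {A : Type*} [CommGroup A] [TopologicalSpace A]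
  (e : A ≃ₜ* Multiplicative (Fin r → ℤ_[p]))

/-- The basis of a free abelian pro-`p` group that corresponds to the standard basis. -/
noncomputable def basis (l : Fin r) : A := e.symm (Multiplicative.ofAdd (Pi.single l 1))

/-- The coordinates modulo `p ^ m` of a free abelian pro-`p` group. -/
noncomputable def coord (m : ℕ) (l : Fin r) : A →* Multiplicative (ZMod (p ^ m)) :=
  (AddMonoidHom.toMultiplicative
    ((PadicInt.toZModPow m : ℤ_[p] →+* ZMod (p ^ m)).toAddMonoidHom.comp
      (Pi.evalAddMonoidHom (fun _ => ℤ_[p]) l))).comp e.toMulEquiv.toMonoidHom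

lemma coord_apply (m : ℕ) (l : Fin r) (a : A) :
    (coord e m l a).toAdd = PadicInt.toZModPow m ((e a).toAdd l) := rfl

lemma coord_basis (m : ℕ) (l l' : Fin r) :
    (coord e m l (basis e l')).toAdd = if l' = l then 1 else 0 := by
  rw [coord_apply, basis, ContinuousMulEquiv.apply_symm_apply, toAdd_ofAdd, Pi.single_apply]
  split_ifs <;> simp_all

lemma isLocallyConstant_toZModPow (m : ℕ) :
    IsLocallyConstant (PadicInt.toZModPow m : ℤ_[p] → ZMod (p ^ m)) := by
  refine (IsLocallyConstant.iff_eventually_eq _).2 fun x => ?_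
  have h : ∀ᶠ y in nhds x, ‖y - x‖ ≤ (p : ℝ) ^ (-m : ℤ) := by
    have hpos : (0 : ℝ) < (p : ℝ) ^ (-m : ℤ) :=
      zpow_pos (by exact_mod_cast (Fact.out : p.Prime).pos) _
    filter_upwards [Metric.ball_mem_nhds x hpos] with y hy
    rw [mem_ball_iff_norm] at hy
    exact hy.le
  filter_upwards [h] with y hy
  rw [PadicInt.norm_le_pow_iff_mem_span_pow, ← PadicInt.ker_toZModPow, RingHom.mem_ker, map_sub,
    sub_eq_zero] at hy
  exact hy

lemma isLocallyConstant_coord (m : ℕ) (l : Fin r) : IsLocallyConstant (coord e m l) := by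
  have h1 : Continuous fun a : A => (e a).toAdd l :=
    (continuous_apply l).comp (continuous_toAdd.comp e.continuous)
  exact ((isLocallyConstant_toZModPow m).comp_continuous h1).comp Multiplicative.ofAdd

lemma coord_pow (m : ℕ) (l : Fin r) (a : A) : coord e m l (a ^ p ^ m) = 1 := by
  rw [map_pow]
  refine Multiplicative.toAdd.injective ?_
  rw [toAdd_pow, nsmul_eq_mul, ZMod.natCast_self, zero_mul]
  rfl

/-- An open subgroup that contains the basis is everything. -/
lemma eq_top_of_isOpen {K : Subgroup A} (hK : IsOpen (K : Set A)) (h : ∀ l, basis e l ∈ K) :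
    K = ⊤ := by
  let U : Subgroup (Multiplicative (Fin r → ℤ_[p])) := K.comap e.symm.toMulEquiv.toMonoidHom
  have hU : IsOpen (U : Set (Multiplicative (Fin r → ℤ_[p]))) := hK.preimage e.symm.continuous
  have hUc := U.isClosed_of_isOpen hU
  have h1 : ∀ l (a : ℤ_[p]), Multiplicative.ofAdd (Pi.single l a : Fin r → ℤ_[p]) ∈ U := by
    intro l a
    refine DenseRange.induction_on PadicInt.denseRange_natCast a ?_ fun n => ?_
    · exact hUc.preimage (continuous_ofAdd.comp (continuous_single l))
    · have h2 : (Pi.single l (n : ℤ_[p]) : Fin r → ℤ_[p]) = n • Pi.single l 1 := by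
        rw [← Pi.single_smul, nsmul_eq_mul, mul_one]
      rw [h2, ofAdd_nsmul]
      exact U.pow_mem (h l) n
  rw [eq_top_iff]
  intro a _
  have h3 : e a ∈ U := by
    have h4 : e a = ∏ l, Multiplicative.ofAdd (Pi.single l ((e a).toAdd l) : Fin r → ℤ_[p]) := by
      rw [← ofAdd_sum, Finset.univ_sum_single]
      rfl
    rw [h4]
    exact U.prod_mem fun l _ => h1 l _
  have h5 : e.symm (e a) ∈ K := h3
  rwa [e.symm_apply_apply] at h5

include e in
lemma exists_pow_mem {K : Subgroup A} (hK : IsOpen (K : Set A)) (a : A) :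
    ∃ m : ℕ, a ^ p ^ m ∈ K := by
  have h1 : Filter.Tendsto (fun m : ℕ => e.symm (Multiplicative.ofAdd
      ((p ^ m : ℕ) • (e a).toAdd))) Filter.atTop (nhds 1) := by
    have h2 : Filter.Tendsto (fun m : ℕ => (p ^ m : ℕ) • (e a).toAdd) Filter.atTop (nhds 0) := by
      rw [tendsto_pi_nhds]
      intro l
      have h3 : Filter.Tendsto (fun m : ℕ => (p : ℤ_[p]) ^ m) Filter.atTop (nhds 0) :=
        tendsto_pow_atTop_nhds_zero_of_norm_lt_one ((PadicInt.norm_lt_one_iff_dvd _).2 dvd_rfl)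
      have h4 := h3.mul_const ((e a).toAdd l)
      rw [zero_mul] at h4
      refine h4.congr fun m => ?_
      simp
    have h5 : Continuous fun x : Fin r → ℤ_[p] => e.symm (Multiplicative.ofAdd x) :=
      e.symm.continuous.comp continuous_ofAdd
    have h6 := (h5.tendsto 0).comp h2
    rwa [ofAdd_zero, map_one] at h6
  have h7 := h1.eventually (hK.mem_nhds K.one_mem)
  obtain ⟨m, hm⟩ := h7.exists
  refine ⟨m, ?_⟩
  have h8 : e.symm (Multiplicative.ofAdd ((p ^ m : ℕ) • (e a).toAdd)) = a ^ p ^ m := by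
    rw [ofAdd_nsmul, ofAdd_toAdd, ← map_pow, e.symm_apply_apply]
  rwa [h8] at hm

end FreeProP

/-! ### Coordinates on a central extension -/

/-- A character of a central subgroup whose kernel contains an open subgroup of the whole group
extends to an equivariant locally constant function: choose representatives of the cosets of the
product of the two subgroups. -/
lemma exists_equivariant {A G : Type*} [CommGroup A] [Group G] [TopologicalSpace G]
    [ContinuousMul G] {i : A →* G} (hi : i.range ≤ Subgroup.center G) {q : ℕ}
    (c : A →* Multiplicative (ZMod q)) {K : Subgroup G} (hK : IsOpen (K : Set G))
    (hc : ∀ a, i a ∈ K → c a = 1) :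
    ∃ τ : G → ZMod q, IsLocallyConstant τ ∧ ∀ a x, τ (i a * x) = τ x + (c a).toAdd := by
  have hcomm : ∀ a g, i a * g = g * i a := fun a g =>
    (Subgroup.mem_center_iff.1 (hi ⟨a, rfl⟩) g).symm
  have hK' : ∀ g, g ∈ i.range ⊔ K ↔ ∃ a, ∃ κ ∈ K, i a * κ = g := by
    have : i.range.Normal := ⟨by
      rintro _ ⟨a, rfl⟩ g
      exact ⟨a, by rw [← hcomm, mul_inv_cancel_right]⟩⟩
    intro g
    rw [Subgroup.mem_sup_of_normal_left]
    constructor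
    · rintro ⟨_, ⟨a, rfl⟩, κ, hκ, e⟩
      exact ⟨a, κ, hκ, e⟩
    · rintro ⟨a, κ, hκ, e⟩
      exact ⟨_, ⟨a, rfl⟩, κ, hκ, e⟩
  have hout : ∀ x : G, ∃ a, ∃ κ ∈ K, i a * κ = ((x : G ⧸ (i.range ⊔ K)).out)⁻¹ * x := fun x =>
    (hK' _).1 (QuotientGroup.eq.1 (QuotientGroup.out_eq' _))
  choose n κ hκ hn using hout
  have key : ∀ (a : A) (x : G), ∀ k ∈ K, c (n (i a * x * k)) = c (n x) * c a := by
    intro a x k hk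
    have hcoset : ((i a * x * k : G) : G ⧸ (i.range ⊔ K)) = (x : G ⧸ (i.range ⊔ K)) := by
      refine (QuotientGroup.eq.2 ((hK' _).2 ⟨a, k, hk, ?_⟩)).symm
      rw [hcomm a x, hcomm a k]
      group
      exact (hcomm a k).symm
    have h1 := hn (i a * x * k)
    rw [hcoset] at h1
    have h2 := hn x
    rw [← map_mul, ← div_eq_one, ← map_div]
    refine hc _ ?_
    have h3 : i (n (i a * x * k)) * κ (i a * x * k) = i (n x * a) * (κ x * k) := by
      rw [h1, map_mul, ← hcomm a]
      calc _ = ((x : G ⧸ (i.range ⊔ K)).out)⁻¹ * i a * x * k := by simp only [mul_assoc]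
        _ = i a * (((x : G ⧸ (i.range ⊔ K)).out)⁻¹ * x) * k := by
          rw [← hcomm a]
          simp only [mul_assoc]
        _ = i a * i (n x) * (κ x * k) := by
          rw [← h2]
          simp only [mul_assoc]
    have h4 : i (n (i a * x * k) / (n x * a)) = κ x * k * (κ (i a * x * k))⁻¹ := by
      rw [eq_mul_inv_iff_mul_eq, ← mul_right_inj (i (n x * a)), ← h3, ← mul_assoc, ← map_mul,
        mul_div_cancel]
    rw [h4]
    exact K.mul_mem (K.mul_mem (hκ _) hk) (K.inv_mem (hκ _))
  refine ⟨fun x => (c (n x)).toAdd, (IsLocallyConstant.iff_eventually_eq _).2 fun x => ?_,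
    fun a x => ?_⟩
  · have h1 : ∀ᶠ y in nhds x, x⁻¹ * y ∈ K := by
      have h2 : Continuous fun y : G => x⁻¹ * y := by fun_prop
      exact (h2.tendsto x).eventually (hK.mem_nhds (by simp [K.one_mem]))
    filter_upwards [h1] with y hy
    have h3 := key 1 x _ hy
    rw [map_one, one_mul, mul_inv_cancel_left, map_one, mul_one] at h3
    rw [h3]
  · have h3 := key a x 1 K.one_mem
    rw [mul_one] at h3
    change (c (n (i a * x))).toAdd = _
    rw [h3, toAdd_mul]

namespace CentralGens
variable {p : ℕ} {G G' : Type u} [Group G] [TopologicalSpace G] [Group G'] [TopologicalSpace G']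
  {r s : ℕ}

/-- The image of central generators under a surjective homomorphism. -/
def map (D : CentralGens p G r s) (f : G →* G') (hf : Continuous f) (hs : Function.Surjective f) :
    CentralGens p G' r s where
  Z := D.Z.map f
  ν l := f (D.ν l)
  ε l := f (D.ε l)
  central := by
    rintro _ ⟨z, hz, rfl⟩
    rw [Subgroup.mem_center_iff]
    intro g
    obtain ⟨g, rfl⟩ := hs g
    rw [← map_mul, ← map_mul, Subgroup.mem_center_iff.1 (D.central hz) g]
  ν_mem l := ⟨_, D.ν_mem l, rfl⟩
  ν_gen K hK h := by
    rw [Subgroup.map_le_iff_le_comap]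
    exact D.ν_gen _ (hK.preimage hf) h
  ε_gen K hK hZ h := by
    have h1 := D.ε_gen (K.comap f) (hK.preimage hf) (Subgroup.map_le_iff_le_comap.1 hZ) h
    rw [eq_top_iff]
    intro g _
    obtain ⟨g, rfl⟩ := hs g
    have h2 : g ∈ K.comap f := by rw [h1]; trivial
    exact h2
  ε_comm l l' := by
    obtain ⟨z, hz, e⟩ := D.ε_comm l l'
    exact ⟨f z, ⟨z, hz, rfl⟩, by rw [← map_mul, e, map_mul, map_mul]⟩
  pow_mem K hK g := by
    obtain ⟨g, rfl⟩ := hs g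
    obtain ⟨m, hm⟩ := D.pow_mem (K.comap f) (hK.preimage hf) g
    exact ⟨m, by rw [← map_pow]; exact hm⟩

lemma isMap_map (D : CentralGens p G r s) (f : G →* G') (hf : Continuous f)
    (hs : Function.Surjective f) : IsMap D (D.map f hf hs) f where
  continuous := hf
  map_Z z hz := ⟨z, hz, rfl⟩
  map_ν _ := rfl
  map_ε _ := rfl

end CentralGens

section extension
variable {p : ℕ} [Fact p.Prime] {r s : ℕ}
    {N : Type v} [CommGroup N] [TopologicalSpace N]
    {H : Type w} [CommGroup H] [TopologicalSpace H]
    {E : Type u} [Group E] [TopologicalSpace E]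
    (S : GroupExtension N E H)

lemma GroupExtension.mem_range_inl_iff {N : Type*} {E : Type*} {H : Type*} [Group N] [Group E]
    [Group H] (S : GroupExtension N E H) {x : E} : x ∈ S.inl.range ↔ S.rightHom x = 1 := by
  rw [S.range_inl_eq_ker_rightHom, MonoidHom.mem_ker]

variable (eN : N ≃ₜ* Multiplicative (Fin r → ℤ_[p])) (eH : H ≃ₜ* Multiplicative (Fin s → ℤ_[p]))
  (hinl : Continuous S.inl) (hright : Continuous S.rightHom)
  (hcent : S.inl.range ≤ Subgroup.center E)

/-- A lift of a basis of the quotient of an extension. -/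
noncomputable def liftBasis (l : Fin s) : E :=
  (S.rightHom_surjective (FreeProP.basis eH l)).choose

omit [TopologicalSpace N] [TopologicalSpace E] in
lemma rightHom_liftBasis (l : Fin s) : S.rightHom (liftBasis S eH l) = FreeProP.basis eH l :=
  (S.rightHom_surjective (FreeProP.basis eH l)).choose_spec

variable [IsTopologicalGroup E] [CompactSpace E]

section
include hright eH

omit [TopologicalSpace N] [IsTopologicalGroup E] in
lemma isQuotientMap_rightHom : Topology.IsQuotientMap S.rightHom := by
  have : T2Space H := eH.toHomeomorph.isEmbedding.t2Space
  exact hright.isClosedMap.isQuotientMap hright S.rightHom_surjective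

omit [TopologicalSpace N] [IsTopologicalGroup E] in
lemma isOpen_map_rightHom {K : Subgroup E} (hK : IsOpen (K : Set E)) (h : S.inl.range ≤ K) :
    IsOpen (K.map S.rightHom : Set H) := by
  rw [← (isQuotientMap_rightHom S eH hright).isOpen_preimage]
  have h1 : (S.rightHom ⁻¹' (K.map S.rightHom : Set H) : Set E) = K := by
    rw [← Subgroup.coe_comap, Subgroup.comap_map_eq, ← S.range_inl_eq_ker_rightHom,
      sup_eq_left.2 h]
  rwa [h1]

end

/-- Generators of a central extension of free abelian pro-`p` groups: the bases. -/
@[simps ν ε]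
noncomputable def extGens : CentralGens p E r s where
  Z := S.inl.range
  ν l := S.inl (FreeProP.basis eN l)
  ε := liftBasis S eH
  central := hcent
  ν_mem l := ⟨_, rfl⟩
  ν_gen K hK h := by
    have h1 := FreeProP.eq_top_of_isOpen eN (K := K.comap S.inl) (hK.preimage hinl) h
    rintro _ ⟨n, rfl⟩
    have h2 : n ∈ K.comap S.inl := by rw [h1]; trivial
    exact h2
  ε_gen K hK hZ h := by
    have h1 := FreeProP.eq_top_of_isOpen eH (isOpen_map_rightHom S eH hright hK hZ)
      fun l => ⟨_, h l, rightHom_liftBasis S eH l⟩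
    have h2 := Subgroup.comap_map_eq S.rightHom K
    rw [h1, Subgroup.comap_top, ← S.range_inl_eq_ker_rightHom, sup_eq_left.2 hZ] at h2
    exact h2.symm
  ε_comm l l' := by
    refine ⟨liftBasis S eH l * liftBasis S eH l' * (liftBasis S eH l' * liftBasis S eH l)⁻¹, ?_,
      by group⟩
    rw [S.mem_range_inl_iff, map_mul, map_mul, map_inv, map_mul, mul_comm, mul_comm (S.rightHom _),
      inv_mul_cancel]
  pow_mem K hK g := by
    have hcomm : ∀ n g, S.inl n * g = g * S.inl n := fun n g =>
      (Subgroup.mem_center_iff.1 (hcent ⟨n, rfl⟩) g).symm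
    have h1 : IsOpen ((S.inl.range ⊔ K : Subgroup E) : Set E) :=
      Subgroup.isOpen_mono le_sup_right hK
    obtain ⟨m, hm⟩ := FreeProP.exists_pow_mem eH
      (isOpen_map_rightHom S eH hright h1 le_sup_left) (S.rightHom g)
    have h2 : g ^ p ^ m ∈ S.inl.range ⊔ K := by
      rw [← map_pow, ← Subgroup.mem_comap, Subgroup.comap_map_eq, ← S.range_inl_eq_ker_rightHom,
        sup_eq_left.2 le_sup_left] at hm
      exact hm
    rw [Subgroup.mem_sup_of_normal_left] at h2
    obtain ⟨_, ⟨n, rfl⟩, κ, hκ, e⟩ := h2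
    obtain ⟨m', hm'⟩ := FreeProP.exists_pow_mem eN (K := K.comap S.inl) (hK.preimage hinl) n
    refine ⟨m + m', ?_⟩
    rw [pow_add, pow_mul, ← e, (show Commute (S.inl n) κ from hcomm n κ).mul_pow]
    rw [Subgroup.mem_comap, map_pow] at hm'
    exact K.mul_mem hm' (K.pow_mem hκ _)

lemma coords_extGens [T2Space E] [TotallyDisconnectedSpace E] (m : ℕ) :
    (extGens S eN eH hinl hright hcent).Coords (p ^ m) where
  exists_left l := by
    have : CompactSpace N := eN.toHomeomorph.symm.compactSpace
    obtain ⟨U, hU, hUN⟩ := (hinl.isClosedEmbedding S.inl_injective).isInducing.isOpen_iff.1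
      ((FreeProP.isLocallyConstant_coord eN m l).isOpen_fiber 1)
    obtain ⟨K, hK⟩ := ProfiniteGrp.exist_openNormalSubgroup_sub_open_nhds_of_one (G := E) hU (by
      have h1 : (1 : N) ∈ S.inl ⁻¹' U := by rw [hUN]; exact map_one (FreeProP.coord eN m l)
      simpa using h1)
    obtain ⟨τ, h1, h2⟩ := exists_equivariant hcent (FreeProP.coord eN m l) (K := K.toSubgroup)
      K.isOpen' fun a ha => by
        have h3 : a ∈ S.inl ⁻¹' U := hK ha
        rw [hUN] at h3
        exact h3
    refine ⟨τ, h1, fun x => ?_, fun l' hl x => ?_⟩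
    · rw [extGens_ν, h2, FreeProP.coord_basis, if_pos rfl]
    · rw [extGens_ν, h2, FreeProP.coord_basis, if_neg hl, add_zero]
  exists_right l := by
    refine ⟨fun x => (FreeProP.coord eH m l (S.rightHom x)).toAdd,
      ((FreeProP.isLocallyConstant_coord eH m l).comp_continuous hright).comp _,
      fun x => ?_, fun l' hl x => ?_, ?_⟩
    · beta_reduce
      rw [extGens_ε, map_mul, map_mul, toAdd_mul, rightHom_liftBasis, FreeProP.coord_basis,
        if_pos rfl, add_comm]
    · beta_reduce
      rw [extGens_ε, map_mul, map_mul, toAdd_mul, rightHom_liftBasis, FreeProP.coord_basis,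
        if_neg hl, zero_add]
    · rintro _ ⟨n, rfl⟩ x
      beta_reduce
      rw [map_mul, S.rightHom_inl, one_mul]

end extension

/-! ### The weight automorphism of a finite Heisenberg group -/

section heisenberg
variable {N : Type v} {E : Type u} {H : Type w} [CommGroup N] [Group E] [CommGroup H]
  {S : GroupExtension N E H} (σ : S.Section)

/-- The coordinates `inl n * σ h` on an extension with a set-theoretic section. -/
noncomputable def sectionEquiv : N × H ≃ E :=
  Equiv.ofBijective (fun x => S.inl x.1 * σ.toFun x.2) <| by
    have hσ : ∀ h, S.rightHom (σ.toFun h) = h := σ.rightInverse_rightHom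
    constructor
    · rintro ⟨n, h⟩ ⟨n', h'⟩ e
      have h1 := congrArg S.rightHom e
      simp only [map_mul, S.rightHom_inl, one_mul, hσ] at h1
      subst h1
      simp only [mul_left_inj] at e
      rw [S.inl_injective e]
    · intro x
      have h1 : x * (σ.toFun (S.rightHom x))⁻¹ ∈ S.inl.range := by
        rw [S.mem_range_inl_iff, map_mul, map_inv, hσ, mul_inv_cancel]
      obtain ⟨n, hn⟩ := h1
      exact ⟨(n, S.rightHom x), by simp [hn]⟩

lemma sectionEquiv_apply (n : N) (h : H) : sectionEquiv σ (n, h) = S.inl n * σ.toFun h := rfl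

lemma rightHom_sectionEquiv (n : N) (h : H) : S.rightHom (sectionEquiv σ (n, h)) = h := by
  rw [sectionEquiv_apply, map_mul, S.rightHom_inl, one_mul]
  exact σ.rightInverse_rightHom h

variable (hcent : S.inl.range ≤ Subgroup.center E) {c : H →* H →* N}
  (hc : ∀ h₁ h₂ : H, σ.toFun h₁ * σ.toFun h₂ = S.inl (c h₁ h₂) * σ.toFun (h₁ * h₂))
include hc

lemma sectionEquiv_one : sectionEquiv σ (1, 1) = 1 := by
  have h := hc 1 1
  rw [map_one, map_one, one_mul, one_mul, mul_eq_right] at h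
  rw [sectionEquiv_apply, h, map_one, one_mul]

lemma sectionEquiv_inl (n : N) : sectionEquiv σ (n, 1) = S.inl n := by
  have h := sectionEquiv_one σ hc
  rw [sectionEquiv_apply, map_one, one_mul] at h
  rw [sectionEquiv_apply, h, mul_one]

include hcent in
lemma sectionEquiv_mul (n n' : N) (h h' : H) :
    sectionEquiv σ (n, h) * sectionEquiv σ (n', h') = sectionEquiv σ (n * n' * c h h', h * h') := by
  have hcomm : σ.toFun h * S.inl n' = S.inl n' * σ.toFun h :=
    Subgroup.mem_center_iff.1 (hcent ⟨n', rfl⟩) _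
  simp only [sectionEquiv_apply]
  rw [mul_assoc, ← mul_assoc (σ.toFun h), hcomm, mul_assoc, hc]
  simp only [map_mul, mul_assoc]

/-- Multiplication by `L` on the quotient and by `L ^ 2` on the central subgroup. This is a
homomorphism since the factor set is bilinear. -/
noncomputable def scaleHom (L : ℕ) : E →* E where
  toFun x := sectionEquiv σ
    (((sectionEquiv σ).symm x).1 ^ L ^ 2, ((sectionEquiv σ).symm x).2 ^ L)
  map_one' := by
    rw [← sectionEquiv_one σ hc, Equiv.symm_apply_apply, one_pow, one_pow]
  map_mul' x y := by
    obtain ⟨⟨n, h⟩, rfl⟩ := (sectionEquiv σ).surjective x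
    obtain ⟨⟨n', h'⟩, rfl⟩ := (sectionEquiv σ).surjective y
    rw [sectionEquiv_mul σ hcent hc, Equiv.symm_apply_apply, Equiv.symm_apply_apply,
      Equiv.symm_apply_apply, sectionEquiv_mul σ hcent hc]
    simp only [mul_pow, map_pow, MonoidHom.pow_apply]
    rw [← pow_mul, sq]

lemma scaleHom_apply (L : ℕ) (n : N) (h : H) :
    scaleHom σ hcent hc L (sectionEquiv σ (n, h)) = sectionEquiv σ (n ^ L ^ 2, h ^ L) := by
  change sectionEquiv σ _ = _
  rw [Equiv.symm_apply_apply]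

lemma scaleHom_inl (L : ℕ) (n : N) : scaleHom σ hcent hc L (S.inl n) = S.inl n ^ L ^ 2 := by
  rw [← sectionEquiv_inl σ hc, scaleHom_apply, one_pow, sectionEquiv_inl σ hc,
    sectionEquiv_inl σ hc, map_pow]

lemma rightHom_scaleHom (L : ℕ) (x : E) :
    S.rightHom (scaleHom σ hcent hc L x) = S.rightHom x ^ L := by
  obtain ⟨⟨n, h⟩, rfl⟩ := (sectionEquiv σ).surjective x
  rw [scaleHom_apply, rightHom_sectionEquiv, rightHom_sectionEquiv]

lemma scaleHom_iterate (L j : ℕ) (n : N) (h : H) :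
    (scaleHom σ hcent hc L)^[j] (sectionEquiv σ (n, h)) =
      sectionEquiv σ (n ^ (L ^ 2) ^ j, h ^ L ^ j) := by
  induction j with
  | zero => simp
  | succ j ih =>
    rw [Function.iterate_succ_apply', ih, scaleHom_apply, ← pow_mul n, ← pow_mul h, ← pow_succ,
      ← pow_succ]

end heisenberg

lemma pow_eq_self_of_natCast {p : ℕ} {A : Type*} [Group A] {a : A} (ha : a ^ p = 1) {m : ℕ}
    (hm : (m : ZMod p) = 1) : a ^ m = a := by
  have h1 : m ≡ 1 [MOD p] := (ZMod.natCast_eq_natCast_iff _ _ _).1 (by rw [hm, Nat.cast_one])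
  rw [← pow_one a, ← pow_mul, one_mul]
  exact pow_eq_pow_iff_modEq.2 (h1.of_dvd (orderOf_dvd_of_pow_eq_one ha))

/-! ### Reduction modulo `p` -/

section reduction
variable {p : ℕ} [Fact p.Prime] {r s : ℕ}
    {N : Type v} [CommGroup N] [TopologicalSpace N]
    {H : Type w} [CommGroup H] [TopologicalSpace H]
    {E : Type u} [Group E] [TopologicalSpace E] [IsTopologicalGroup E]
    [CompactSpace E] {S : GroupExtension N E H}
    {N' : Type v'} [CommGroup N'] {H' : Type w'} [CommGroup H']
    {E' : Type u} [Group E'] [TopologicalSpace E'] [IsTopologicalGroup E'] [DiscreteTopology E']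
    {S' : GroupExtension N' E' H'}
    {fN : N →* N'} {fE : E →ₜ* E'} {fH : H →* H'}

omit [Fact p.Prime] [TopologicalSpace N] [TopologicalSpace H] [IsTopologicalGroup E]
  [CompactSpace E] [IsTopologicalGroup E'] [DiscreteTopology E'] in
lemma IsModPReduction.surjective (hred : IsModPReduction p S S' fN fE fH) :
    Function.Surjective fE := by
  intro x
  obtain ⟨h, hh⟩ := hred.surjective_right (S'.rightHom x)
  obtain ⟨y, rfl⟩ := S.rightHom_surjective h
  have h1 : x * (fE y)⁻¹ ∈ S'.inl.range := by
    rw [S'.mem_range_inl_iff, map_mul, map_inv, hred.comm_rightHom, hh, mul_inv_cancel]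
  obtain ⟨n', hn'⟩ := h1
  obtain ⟨n, rfl⟩ := hred.surjective_left n'
  refine ⟨S.inl n * y, ?_⟩
  rw [map_mul, hred.comm_inl, hn', inv_mul_cancel_right]

omit [Fact p.Prime] in
lemma IsFiniteHeisenberg.finite {N : Type v} {E : Type u} {H : Type w} [CommGroup N]
    [Group E] [CommGroup H] {S : GroupExtension N E H} (h : IsFiniteHeisenberg p S) :
    Finite E := by
  obtain ⟨c, -, σ, -⟩ := h.exists_alternating
  have := h.finite_left
  have := h.finite_right
  exact Finite.of_equiv _ (sectionEquiv σ)

/-- The coordinates modulo `p` of a free abelian pro-`p` group descend to its reduction. -/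
lemma FreeProP.exists_coord {A : Type*} [CommGroup A] [TopologicalSpace A] {A' : Type*}
    [CommGroup A'] (e : A ≃ₜ* Multiplicative (Fin r → ℤ_[p])) {f : A →* A'}
    (hf : Function.Surjective f) (hker : f.ker = (powMonoidHom p : A →* A).range) (l : Fin r) :
    ∃ c : A' →* Multiplicative (ZMod (p ^ 1)), ∀ l',
      (c (f (FreeProP.basis e l'))).toAdd = if l' = l then 1 else 0 := by
  refine ⟨f.liftOfSurjective hf ⟨FreeProP.coord e 1 l, ?_⟩, fun l' => ?_⟩
  · rw [hker]
    rintro _ ⟨a, rfl⟩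
    have h1 : powMonoidHom p a = a ^ p ^ 1 := by rw [pow_one]; rfl
    rw [MonoidHom.mem_ker, h1, FreeProP.coord_pow]
  · rw [← FreeProP.coord_basis e 1 l l']
    congr 1
    exact MonoidHom.liftOfRightInverse_comp_apply _ _ _ _ _

variable (eN : N ≃ₜ* Multiplicative (Fin r → ℤ_[p])) (eH : H ≃ₜ* Multiplicative (Fin s → ℤ_[p]))
  (hinl : Continuous S.inl) (hright : Continuous S.rightHom)
  (hcent : S.inl.range ≤ Subgroup.center E) (hred : IsModPReduction p S S' fN fE fH)

/-- Generators of the reduction: the images of the bases. -/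
noncomputable def redGens : CentralGens p E' r s :=
  (extGens S eN eH hinl hright hcent).map fE fE.continuous_toFun hred.surjective

omit [IsTopologicalGroup E'] [DiscreteTopology E'] in
lemma isMap_redGens :
    CentralGens.IsMap (extGens S eN eH hinl hright hcent)
      (redGens eN eH hinl hright hcent hred) (fE : E →* E') :=
  CentralGens.isMap_map _ _ _ _

omit [IsTopologicalGroup E'] [DiscreteTopology E'] in
lemma redGens_Z : (redGens eN eH hinl hright hcent hred).Z = S'.inl.range := by
  ext x
  constructor
  · rintro ⟨_, ⟨n, rfl⟩, rfl⟩
    exact ⟨fN n, (hred.comm_inl n).symm⟩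
  · rintro ⟨n', rfl⟩
    obtain ⟨n, rfl⟩ := hred.surjective_left n'
    exact ⟨_, ⟨n, rfl⟩, hred.comm_inl n⟩

omit [IsTopologicalGroup E'] [DiscreteTopology E'] in
lemma redGens_ν (l : Fin r) :
    (redGens eN eH hinl hright hcent hred).ν l = S'.inl (fN (FreeProP.basis eN l)) :=
  hred.comm_inl _

omit [IsTopologicalGroup E'] [DiscreteTopology E'] in
lemma rightHom_redGens_ε (l : Fin s) :
    S'.rightHom ((redGens eN eH hinl hright hcent hred).ε l) = fH (FreeProP.basis eH l) := by
  rw [← rightHom_liftBasis S eH]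
  exact hred.comm_rightHom _

lemma coords_redGens : (redGens eN eH hinl hright hcent hred).Coords p := by
  have h : (redGens eN eH hinl hright hcent hred).Coords (p ^ 1) := by
    refine ⟨fun l => ?_, fun l => ?_⟩
    · obtain ⟨c, hc⟩ := FreeProP.exists_coord eN hred.surjective_left hred.ker_left l
      obtain ⟨τ, h1, h2⟩ := exists_equivariant hred.heisenberg.central c
        (K := ⊥) (isOpen_discrete _) fun a ha => by
          rw [Subgroup.mem_bot] at ha
          rw [S'.inl_injective (ha.trans (map_one _).symm), map_one]
      refine ⟨τ, h1, fun x => ?_, fun l' hl x => ?_⟩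
      · rw [redGens_ν, h2, hc, if_pos rfl]
      · rw [redGens_ν, h2, hc, if_neg hl, add_zero]
    · obtain ⟨c, hc⟩ := FreeProP.exists_coord eH hred.surjective_right hred.ker_right l
      refine ⟨fun x => (c (S'.rightHom x)).toAdd, IsLocallyConstant.of_discrete _,
        fun x => ?_, fun l' hl x => ?_, fun z hz x => ?_⟩
      · beta_reduce
        rw [map_mul, map_mul, toAdd_mul, rightHom_redGens_ε, hc, if_pos rfl, add_comm]
      · beta_reduce
        rw [map_mul, map_mul, toAdd_mul, rightHom_redGens_ε, hc, if_neg hl, zero_add]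
      · beta_reduce
        rw [redGens_Z, S'.mem_range_inl_iff] at hz
        rw [map_mul, hz, one_mul]
  rwa [pow_one] at h

omit [IsTopologicalGroup E'] [DiscreteTopology E'] in
lemma redGens_ν_pow (l : Fin r) : (redGens eN eH hinl hright hcent hred).ν l ^ p = 1 := by
  rw [redGens_ν, ← map_pow, hred.heisenberg.pow_left, map_one]

omit [IsTopologicalGroup E'] [DiscreteTopology E'] in
lemma redGens_ε_pow (l : Fin s) :
    (redGens eN eH hinl hright hcent hred).ε l ^ p ∈ (redGens eN eH hinl hright hcent hred).Z := by
  rw [redGens_Z, S'.mem_range_inl_iff, map_pow, hred.heisenberg.pow_right]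

omit [IsTopologicalGroup E'] in
lemma exists_isScaling {L : ℕ} (hL : (L : ZMod p) ≠ 0) :
    ∃ ℓ : E' →* E', (redGens eN eH hinl hright hcent hred).IsScaling ℓ L := by
  obtain ⟨c, -, σ, hc⟩ := hred.heisenberg.exists_alternating
  have hcent' := hred.heisenberg.central
  refine ⟨scaleHom σ hcent' hc L, continuous_of_discreteTopology, fun z hz => ?_, fun l => ?_,
    fun l => ?_, ?_⟩
  · rw [redGens_Z] at hz ⊢
    obtain ⟨n, rfl⟩ := hz
    exact ⟨n ^ L ^ 2, by rw [scaleHom_inl, map_pow]⟩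
  · rw [redGens_ν, scaleHom_inl]
  · set ε := (redGens eN eH hinl hright hcent hred).ε l
    refine ⟨scaleHom σ hcent' hc L ε * (ε ^ L)⁻¹, ?_, by group⟩
    rw [redGens_Z, S'.mem_range_inl_iff, map_mul, map_inv, rightHom_scaleHom, map_pow,
      mul_inv_cancel]
  · funext x
    obtain ⟨⟨n, h⟩, rfl⟩ := (sectionEquiv σ).surjective x
    have h1 : (L : ZMod p) ^ (p - 1) = 1 := ZMod.pow_card_sub_one_eq_one hL
    rw [scaleHom_iterate, pow_eq_self_of_natCast (hred.heisenberg.pow_left n),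
      pow_eq_self_of_natCast (hred.heisenberg.pow_right h)]
    · rfl
    · rw [Nat.cast_pow, h1]
    · rw [Nat.cast_pow, Nat.cast_pow, ← pow_mul, mul_comm, pow_mul, h1, one_pow]

end reduction

/-- A primitive root modulo `p`. -/
lemma exists_primitive_root (p : ℕ) [Fact p.Prime] : ∃ L : ℕ, (L : ZMod p) ≠ 0 ∧
    ∀ δ : ℕ, (L : ZMod p) ^ δ = 1 → p - 1 ∣ δ := by
  obtain ⟨g, hg⟩ := IsCyclic.exists_generator (α := (ZMod p)ˣ)
  have h1 : (((g : ZMod p).val : ℕ) : ZMod p) = g := ZMod.natCast_zmod_val _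
  refine ⟨(g : ZMod p).val, by rw [h1]; exact g.ne_zero, fun δ hδ => ?_⟩
  rw [h1] at hδ
  have h2 := orderOf_dvd_of_pow_eq_one (x := g) (n := δ) (Units.ext (by simpa using hδ))
  rwa [orderOf_eq_card_of_forall_mem_zpowers hg, Nat.card_eq_fintype_card,
    ZMod.card_units_eq_totient, Nat.totient_prime Fact.out] at h2

/-! ### Continuous cohomology with coefficients in `𝔽_p` -/

/-- A map of complexes of topological modules is surjective on cohomology if every cocycle is
cohomologous to the image of a cocycle. -/
lemma TopModuleCat.homologyMap_surjective {R : Type u} [Ring R] [TopologicalSpace R]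
    {K L : CochainComplex (TopModuleCat.{v} R) ℕ} (φ : K ⟶ L) (n : ℕ)
    (h : ∀ z : L.X n, (L.d n (n + 1)).hom z = 0 → ∃ c : K.X n, (K.d n (n + 1)).hom c = 0 ∧
      ∃ (m : ℕ) (y : L.X m), (φ.f n).hom c - z = (L.d m n).hom y) :
    Function.Surjective (HomologicalComplex.homologyMap φ n) := by
  have hepi : Function.Surjective (L.homologyπ n).hom := by
    have h1 : Epi ((forget₂ (TopModuleCat.{v} R) (ModuleCat R)).map (L.homologyπ n)) :=
      inferInstance
    exact (ModuleCat.epi_iff_surjective _).1 h1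
  have hmono : Function.Injective (L.iCycles n).hom := by
    have h1 : Mono ((forget₂ (TopModuleCat.{v} R) (ModuleCat R)).map (L.iCycles n)) := inferInstance
    exact (ModuleCat.mono_iff_injective _).1 h1
  intro x
  obtain ⟨z, rfl⟩ := hepi x
  have hz : (L.d n (n + 1)).hom ((L.iCycles n).hom z) = 0 :=
    ConcreteCategory.congr_hom (L.iCycles_d n (n + 1)) z
  obtain ⟨c, hc, m, y, e⟩ := h _ hz
  let l := K.liftCycles (TopModuleCat.kerι (K.d n (n + 1))) (n + 1) (by simp)
    (TopModuleCat.kerι_comp _)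
  let c' : TopModuleCat.ker (K.d n (n + 1)) := ⟨c, hc⟩
  refine ⟨(K.homologyπ n).hom (l.hom c'), ?_⟩
  have h1 : (L.iCycles n).hom ((HomologicalComplex.cyclesMap φ n).hom (l.hom c')) =
      (φ.f n).hom c := by
    have h2 := ConcreteCategory.congr_hom (HomologicalComplex.cyclesMap_i φ n) (l.hom c')
    have h3 := ConcreteCategory.congr_hom
      (K.liftCycles_i (TopModuleCat.kerι (K.d n (n + 1))) (n + 1) (by simp)
        (TopModuleCat.kerι_comp _)) c'
    exact h2.trans (congrArg (φ.f n).hom h3)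
  have h4 : (HomologicalComplex.cyclesMap φ n).hom (l.hom c') = z + (L.toCycles m n).hom y := by
    apply hmono
    have h5 : (L.iCycles n).hom ((L.toCycles m n).hom y) = (L.d m n).hom y :=
      ConcreteCategory.congr_hom (L.toCycles_i m n) y
    rw [h1, map_add, h5, ← e]
    abel
  have h6 := ConcreteCategory.congr_hom (HomologicalComplex.homologyπ_naturality φ n) (l.hom c')
  have h7 : (L.homologyπ n).hom ((L.toCycles m n).hom y) = 0 :=
    ConcreteCategory.congr_hom (L.toCycles_comp_homologyπ m n) y
  refine h6.trans ?_
  change (L.homologyπ n).hom ((HomologicalComplex.cyclesMap φ n).hom (l.hom c')) = _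
  rw [h4, map_add, h7, add_zero]

lemma discreteTopology_continuousMap (X Y : Type*) [TopologicalSpace X] [CompactSpace X]
    [TopologicalSpace Y] [DiscreteTopology Y] : DiscreteTopology C(X, Y) := by
  refine discreteTopology_iff_isOpen_singleton.2 fun f => ?_
  have hf : IsLocallyConstant f := IsLocallyConstant.iff_continuous f |>.2 f.continuous
  have h1 : ({f} : Set C(X, Y)) = ⋂ y ∈ Set.range f,
      {g : C(X, Y) | Set.MapsTo g (f ⁻¹' {y}) {y}} := by
    ext g
    simp only [Set.mem_singleton_iff, Set.mem_iInter, Set.mem_ofPred_eq]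
    constructor
    · rintro rfl y _ x hx
      exact hx
    · intro h
      ext x
      exact h (f x) ⟨x, rfl⟩ rfl
  rw [h1]
  refine hf.range_finite.isOpen_biInter fun y _ => ?_
  exact ContinuousMap.isOpen_setOfPred_mapsTo (hf.isClosed_fiber y).isCompact (isOpen_discrete _)

section bridge
variable (p : ℕ) [Fact p.Prime] {G G' : Type u} [Group G] [TopologicalSpace G]
  [IsTopologicalGroup G] [Group G'] [TopologicalSpace G'] [IsTopologicalGroup G']

open TopRep

instance discreteTopology_resolutionX [CompactSpace G] :
    ∀ n, DiscreteTopology (resolutionX (trivialFp p G) n)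
  | 0 => inferInstanceAs (DiscreteTopology (ULift.{u} (ZMod p)))
  | n + 1 =>
    have := discreteTopology_resolutionX n
    discreteTopology_continuousMap G (resolutionX (trivialFp p G) n)

/-- The iterated function underlying an element of the resolution. -/
noncomputable def toCo : ∀ n, resolutionX (trivialFp p G) n →ₗ[ZMod p] Co (ULift.{u} (ZMod p)) G n
  | 0 => LinearMap.id
  | n + 1 =>
    { toFun := fun (φ : C(G, resolutionX (trivialFp p G) n)) x => toCo n (φ x)
      map_add' := fun _ _ => by
        funext x
        exact map_add (toCo n) _ _
      map_smul' := fun _ _ => by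
        funext x
        exact map_smul (toCo n) _ _ }

lemma toCo_succ {n : ℕ} (φ : C(G, resolutionX (trivialFp p G) n)) (x : G) :
    toCo p (n + 1) φ x = toCo p n (φ x) := rfl

lemma toCo_injective : ∀ n, Function.Injective (toCo p (G := G) n)
  | 0 => Function.injective_id
  | n + 1 => fun _ _ h => ContinuousMap.ext fun x => toCo_injective n (congrFun h x)

lemma toCo_d : ∀ n (φ : resolutionX (trivialFp p G) n),
    toCo p (n + 1) ((d (trivialFp p G) n).hom φ) = Co.dd (ZMod p) n (toCo p n φ)
  | 0, _ => rfl
  | n + 1, φ => by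
    funext x
    rw [Co.dd_succ_apply, toCo_succ p φ, ← toCo_d, ← map_sub]
    rfl

lemma toCo_act : ∀ n (g : G) (φ : resolutionX (trivialFp p G) n),
    toCo p n ((resolutionX (trivialFp p G) n).ρ g φ) = Co.act (ZMod p) g n (toCo p n φ)
  | 0, _, _ => rfl
  | n + 1, g, φ => by
    funext x
    rw [Co.act_succ_apply, toCo_succ p φ, ← toCo_act]
    rfl

lemma toCo_pull (f : G →ₜ* G') : ∀ n (φ : resolutionX (trivialFp p G') n),
    toCo p n ((ContinuousCohomology.resolutionMap (X := trivialFp p G') (Y := trivialFp p G) f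
      (TopRep.ofHom ⟨ContinuousLinearMap.id _ _, fun _ => rfl⟩) n).hom φ) =
        Co.pull (ZMod p) f n (toCo p n φ)
  | 0, _ => rfl
  | n + 1, φ => by
    funext x
    rw [Co.pull_succ_apply, toCo_succ p φ, ← toCo_pull]
    rfl

lemma toCo_mem [CompactSpace G] : ∀ n (φ : resolutionX (trivialFp p G) n),
    toCo p n φ ∈ Co.Lc (ZMod p) (ULift.{u} (ZMod p)) G n
  | 0, _ => Submodule.mem_top
  | n + 1, φ =>
    ⟨((IsLocallyConstant.iff_continuous _).2 (ContinuousMap.continuous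
      (φ : C(G, resolutionX (trivialFp p G) n)))).comp (toCo p n), fun _ => toCo_mem n _⟩

lemma exists_toCo_eq [CompactSpace G] : ∀ n (ψ : Co (ULift.{u} (ZMod p)) G n),
    ψ ∈ Co.Lc (ZMod p) (ULift.{u} (ZMod p)) G n → ∃ φ, toCo p n φ = ψ
  | 0, ψ, _ => ⟨ψ, rfl⟩
  | n + 1, ψ, h => by
    choose φ hφ using fun x => exists_toCo_eq n (ψ x) (h.2 x)
    have hc : IsLocallyConstant φ := by
      refine (IsLocallyConstant.iff_eventually_eq _).2 fun x => ?_
      filter_upwards [(IsLocallyConstant.iff_eventually_eq _).1 h.1 x] with y hy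
      exact toCo_injective p n (by rw [hφ, hφ, hy])
    exact ⟨(⟨φ, hc.continuous⟩ : C(G, resolutionX (trivialFp p G) n)), funext hφ⟩

variable [CompactSpace G] [CompactSpace G']

/-- The cochain in the complex of locally constant cochains that belongs to a homogeneous
cochain. -/
noncomputable def toTot (n : ℕ) (σ : (homogeneousCochains (trivialFp p G)).X n) :
    Tot (ULift.{u} (ZMod p)) G := Tot.single n (toCo p (n + 1) σ.1)

omit [CompactSpace G] in
lemma toTot_same (n : ℕ) (σ : (homogeneousCochains (trivialFp p G)).X n) :
    toTot p n σ n = toCo p (n + 1) σ.1 := Tot.single_same _ _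

lemma toTot_mem (n : ℕ) (σ : (homogeneousCochains (trivialFp p G)).X n) :
    toTot p n σ ∈ (lcCx (ZMod p) (ULift.{u} (ZMod p)) G).G n :=
  Tot.single_mem (toCo_mem p (n + 1) σ.1)

lemma toTot_sub (n : ℕ) (σ τ : (homogeneousCochains (trivialFp p G)).X n) :
    toTot p n (σ - τ) = toTot p n σ - toTot p n τ := by
  refine Tot.ext_of_mem (toTot_mem p n _) (sub_mem (toTot_mem p n _) (toTot_mem p n _)) ?_
  rw [Pi.sub_apply, toTot_same, toTot_same, toTot_same, ← map_sub]
  rfl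

omit [CompactSpace G] in
lemma toTot_injective (n : ℕ) : Function.Injective (toTot p (G := G) n) := fun σ τ h =>
  Subtype.ext (toCo_injective p (n + 1) (by rw [← toTot_same, h, toTot_same]))

lemma toTot_act (n : ℕ) (σ : (homogeneousCochains (trivialFp p G)).X n) (g : G) :
    Tot.act (ZMod p) g (toTot p n σ) = toTot p n σ := by
  refine Tot.ext_of_mem (Tot.act_mem g (toTot_mem p n σ)) (toTot_mem p n σ) ?_
  rw [Tot.act_apply, toTot_same, ← toCo_act]
  exact congrArg _ (σ.2 g)

lemma toTot_d (n : ℕ) (σ : (homogeneousCochains (trivialFp p G)).X n) :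
    toTot p (n + 1) (((homogeneousCochains (trivialFp p G)).d n (n + 1)).hom σ) =
      Tot.d (ZMod p) (toTot p n σ) := by
  refine Tot.ext_of_mem (toTot_mem p (n + 1) _)
    (by exact_mod_cast (lcCx _ _ G).d_mem (toTot_mem p n σ)) ?_
  rw [toTot_same, Tot.d_succ, toTot_same, homogeneousCochains.d_apply, toCo_d]

lemma toTot_pull (f : G →ₜ* G') (n : ℕ) (σ : (homogeneousCochains (trivialFp p G')).X n) :
    toTot p n (((ContinuousCohomology.cochainsMap (X := trivialFp p G') (Y := trivialFp p G) f
      (TopRep.ofHom ⟨ContinuousLinearMap.id _ _, fun _ => rfl⟩)).f n).hom σ) =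
        Tot.pull (ZMod p) f (toTot p n σ) := by
  refine Tot.ext_of_mem (toTot_mem p n _)
    (Tot.pull_mem f.continuous_toFun (toTot_mem p n σ)) ?_
  rw [toTot_same, Tot.pull_apply, toTot_same]
  exact toCo_pull p f (n + 1) σ.1

lemma exists_toTot_eq (n : ℕ) {φ : Tot (ULift.{u} (ZMod p)) G}
    (hφ : φ ∈ (lcCx (ZMod p) (ULift.{u} (ZMod p)) G).G n)
    (hinv : ∀ g, Tot.act (ZMod p) g φ = φ) : ∃ σ, toTot p n σ = φ := by
  obtain ⟨σ, hσ⟩ := exists_toCo_eq p (n + 1) (φ n) (hφ n).1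
  refine ⟨⟨σ, fun g => toCo_injective p (n + 1) ?_⟩, ?_⟩
  · rw [toCo_act, hσ]
    exact congrFun (hinv g) n
  · refine Tot.ext_of_mem (toTot_mem p n _) hφ ?_
    exact (toTot_same p n _).trans hσ

/-- Surjectivity on continuous cohomology in terms of locally constant invariant cochains. -/
theorem cohFpMap_surjective (f : G →ₜ* G') (n : ℕ)
    (h : ∀ φ ∈ (lcCx (ZMod p) (ULift.{u} (ZMod p)) G).G n, (∀ g, Tot.act (ZMod p) g φ = φ) →
      Tot.d (ZMod p) φ = 0 →
      ∃ c ∈ (lcCx (ZMod p) (ULift.{u} (ZMod p)) G').G n, (∀ g, Tot.act (ZMod p) g c = c) ∧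
        Tot.d (ZMod p) c = 0 ∧ ∃ y ∈ (lcCx (ZMod p) (ULift.{u} (ZMod p)) G).G (n - 1),
          (∀ g, Tot.act (ZMod p) g y = y) ∧ Tot.pull (ZMod p) f c - φ = Tot.d (ZMod p) y) :
    Function.Surjective (cohFpMap p f n) := by
  refine TopModuleCat.homologyMap_surjective _ n fun z hz => ?_
  have h0 : ∀ {G : Type u} [Group G] [TopologicalSpace G] [IsTopologicalGroup G] [CompactSpace G]
      (m : ℕ), toTot p m (0 : (homogeneousCochains (trivialFp p G)).X m) = 0 := by
    intro G _ _ _ _ m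
    rw [← sub_self 0, toTot_sub, sub_self]
  obtain ⟨c, hc, hcinv, hdc, y, hy, hyinv, e⟩ := h _ (toTot_mem p n z) (toTot_act p n z)
    (by rw [← toTot_d, hz, h0])
  obtain ⟨c, rfl⟩ := exists_toTot_eq p n hc hcinv
  refine ⟨c, toTot_injective p (n + 1) (by rw [toTot_d, hdc, h0]), ?_⟩
  rcases n with _ | n
  · refine ⟨0, 0, toTot_injective p 0 ?_⟩
    have hy0 : y = 0 := (lcCx _ _ G).G_neg (by norm_num) hy
    rw [toTot_sub, toTot_pull, e, hy0, map_zero, map_zero, h0]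
  · obtain ⟨y, rfl⟩ := exists_toTot_eq p n
      (by rwa [show ((n + 1 : ℕ) : ℤ) - 1 = n by push_cast; ring] at hy) hyinv
    refine ⟨n, y, toTot_injective p (n + 1) ?_⟩
    rw [toTot_sub, toTot_pull, e, toTot_d]

end bridge

theorem mainTheorem10 (p : ℕ) [Fact p.Prime] (hp2 : 2 < p) (r s : ℕ)
    {N : Type v} [CommGroup N] [TopologicalSpace N]
    {H : Type w} [CommGroup H] [TopologicalSpace H]
    {E : Type u} [Group E] [TopologicalSpace E] [IsTopologicalGroup E]
    [CompactSpace E] [T2Space E] [TotallyDisconnectedSpace E]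
    (S : GroupExtension N E H) (hS : IsFreeProPCentralExtension p r s S)
    {N' : Type v'} [CommGroup N'] {H' : Type w'} [CommGroup H']
    {E' : Type u} [Group E'] [TopologicalSpace E'] [IsTopologicalGroup E'] [DiscreteTopology E']
    (S' : GroupExtension N' E' H')
    (fN : N →* N') (fE : E →ₜ* E') (fH : H →* H')
    (hred : IsModPReduction p S S' fN fE fH)
    (hp : ((s : ℝ) + 3 * (r : ℝ) + 1) / 2 < (p : ℝ)) :
    ∀ n : ℕ, Function.Surjective (cohFpMap p fE n) := by
  intro n
  obtain ⟨eN⟩ := hS.free_left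
  obtain ⟨eH⟩ := hS.free_right
  have : Finite E' := hred.heisenberg.finite
  obtain ⟨L, hL, hprim⟩ := exists_primitive_root p
  obtain ⟨ℓ, hℓ⟩ := exists_isScaling eN eH hS.continuous_inl hS.continuous_rightHom hS.central
    hred hL
  -- The bound on `p` says that the weights on the relevant range are distinct modulo `p - 1`.
  have hbound : (s : ℤ) + 3 * r - 1 < 2 * (p - 1 : ℕ) := by
    have h1 : (s : ℝ) + 3 * r + 1 < 2 * p := by linarith
    have h2 : (s : ℤ) + 3 * r + 1 < 2 * p := by exact_mod_cast h1
    rw [Nat.cast_sub (by omega)]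
    push_cast
    linarith
  exact cohFpMap_surjective p fE n fun φ hφ hinv hd =>
    CentralGens.exists_pullback hp2
      (isMap_redGens eN eH hS.continuous_inl hS.continuous_rightHom hS.central hred)
      (coords_extGens S eN eH hS.continuous_inl hS.continuous_rightHom hS.central)
      (coords_redGens eN eH hS.continuous_inl hS.continuous_rightHom hS.central hred)
      (redGens_ν_pow eN eH hS.continuous_inl hS.continuous_rightHom hS.central hred)
      (redGens_ε_pow eN eH hS.continuous_inl hS.continuous_rightHom hS.central hred)
      hℓ hL hprim hbound hφ hinv hd
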